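/- A simplicial complex is *flag* if every nonempty finite set of pairwise adjacent vertices spans a simplex, and *flag-no-square* if it is flag and its $1$-skeleton has no induced $4$-cycle. A subcomplex $L$ of $X$ is *full* if every simplex of $X$ all of whose vertices lie in $L$ is a simplex of $L$. A *subdivision* of $X$ is a simplicial complex $X'$ such that every simplex of $X'$ is contained in a simplex of $X$ and every simplex of $X$ is the union of finitely many simplices of $X'$. (1) Let $X$ be a simplicial complex of dimension at most $2$ and let $L$ be a flag-no-square subcomplex of $X$. Then there is a subdivision $X'$ of $X$ that is flag-no-square and contains $L$ (unsubdivided) as a full subcomplex. (2) Let $\Gamma$ be a finite simplicial graph of girth at least $5$ (that is, every cycle in $\Gamma$ has length at least $5$; forests are allowed). Then there is a finite flag-no-square triangulation of a closed connected orientable surface whose $1$-skeleton contains $\Gamma$ as an induced subgraph. -/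

import Mathlib

namespace Geometry.SimplicialComplex

variable {E : Type*} [AddCommGroup E] [Module ℝ E]

/-- The `1`-skeleton of a simplicial complex, as a simple graph on its vertices. -/
def edgeGraph (K : SimplicialComplex ℝ E) : SimpleGraph K.vertices where
  Adj v w := v ≠ w ∧ ∃ s ∈ K.faces, (s : Set E) = {v.1, w.1}
  symm := ⟨fun _ _ h => ⟨h.1.symm, by simpa only [Set.pair_comm] using h.2⟩⟩
  loopless := ⟨fun _ h => h.1 rfl⟩

/-- Every nonempty finite collection of pairwise adjacent vertices spans a simplex. -/
def IsFlag (K : SimplicialComplex ℝ E) : Prop :=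
  ∀ s : Finset K.vertices, s.Nonempty → K.edgeGraph.IsClique (s : Set K.vertices) →
    s.map (Function.Embedding.subtype _) ∈ K.faces

/-- Flag, and without induced `4`-cycles. -/
def IsFlagNoSquare (K : SimplicialComplex ℝ E) : Prop :=
  K.IsFlag ∧ ¬ (SimpleGraph.cycleGraph 4).IsIndContained K.edgeGraph

/-- `L` is a full (induced) subcomplex of `K`: it is a subcomplex, and contains every simplex of `K`
all of whose vertices are in `L`. -/
def IsFullSubcomplex (L K : SimplicialComplex ℝ E) : Prop :=
  L ≤ K ∧ ∀ s ∈ K.faces, (∀ v ∈ s, v ∈ L.vertices) → s ∈ L.faces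

/-- `K'` is a subdivision of `K`: every simplex of `K'` is contained in a simplex of `K`, and every
simplex of `K` is the union of finitely many simplices of `K'`. -/
def IsSubdivision (K' K : SimplicialComplex ℝ E) : Prop :=
  (∀ s ∈ K'.faces, ∃ t ∈ K.faces, convexHull ℝ (s : Set E) ⊆ convexHull ℝ (t : Set E)) ∧
  ∀ t ∈ K.faces, ∃ S : Set (Finset E), S.Finite ∧ S ⊆ K'.faces ∧
    convexHull ℝ (t : Set E) = ⋃ s ∈ S, convexHull ℝ (s : Set E)

/-- `a`, `b`, `c` are the three distinct vertices of a `2`-simplex of `K`. -/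
def IsTriangle (K : SimplicialComplex ℝ E) (a b c : E) : Prop :=
  a ≠ b ∧ b ≠ c ∧ a ≠ c ∧ ∃ s ∈ K.faces, (s : Set E) = {a, b, c}

/-- The `2`-simplices of `K` can be coherently oriented. Here `o a b c` says that the cyclic
order `a → b → c → a` is the chosen orientation of the triangle `abc`; exactly one of the two cyclic
orders of each triangle is chosen, and two distinct triangles with a common edge induce
opposite orientations on that edge. -/
def IsOrientable (K : SimplicialComplex ℝ E) : Prop :=
  ∃ o : E → E → E → Prop,
    (∀ a b c, K.IsTriangle a b c → (o a b c ↔ o b c a)) ∧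
    (∀ a b c, K.IsTriangle a b c → (o a b c ↔ ¬ o b a c)) ∧
    (∀ a b c d, c ≠ d → K.IsTriangle a b c → K.IsTriangle a b d → (o a b c ↔ o b a d))

end Geometry.SimplicialComplex

/-- A closed connected surface: a nonempty, compact, connected Hausdorff space in which every point
has an open neighbourhood homeomorphic to the plane (such a space is second countable). -/
structure IsClosedSurface (M : Type*) [TopologicalSpace M] : Prop where
  t2 : T2Space M
  compact : CompactSpace M
  connected : ConnectedSpace M
  locallyEuclidean : ∀ x : M, ∃ U : Set M, IsOpen U ∧ x ∈ U ∧
    Nonempty (U ≃ₜ EuclideanSpace ℝ (Fin 2))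

/-- The finite complex `K` triangulates a closed connected orientable surface: its underlying space
is a closed connected surface, and its triangles can be coherently oriented. -/
structure Geometry.SimplicialComplex.TriangulatesClosedOrientableSurface {N : ℕ}
    (K : Geometry.SimplicialComplex ℝ (EuclideanSpace ℝ (Fin N))) : Prop where
  finite : K.faces.Finite
  surface : IsClosedSurface K.space
  orientable : K.IsOrientable

/-! For (1), keep the simplices of `L`, cut every edge outside `L` into thirds, and fill every
triangle outside `L` with a disk made of a boundary cycle, an inner cycle of the same length and a
centre. Since `L` is flag, a triangle outside `L` has at most two sides in `L`, so its boundary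
becomes a cycle of length 9, 7 or 5. Thirds are what is needed: with halves, a triangle with two
sides in `L` would get a boundary square. Interior links in the disk are cycles of length at least
5, no edge of the disk joins boundary vertices that lie on no common side, and the boundary
neighbours of an interior vertex are pairwise adjacent.

These finite facts exclude squares and unfilled cliques. The star of a vertex interior to a triangle
stays in that triangle, so a clique with such a vertex lies in one disk; a square with such a vertex
lies in the disk too, or leaves it through two boundary vertices, which are then adjacent.
Otherwise, the only neighbours of a third point are the next points along its edge, so a square
through it would close up by an uncut copy of that edge. What remains is spanned by old vertices,
whose edges all belong to `L` (`pair_mem_of_vertices`), and there the hypothesis on `L` applies.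

That the disks triangulate geometrically comes from regularity: lifting by `p ↦ p ⬝ p` gives strict
supporting forms, hence cells meeting in common faces, and maximizing these forms gives covering.
The cells glue because the trace on a side depends only on whether the side is in `L`.

For (2), take a prime `p ≡ 1` modulo 4 with `p` greater than the number of vertices of `Γ`, and
Biggs's map: the complete graph on `ZMod p` embedded in an oriented surface with faces `c + η ^ k`,
where `η` is a primitive root. Coning the faces gives a triangulated surface whose 1-skeleton
contains `Γ`. Girth at least 5 makes `Γ` a flag-no-square subcomplex, and (1) makes it full. The
space is unchanged by subdivision; charts are open stars, identified with a complete planar fan.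
Orientations pass to the subdivision through the signs of determinants in the coordinates of the
surrounding triangle. -/

section

open Geometry Finset

/-! ### Convexity criteria for intersections of cells. -/

section Convex

variable {E : Type*} [AddCommGroup E] [Module ℝ E]

/-- Cells cut out by supporting linear forms of a common height function meet along common faces. -/
theorem convexHull_inter_subset_of_supporting_forms [DecidableEq E] (h : E → ℝ) {s t : Finset E}
    {f g : E →ₗ[ℝ] ℝ} (hf : ∀ p ∈ s, f p = h p) (hg : ∀ p ∈ t, g p = h p)
    (hft : ∀ p ∈ t, p ∉ s → f p < h p) (hgs : ∀ p ∈ s, g p ≤ h p) :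
    convexHull ℝ (s : Set E) ∩ convexHull ℝ t ⊆ convexHull ℝ (s ∩ t : Set E) := by
  rintro x ⟨hxs, hxt⟩
  obtain ⟨a, ha, ha1, hax⟩ := Finset.mem_convexHull'.1 hxs
  obtain ⟨b, hb, hb1, hbx⟩ := Finset.mem_convexHull'.1 hxt
  have hft' : ∀ p ∈ t, 0 ≤ b p * (h p - f p) := fun p hp => by
    by_cases hps : p ∈ s
    · simp [hf p hps]
    · exact mul_nonneg (hb p hp) (sub_nonneg.2 (hft p hp hps).le)
  have e1 : ∑ p ∈ s, a p * h p = f x := by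
    rw [← hax, map_sum]
    exact sum_congr rfl fun p hp => by simp [hf p hp]
  have e2 : ∑ p ∈ t, b p * h p = g x := by
    rw [← hbx, map_sum]
    exact sum_congr rfl fun p hp => by simp [hg p hp]
  have e3 : ∑ p ∈ t, b p * f p = f x := by
    conv_rhs => rw [← hbx, map_sum]
    simp
  have e4 : g x ≤ ∑ p ∈ s, a p * h p := by
    rw [← hax, map_sum]
    exact sum_le_sum fun p hp => by
      simpa using mul_le_mul_of_nonneg_left (hgs p hp) (ha p hp)
  -- The first expansion gives `g x ≤ f x`, the second `f x ≤ g x`; equality kills every weight of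
  -- `t` at a point where `f < h`.
  have e5 : ∑ p ∈ t, b p * (h p - f p) = 0 := by
    apply le_antisymm _ (sum_nonneg hft')
    simp only [mul_sub, sum_sub_distrib]
    linarith
  have key : ∀ p ∈ t, p ∉ s → b p = 0 := fun p hp hps => by
    have := (sum_eq_zero_iff_of_nonneg hft').1 e5 p hp
    rcases mul_eq_zero.1 this with h0 | h0
    · exact h0
    · linarith [hft p hp hps]
  have hsub : s ∩ t ⊆ t := inter_subset_right
  rw [← coe_inter, Finset.mem_convexHull']
  have hz : ∀ p ∈ t, p ∉ s ∩ t → b p = 0 := fun p hp hn =>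
    key p hp fun hps => hn (mem_inter.2 ⟨hps, hp⟩)
  refine ⟨b, fun p hp => hb p (hsub hp), ?_, ?_⟩
  · rw [← hb1]
    exact sum_subset hsub hz
  · rw [← hbx]
    exact sum_subset hsub fun p hp hn => by simp [hz p hp hn]

/-- A face of a simplex is an extreme subset. -/
theorem mem_convexHull_filter_of_mem_face {σ ρ s : Finset E}
    (hσ : AffineIndependent ℝ ((↑) : σ → E)) (hρ : ρ ⊆ σ)
    (hs : (s : Set E) ⊆ convexHull ℝ (σ : Set E)) {x : E} (hxs : x ∈ convexHull ℝ (s : Set E))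
    (hxρ : x ∈ convexHull ℝ (ρ : Set E)) :
    x ∈ convexHull ℝ {p | p ∈ s ∧ p ∈ convexHull ℝ (ρ : Set E)} := by
  classical
  obtain ⟨a, ha, ha1, hax⟩ := Finset.mem_convexHull'.1 hxs
  obtain ⟨b, hb, hb1, hbx⟩ := Finset.mem_convexHull'.1 hxρ
  have : ∀ p, ∃ w : E → ℝ, p ∈ s → (∀ y ∈ σ, 0 ≤ w y) ∧ ∑ y ∈ σ, w y = 1 ∧ ∑ y ∈ σ, w y • y = p :=
    fun p => by
      by_cases hp : p ∈ s
      · obtain ⟨w, hw⟩ := Finset.mem_convexHull'.1 (hs hp)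
        exact ⟨w, fun _ => hw⟩
      · exact ⟨0, fun h => (hp h).elim⟩
  choose c hc using this
  set b' : E → ℝ := fun v => if v ∈ ρ then b v else 0 with hb'
  -- The difference of two systems of barycentric coordinates of `x` in `σ`, through `s` and through
  -- `ρ`. It vanishes, so points of `s` with positive weight have no coordinate outside `ρ`.
  set d : E → ℝ := fun v => ∑ p ∈ s, a p * c p v - b' v with hd
  have hd0 : ∑ v ∈ σ, d v = 0 := by
    simp only [hd, sum_sub_distrib, hb']
    rw [sum_comm, sum_ite_mem, inter_eq_right.2 hρ, hb1, ← ha1, sub_eq_zero]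
    exact sum_congr rfl fun p hp => by rw [← mul_sum, (hc p hp).2.1, mul_one]
  have hdv : ∑ v ∈ σ, d v • v = 0 := by
    simp only [hd, sub_smul, sum_sub_distrib, hb', ite_smul, zero_smul, sum_smul]
    rw [sum_comm, sum_ite_mem, inter_eq_right.2 hρ, hbx, ← hax, sub_eq_zero]
    refine sum_congr rfl fun p hp => ?_
    simp only [mul_smul]
    rw [← smul_sum, (hc p hp).2.2]
  have hdz : ∀ v ∈ σ, d v = 0 := by
    intro v hv
    have := affineIndependent_iff.1 hσ univ (fun i => d i)
      (by rw [← hd0]; exact Finset.sum_coe_sort σ d)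
      (by rw [← hdv]; exact Finset.sum_coe_sort σ fun v => d v • v)
    exact this ⟨v, hv⟩ (mem_univ _)
  have hmem : ∀ p ∈ s, a p ≠ 0 → p ∈ convexHull ℝ (ρ : Set E) := by
    intro p hp hap
    have hz : ∀ v ∈ σ, v ∉ ρ → c p v = 0 := by
      intro v hv hvρ
      have h1 := hdz v hv
      simp only [hd, hb', if_neg hvρ, sub_zero] at h1
      have := (sum_eq_zero_iff_of_nonneg fun q hq => mul_nonneg (ha q hq) ((hc q hq).1 v hv)).1
        h1 p hp
      exact (mul_eq_zero.1 this).resolve_left hap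
    rw [Finset.mem_convexHull']
    refine ⟨c p, fun y hy => (hc p hp).1 y (hρ hy), ?_, ?_⟩
    · rw [← (hc p hp).2.1]
      exact sum_subset hρ hz
    · exact (sum_subset hρ fun v hv hn => by simp [hz v hv hn]).trans (hc p hp).2.2
  have : {p | p ∈ s ∧ p ∈ convexHull ℝ (ρ : Set E)} =
      ((s.filter fun p => p ∈ convexHull ℝ (ρ : Set E) : Finset E) : Set E) := by
    ext; simp
  rw [this, Finset.mem_convexHull']
  have hz : ∀ p ∈ s, p ∉ s.filter (fun p => p ∈ convexHull ℝ (ρ : Set E)) → a p = 0 := by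
    intro p hp hn
    by_contra h0
    exact hn (mem_filter.2 ⟨hp, hmem p hp h0⟩)
  refine ⟨a, fun y hy => ha y (filter_subset _ _ hy), ?_, ?_⟩
  · rw [← ha1]
    exact sum_subset (filter_subset _ _) hz
  · rw [← hax]
    exact sum_subset (filter_subset _ _) fun v hv hn => by simp [hz v hv hn]

theorem convexHull_inter_of_subset_simplex {F : Finset E}
    (hF : AffineIndependent ℝ ((↑) : F → E)) {s t : Set E} (hs : s ⊆ F) (ht : t ⊆ F) :
    convexHull ℝ s ∩ convexHull ℝ t ⊆ convexHull ℝ (s ∩ t) := by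
  classical
  have hs' := F.finite_toSet.subset hs
  have ht' := F.finite_toSet.subset ht
  have := hF.convexHull_inter (t₁ := hs'.toFinset) (t₂ := ht'.toFinset)
    (by simpa [← Finset.coe_subset] using hs) (by simpa [← Finset.coe_subset] using ht)
  simpa using this.ge

end Convex

/-! ### Gluing triangulations of the simplices to a subdivision. -/

namespace Geometry.SimplicialComplex

variable {E : Type*} [AddCommGroup E] [Module ℝ E]

/-- `𝓕` is the set of maximal simplices of a triangulation of the simplex `σ`. -/
structure Triangulates (𝓕 : Set (Finset E)) (σ : Finset E) : Prop where
  finite : 𝓕.Finite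
  subset : ∀ F ∈ 𝓕, (F : Set E) ⊆ convexHull ℝ (σ : Set E)
  indep : ∀ F ∈ 𝓕, AffineIndependent ℝ ((↑) : F → E)
  inter : ∀ F ∈ 𝓕, ∀ G ∈ 𝓕,
    convexHull ℝ (F : Set E) ∩ convexHull ℝ G ⊆ convexHull ℝ (F ∩ G : Set E)
  cover : ∀ x ∈ convexHull ℝ (σ : Set E), ∃ F ∈ 𝓕, x ∈ convexHull ℝ (F : Set E)

/-- Compatible triangulations of all simplices of `X`. -/
structure CellwiseTriangulation (X : SimplicialComplex ℝ E) where
  cells : Finset E → Set (Finset E)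
  triangulates : ∀ σ ∈ X.faces, Triangulates (cells σ) σ
  -- With `extend`, this says that the triangulation of `σ` induces that of `ρ`, in terms of maximal
  -- cells and their vertices only.
  restrict : ∀ σ ∈ X.faces, ∀ ρ ⊆ σ, ρ.Nonempty → ∀ F ∈ cells σ,
    ∃ G ∈ cells ρ, ∀ p ∈ F, p ∈ convexHull ℝ (ρ : Set E) → p ∈ G
  extend : ∀ σ ∈ X.faces, ∀ ρ ⊆ σ, ρ.Nonempty → ∀ G ∈ cells ρ, ∃ F ∈ cells σ, G ⊆ F

namespace CellwiseTriangulation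

variable {X : SimplicialComplex ℝ E} (T : X.CellwiseTriangulation)

/-- Descend from `σ` to the common face `σ ∩ τ` by `restrict`, then ascend to `τ` by `extend`. Thus
a simplex of the glued complex can be studied in any simplex of `X` that contains it. -/
theorem exists_cell_of_subset {s F σ τ : Finset E} (hσ : σ ∈ X.faces) (hτ : τ ∈ X.faces)
    (hF : F ∈ T.cells σ) (hsF : s ⊆ F) (hs : s.Nonempty)
    (hsτ : (s : Set E) ⊆ convexHull ℝ (τ : Set E)) : ∃ G ∈ T.cells τ, s ⊆ G := by
  classical
  have hsub : ∀ p ∈ s, p ∈ convexHull ℝ ((σ ∩ τ : Finset E) : Set E) := fun p hp => by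
    rw [coe_inter]
    exact X.inter_subset_convexHull hσ hτ ⟨(T.triangulates σ hσ).subset F hF (hsF hp), hsτ hp⟩
  have hne : (σ ∩ τ).Nonempty := by
    obtain ⟨p, hp⟩ := hs
    exact coe_nonempty.1 (convexHull_nonempty_iff.1 ⟨p, hsub p hp⟩)
  obtain ⟨G, hG, hFG⟩ := T.restrict σ hσ _ inter_subset_left hne F hF
  obtain ⟨H, hH, hGH⟩ := T.extend τ hτ _ inter_subset_right hne G hG
  exact ⟨H, hH, fun p hp => hGH (hFG p (hsF hp) (hsub p hp))⟩

/-- The complex obtained by gluing the triangulations of all simplices of `X`. -/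
def complex : SimplicialComplex ℝ E where
  faces := {s | s.Nonempty ∧ ∃ σ ∈ X.faces, ∃ F ∈ T.cells σ, s ⊆ F}
  indep := by
    rintro s ⟨-, σ, hσ, F, hF, hsF⟩
    exact ((T.triangulates σ hσ).indep F hF).mono hsF
  isRelLowerSet_faces := by
    rintro s ⟨hs, σ, hσ, F, hF, hsF⟩
    exact ⟨hs, fun t hts ht => ⟨ht, σ, hσ, F, hF, hts.trans hsF⟩⟩
  inter_subset_convexHull := by
    classical
    rintro s t ⟨-, σ, hσ, F, hF, hsF⟩ ⟨-, τ, hτ, G, hG, htG⟩ x ⟨hxs, hxt⟩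
    have hTσ := T.triangulates σ hσ
    have hTτ := T.triangulates τ hτ
    have hFσ := hTσ.subset F hF
    have hGτ := hTτ.subset G hG
    set ρ := σ ∩ τ with hρ
    have hxρ : x ∈ convexHull ℝ (ρ : Set E) := by
      rw [hρ, coe_inter]
      exact X.inter_subset_convexHull hσ hτ
        ⟨convexHull_min ((coe_subset.2 hsF).trans hFσ) (convex_convexHull ℝ _) hxs,
          convexHull_min ((coe_subset.2 htG).trans hGτ) (convex_convexHull ℝ _) hxt⟩
    have hne : ρ.Nonempty := coe_nonempty.1 <| convexHull_nonempty_iff.1 ⟨x, hxρ⟩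
    have hρX : ρ ∈ X.faces := X.down_closed hσ inter_subset_left hne
    obtain ⟨F', hF', hFF'⟩ := T.restrict σ hσ ρ inter_subset_left hne F hF
    obtain ⟨G', hG', hGG'⟩ := T.restrict τ hτ ρ inter_subset_right hne G hG
    -- As `ρ` is an extreme subset of `σ` and of `τ`, only the vertices of `s` and `t` lying on `ρ`
    -- matter, and these belong to cells of the one triangulation of `ρ`.
    have h1 := mem_convexHull_filter_of_mem_face (X.indep hσ) inter_subset_left
      ((coe_subset.2 hsF).trans hFσ) hxs hxρ
    have h2 := mem_convexHull_filter_of_mem_face (X.indep hτ) inter_subset_right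
      ((coe_subset.2 htG).trans hGτ) hxt hxρ
    have hTρ := T.triangulates ρ hρX
    set s' := {p | p ∈ s ∧ p ∈ convexHull ℝ (ρ : Set E)}
    set t' := {p | p ∈ t ∧ p ∈ convexHull ℝ (ρ : Set E)}
    have hs' : s' ⊆ F' := fun p hp => hFF' p (hsF hp.1) hp.2
    have ht' : t' ⊆ G' := fun p hp => hGG' p (htG hp.1) hp.2
    have h3 := hTρ.inter F' hF' G' hG' ⟨convexHull_mono hs' h1, convexHull_mono ht' h2⟩
    -- Intersect first with `s'` inside the simplex `F'`, then with `t'` inside `G'`; in a single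
    -- simplex, hulls of vertex sets intersect as the vertex sets do.
    have h4 : x ∈ convexHull ℝ (s' ∩ ((F' : Set E) ∩ G')) :=
      convexHull_inter_of_subset_simplex (hTρ.indep F' hF') hs' Set.inter_subset_left ⟨h1, h3⟩
    have h5 : x ∈ convexHull ℝ (s' ∩ ((F' : Set E) ∩ G') ∩ t') :=
      convexHull_inter_of_subset_simplex (hTρ.indep G' hG')
        (Set.inter_subset_right.trans Set.inter_subset_right) ht' ⟨h4, h2⟩
    have hsub : s' ∩ ((F' : Set E) ∩ G') ∩ t' ⊆ (s : Set E) ∩ t := fun p hp =>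
      ⟨hp.1.1.1, hp.2.1⟩
    exact convexHull_mono hsub h5

theorem exists_cell {s σ : Finset E} (hs : s ∈ T.complex.faces) (hσ : σ ∈ X.faces)
    (hsσ : (s : Set E) ⊆ convexHull ℝ (σ : Set E)) : ∃ F ∈ T.cells σ, s ⊆ F := by
  obtain ⟨hne, τ, hτ, F, hF, hsF⟩ := hs
  exact T.exists_cell_of_subset hτ hσ hF hsF hne hsσ

theorem isSubdivision : T.complex.IsSubdivision X := by
  classical
  refine ⟨?_, fun σ hσ => ?_⟩
  · rintro s ⟨-, σ, hσ, F, hF, hsF⟩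
    exact ⟨σ, hσ, convexHull_min ((coe_subset.2 hsF).trans ((T.triangulates σ hσ).subset F hF))
      (convex_convexHull ℝ _)⟩
  · have hT := T.triangulates σ hσ
    refine ⟨{F ∈ T.cells σ | F.Nonempty}, hT.finite.subset fun F hF => hF.1, fun F hF =>
      ⟨hF.2, σ, hσ, F, hF.1, Subset.refl _⟩, ?_⟩
    apply Set.Subset.antisymm
    · intro x hx
      obtain ⟨F, hF, hxF⟩ := hT.cover x hx
      exact Set.mem_iUnion₂.2 ⟨F, ⟨hF, coe_nonempty.1 <| convexHull_nonempty_iff.1 ⟨x, hxF⟩⟩, hxF⟩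
    · exact Set.iUnion₂_subset fun F hF =>
        convexHull_min (hT.subset F hF.1) (convex_convexHull ℝ _)

theorem finite_faces (hX : X.faces.Finite) : T.complex.faces.Finite := by
  have : (⋃ σ ∈ X.faces, ⋃ F ∈ T.cells σ, {s : Finset E | s ⊆ F}).Finite :=
    hX.biUnion fun σ hσ => (T.triangulates σ hσ).finite.biUnion fun F _ =>
      (F.powerset.finite_toSet).subset fun s hs => by simpa using hs
  refine this.subset ?_
  rintro s ⟨-, σ, hσ, F, hF, hsF⟩
  simp only [Set.mem_iUnion]
  exact ⟨σ, hσ, F, hF, hsF⟩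

end CellwiseTriangulation

theorem IsSubdivision.space_eq {X X' : SimplicialComplex ℝ E} (h : X'.IsSubdivision X) :
    X'.space = X.space := by
  apply Set.Subset.antisymm
  · refine Set.iUnion₂_subset fun s hs => ?_
    obtain ⟨t, ht, hst⟩ := h.1 s hs
    exact hst.trans (X.convexHull_subset_space ht)
  · refine Set.iUnion₂_subset fun t ht => ?_
    obtain ⟨S, -, hS, e⟩ := h.2 t ht
    rw [e]
    exact Set.iUnion₂_subset fun s hs => X'.convexHull_subset_space (hS hs)

end Geometry.SimplicialComplex

end

/-!
Three triangulations of a triangle: an outer ring and an inner ring of equally many vertices and a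
centre. The side opposite to the corner `k` is cut into thirds, except for the side `2` in the
second triangulation and the sides `1` and `2` in the third, which stay whole. Points are given by
barycentric coordinates scaled by `12`.
-/

namespace RingDisk

set_option synthInstance.maxHeartbeats 400000
set_option synthInstance.maxSize 100000

/-- The number of vertices of the boundary. -/
def size : Fin 3 → ℕ := ![9, 7, 5]

/-- The vertices of the boundary, in cyclic order. -/
def rimList : Fin 3 → List (Fin 3 → ℤ) :=
  ![[![12, 0, 0], ![8, 4, 0], ![4, 8, 0], ![0, 12, 0], ![0, 8, 4], ![0, 4, 8], ![0, 0, 12],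
      ![4, 0, 8], ![8, 0, 4]],
    [![12, 0, 0], ![0, 12, 0], ![0, 8, 4], ![0, 4, 8], ![0, 0, 12], ![4, 0, 8], ![8, 0, 4]],
    [![12, 0, 0], ![0, 12, 0], ![0, 8, 4], ![0, 4, 8], ![0, 0, 12]]]

/-- The reduction modulo `size t` makes the index cyclic and lets `pt` feed in the index `size t +
i` of an inner vertex directly; the default value is never reached. -/
def rim (t : Fin 3) (i : ℕ) : Fin 3 → ℤ := (rimList t).getD (i % size t) 0

def card (t : Fin 3) : ℕ := 2 * size t + 1

/-- The vertices: the boundary, the inner ring and the centre. -/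
def pt (t : Fin 3) (i : ℕ) : Fin 3 → ℤ :=
  if i < size t then rim t i
  -- Halfway between the centre and the midpoint of a boundary edge: 8 is twice the centre. The
  -- quotient is exact because all entries of `rim` are multiples of 4.
  else if i < 2 * size t then fun k => (rim t i k + rim t (i + 1) k + 8) / 4
  else 4

/-- The triangles, as lists of three vertices. -/
def tri (t : Fin 3) : List (Fin 3 → ℕ) :=
  (List.range (size t)).flatMap fun i =>
    -- The inner vertex `size t + i` is joined to the ends of the `i`-th boundary edge, to two inner
    -- vertices and to the centre, so its link is a 5-cycle.
    [![i, (i + 1) % size t, size t + i],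
      ![(i + 1) % size t, size t + (i + 1) % size t, size t + i],
      ![size t + i, size t + (i + 1) % size t, 2 * size t]]

def dot {R} [CommRing R] (p q : Fin 3 → R) : R := p 0 * q 0 + p 1 * q 1 + p 2 * q 2

def cross {R} [CommRing R] (p q : Fin 3 → R) : Fin 3 → R :=
  ![p 1 * q 2 - p 2 * q 1, p 2 * q 0 - p 0 * q 2, p 0 * q 1 - p 1 * q 0]

/-- The linear form that vanishes on the side of `f` opposite to the vertex `k`. -/
def coface (t : Fin 3) (f : Fin 3 → ℕ) (k : Fin 3) : Fin 3 → ℤ :=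
  cross (pt t (f (k + 1))) (pt t (f (k + 2)))

def det (t : Fin 3) (f : Fin 3 → ℕ) : ℤ := dot (pt t (f 0)) (coface t f 0)

/-- `det t f` times the linear form that agrees with `p ↦ p ⬝ p` on the vertices of `f`. -/
def form (t : Fin 3) (f : Fin 3 → ℕ) : Fin 3 → ℤ := fun c =>
  dot (pt t (f 0)) (pt t (f 0)) * coface t f 0 c + dot (pt t (f 1)) (pt t (f 1)) * coface t f 1 c
    + dot (pt t (f 2)) (pt t (f 2)) * coface t f 2 c

/-- The side `k` is not subdivided. -/
def full (t k : Fin 3) : Bool := (t = 1 && k = 2) || (t = 2 && (k = 1 || k = 2))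

def corner (k : Fin 3) : Fin 3 → ℤ := Pi.single k 12

def third (i j : Fin 3) : Fin 3 → ℤ := Pi.single i 8 + Pi.single j 4

/-- The edges into which the side `k` is subdivided. -/
def segs (t k : Fin 3) : List ((Fin 3 → ℤ) × (Fin 3 → ℤ)) :=
  let i := k + 1
  let j := k + 2
  if full t k then [(corner i, corner j)]
  else [(corner i, third i j), (third i j, third j i), (third j i, corner j)]

def IsBd (t : Fin 3) (i : ℕ) : Prop := ∃ k, pt t i k = 0

instance (t i) : Decidable (IsBd t i) := by unfold IsBd; infer_instance

def Adj (t : Fin 3) (i j : ℕ) : Prop := i ≠ j ∧ ∃ f ∈ tri t, (∃ a, f a = i) ∧ ∃ b, f b = j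

instance (t i j) : Decidable (Adj t i j) := by unfold Adj; infer_instance

/-! ### Finite verifications on the three disks. -/

theorem pt_nonneg : ∀ t, ∀ i < card t, ∀ k, 0 ≤ pt t i k := by decide +kernel

theorem pt_sum : ∀ t, ∀ i < card t, pt t i 0 + pt t i 1 + pt t i 2 = 12 := by decide +kernel

theorem pt_inj : ∀ t, ∀ i < card t, ∀ j < card t, pt t i = pt t j → i = j := by decide +kernel

theorem tri_lt : ∀ t, ∀ f ∈ tri t, ∀ a, f a < card t := by decide +kernel

theorem exists_tri : ∀ t, ∀ i < card t, ∃ f ∈ tri t, ∃ a, f a = i := by decide +kernel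

theorem det_pos : ∀ t, ∀ f ∈ tri t, 0 < det t f := by decide +kernel

/-- Strict Delaunay condition: the triangles are the faces of the lift by `p ↦ p ⬝ p`. It yields the
intersection property of the cells. -/
theorem form_lt : ∀ t, ∀ f ∈ tri t, ∀ i < card t, (¬ ∃ a, f a = i) →
    dot (form t f) (pt t i) < det t f * dot (pt t i) (pt t i) := by
  decide +kernel

/-- A side of `f` lies on the boundary, or some `g` exists for which the normalised form of `g`
minus that of `f` is a negative multiple of the coface. Vanishing cross product means parallel,
negative dot product fixes the sign. It yields the covering property. -/
theorem coface_nonneg_or : ∀ t, ∀ f ∈ tri t, ∀ k, (∀ c, 0 ≤ coface t f k c) ∨ ∃ g ∈ tri t,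
    (∀ c, cross (fun d => det t f * form t g d - det t g * form t f d) (coface t f k) c = 0) ∧
    dot (fun d => det t f * form t g d - det t g * form t f d) (coface t f k) < 0 := by
  decide +kernel

/-- With `segs_subset`, this matches the boundary of the disk with the prescribed subdivision of the
sides, as `restrict` and `extend` demand. -/
theorem side_subset : ∀ t, ∀ f ∈ tri t, ∀ k, ∃ g ∈ segs t k, ∀ a, pt t (f a) k = 0 →
    pt t (f a) = g.1 ∨ pt t (f a) = g.2 := by decide +kernel

theorem segs_subset : ∀ t, ∀ k, ∀ g ∈ segs t k, ∃ f ∈ tri t,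
  (∃ a, pt t (f a) = g.1) ∧ ∃ b, pt t (f b) = g.2 := by decide +kernel

theorem exists_tri_corner : ∀ t, ∀ k, ∃ f ∈ tri t, ∃ a, pt t (f a) = corner k := by decide +kernel

/-- With `no_four_clique`, flagness of the disk. Here and below, adjacencies stand between the
quantifiers so that the enumeration is pruned early. -/
theorem tri_of_clique : ∀ t, ∀ i < card t, ∀ j < card t, Adj t i j → ∀ k < card t, Adj t i k →
   Adj t j k → ∃ f ∈ tri t, (∃ a, f a = i) ∧ (∃ a, f a = j) ∧ ∃ a, f a = k := by decide +kernel

theorem no_four_clique : ∀ t, ∀ i < card t, ∀ j < card t, Adj t i j → ∀ k < card t, Adj t i k →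
   Adj t j k → ∀ l < card t, Adj t i l → Adj t j l → ¬ Adj t k l := by decide +kernel

theorem no_square : ∀ t, ∀ i < card t, ∀ j < card t, Adj t i j → ∀ k < card t, Adj t j k →
   i ≠ k → ¬ Adj t i k → ∀ l < card t, Adj t i l → Adj t k l → l ≠ j → Adj t j l := by decide +kernel

/-- An inner vertex sees only the two ends of one boundary edge, and the centre sees no boundary
vertex. This handles squares that leave the triangle. -/
theorem adj_of_adj_interior : ∀ t, ∀ i < card t, ¬ IsBd t i → ∀ j < card t, Adj t i j → IsBd t j →
  ∀ k < card t, Adj t i k → IsBd t k → j ≠ k → Adj t j k := by decide +kernel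

/-- No edge of the disk cuts a corner, so a new point of a side has no boundary neighbours off that
side. -/
theorem common_side : ∀ t, ∀ i < card t, IsBd t i → ∀ j < card t, IsBd t j → Adj t i j →
  ∃ k, pt t i k = 0 ∧ pt t j k = 0 := by decide +kernel

end RingDisk

/-! ### The disks placed in an affine triangle. -/

section

open Geometry Finset

section Comb

variable {ι E : Type*} [Fintype ι] [AddCommGroup E] [Module ℝ E] {e : ι → E}

theorem AffineIndependent.linearCombination_inj (he : AffineIndependent ℝ e) {x y : ι → ℝ}
    (h : ∑ i, x i = ∑ i, y i)
    (hxy : Fintype.linearCombination ℝ e x = Fintype.linearCombination ℝ e y) : x = y := by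
  have := affineIndependent_iff.1 he univ (x - y) (by simp [h])
    (by simpa [Fintype.linearCombination_apply, sub_smul, sub_eq_zero] using hxy)
  funext i
  exact sub_eq_zero.1 (this i (mem_univ i))

theorem linearCombination_mem_convexHull_image [DecidableEq E] {w : ι → ℝ} (h0 : ∀ i, 0 ≤ w i)
    (h1 : ∑ i, w i = 1) {K : Finset ι} (hK : ∀ i ∉ K, w i = 0) :
    Fintype.linearCombination ℝ e w ∈ convexHull ℝ (K.image e : Set E) := by
  rw [Fintype.linearCombination_apply,
    ← sum_subset (subset_univ K) fun i _ hi => by rw [hK i hi, zero_smul]]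
  refine (convex_convexHull ℝ _).sum_mem (fun i _ => h0 i) ?_ fun i hi =>
    subset_convexHull ℝ _ (mem_coe.2 (mem_image_of_mem e hi))
  rw [← h1]
  exact sum_subset (subset_univ K) fun i _ hi => hK i hi

theorem exists_of_mem_convexHull_image [DecidableEq E] {K : Finset ι} {x : E}
    (hx : x ∈ convexHull ℝ (K.image e : Set E)) : ∃ w : ι → ℝ, (∀ i, 0 ≤ w i) ∧ ∑ i, w i = 1 ∧
      (∀ i ∉ K, w i = 0) ∧ Fintype.linearCombination ℝ e w = x := by
  classical
  have e1 : (K.image e : Set E) =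
      Fintype.linearCombination ℝ e '' ((fun i => Pi.single i 1) '' (K : Set ι)) := by
    rw [Set.image_image]
    simp [Fintype.linearCombination_apply_single]
  rw [e1, ← LinearMap.image_convexHull] at hx
  obtain ⟨w, hw, rfl⟩ := hx
  have hsub : convexHull ℝ ((fun i => (Pi.single i 1 : ι → ℝ)) '' (K : Set ι)) ⊆
      {w | (∀ i, 0 ≤ w i) ∧ ∑ i, w i = 1 ∧ ∀ i ∉ K, w i = 0} := by
    refine convexHull_min ?_ ?_
    · rintro _ ⟨i, hi, rfl⟩
      refine ⟨fun j => ?_, by simp, fun j hj => ?_⟩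
      · by_cases h : j = i
        · subst h; simp
        · simp [h]
      · have : j ≠ i := fun h => hj (h ▸ hi)
        simp [this]
    · rintro x ⟨hx0, hx1, hx2⟩ y ⟨hy0, hy1, hy2⟩ a b ha hb hab
      refine ⟨fun i => ?_, ?_, fun i hi => ?_⟩
      · have := hx0 i; have := hy0 i; simp only [Pi.add_apply, Pi.smul_apply, smul_eq_mul]
        positivity
      · simp [sum_add_distrib, ← mul_sum, hx1, hy1, hab]
      · simp [hx2 i hi, hy2 i hi]
  obtain ⟨h0, h1, h2⟩ := hsub hw
  exact ⟨w, h0, h1, h2, rfl⟩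

theorem AffineIndependent.linearCombination_mem_convexHull_image_iff [DecidableEq E]
    (he : AffineIndependent ℝ e) {w : ι → ℝ} (h0 : ∀ i, 0 ≤ w i) (h1 : ∑ i, w i = 1)
    {K : Finset ι} :
    Fintype.linearCombination ℝ e w ∈ convexHull ℝ (K.image e : Set E) ↔ ∀ i ∉ K, w i = 0 := by
  refine ⟨fun h => ?_, linearCombination_mem_convexHull_image h0 h1⟩
  obtain ⟨v, -, hv1, hvK, hv⟩ := exists_of_mem_convexHull_image h
  rwa [← he.linearCombination_inj (hv1.trans h1.symm) hv]

end Comb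

namespace RingDisk

noncomputable def bary (t : Fin 3) (i : ℕ) : Fin 3 → ℝ := fun k => (pt t i k : ℝ) / 12

/-- The linear form with integer coefficients `c`. -/
noncomputable def lin (c : Fin 3 → ℤ) : (Fin 3 → ℝ) →ₗ[ℝ] ℝ :=
  Fintype.linearCombination ℝ fun k => (c k : ℝ)

theorem lin_apply (c : Fin 3 → ℤ) (x : Fin 3 → ℝ) :
    lin c x = c 0 * x 0 + c 1 * x 1 + c 2 * x 2 := by
  simp [lin, Fintype.linearCombination_apply, Fin.sum_univ_three, mul_comm]

theorem lin_bary (c : Fin 3 → ℤ) (t : Fin 3) (i : ℕ) :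
    lin c (bary t i) = (dot c (pt t i) : ℤ) / 12 := by
  simp only [lin_apply, bary, dot]
  push_cast
  ring

theorem bary_nonneg {t : Fin 3} {i : ℕ} (hi : i < card t) (k : Fin 3) : 0 ≤ bary t i k := by
  have : (0 : ℝ) ≤ pt t i k := by exact_mod_cast pt_nonneg t i hi k
  unfold bary; positivity

theorem bary_sum {t : Fin 3} {i : ℕ} (hi : i < card t) : ∑ k, bary t i k = 1 := by
  have : (pt t i 0 : ℝ) + pt t i 1 + pt t i 2 = 12 := by exact_mod_cast pt_sum t i hi
  rw [Fin.sum_univ_three]; unfold bary; linarith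

theorem bary_inj {t : Fin 3} {i j : ℕ} (hi : i < card t) (hj : j < card t)
    (h : bary t i = bary t j) : i = j := by
  refine pt_inj t i hi j hj (funext fun k => ?_)
  have := congrFun h k
  unfold bary at this
  have h2 : (pt t i k : ℝ) = pt t j k := by linarith
  exact_mod_cast h2

/-- The cofaces are, up to the factor `det t f`, the dual basis of the three vertices. -/
theorem dot_coface (t : Fin 3) (f : Fin 3 → ℕ) (k a : Fin 3) :
    dot (coface t f k) (pt t (f a)) = if a = k then det t f else 0 := by
  fin_cases k <;> fin_cases a <;> simp [coface, det, dot, cross] <;> ring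

theorem dot_form (t : Fin 3) (f : Fin 3 → ℕ) (a : Fin 3) :
    dot (form t f) (pt t (f a)) = det t f * dot (pt t (f a)) (pt t (f a)) := by
  have h0 := dot_coface t f 0 a
  have h1 := dot_coface t f 1 a
  have h2 := dot_coface t f 2 a
  have : dot (form t f) (pt t (f a)) = dot (pt t (f 0)) (pt t (f 0)) * dot (coface t f 0) (pt t (f a))
      + dot (pt t (f 1)) (pt t (f 1)) * dot (coface t f 1) (pt t (f a))
      + dot (pt t (f 2)) (pt t (f 2)) * dot (coface t f 2) (pt t (f a)) := by
    simp only [form, dot]; ring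
  rw [this, h0, h1, h2]
  fin_cases a <;> simp [mul_comm]

theorem bary_linearIndependent {t : Fin 3} {f : Fin 3 → ℕ} (hf : f ∈ tri t) :
    LinearIndependent ℝ fun a => bary t (f a) := by
  rw [Fintype.linearIndependent_iff]
  intro c hc k
  have hd : (0 : ℝ) < det t f := by exact_mod_cast det_pos t f hf
  have := congrArg (lin (coface t f k)) hc
  simp only [map_sum, map_smul, lin_bary, dot_coface, smul_eq_mul, map_zero] at this
  rw [sum_eq_single k (fun b _ hb => by simp [hb]) (by simp)] at this
  simp only [if_true] at this
  rcases mul_eq_zero.1 this with h | h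
  · exact h
  · exact absurd h (by positivity)

/-- The common height is `p ↦ p ⬝ p`; strict supporting forms come from `form_lt`. -/
theorem bary_cells_inter {t : Fin 3} {f g : Fin 3 → ℕ} (hf : f ∈ tri t) (hg : g ∈ tri t) :
    convexHull ℝ (Set.range fun a => bary t (f a)) ∩ convexHull ℝ (Set.range fun a => bary t (g a)) ⊆
      convexHull ℝ ((Set.range fun a => bary t (f a)) ∩ Set.range fun a => bary t (g a)) := by
  classical
  -- Coordinates are divided by 12, so a linear form scales by 12 and the quadratic height by 144;
  -- the extra factor 12 in the normalisation reconciles the two.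
  have key : ∀ f ∈ tri t, ∀ i < card t,
      (((1 / (12 * det t f) : ℝ) • lin (form t f)) (bary t i) =
        dot (form t f) (pt t i) / (144 * det t f)) ∧
      dot (bary t i) (bary t i) = (dot (pt t i) (pt t i) : ℤ) / 144 := fun f hf i hi => by
    constructor
    · rw [LinearMap.smul_apply, lin_bary, smul_eq_mul]
      have : (det t f : ℝ) ≠ 0 := by exact_mod_cast (det_pos t f hf).ne'
      field_simp
      ring
    · simp only [dot, bary]; push_cast; ring
  have heq : ∀ f ∈ tri t, ∀ p ∈ univ.image (fun a => bary t (f a)),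
      ((1 / (12 * det t f) : ℝ) • lin (form t f)) p = dot p p := fun f hf p hp => by
    obtain ⟨a, -, rfl⟩ := mem_image.1 hp
    obtain ⟨h1, h2⟩ := key f hf (f a) (tri_lt t f hf a)
    have : (det t f : ℝ) ≠ 0 := by exact_mod_cast (det_pos t f hf).ne'
    rw [h1, h2, dot_form]
    push_cast
    field_simp
  have hlt : ∀ f ∈ tri t, ∀ g ∈ tri t, ∀ p ∈ univ.image (fun a => bary t (g a)),
      p ∉ univ.image (fun a => bary t (f a)) →
      ((1 / (12 * det t f) : ℝ) • lin (form t f)) p < dot p p := fun f hf g hg p hp hn => by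
    obtain ⟨a, -, rfl⟩ := mem_image.1 hp
    obtain ⟨h1, h2⟩ := key f hf (g a) (tri_lt t g hg a)
    have hd : (0 : ℝ) < det t f := by exact_mod_cast det_pos t f hf
    have := form_lt t f hf (g a) (tri_lt t g hg a) fun ⟨b, hb⟩ =>
      hn (mem_image.2 ⟨b, mem_univ _, by rw [hb]⟩)
    have h3 : ((dot (form t f) (pt t (g a)) : ℤ) : ℝ) <
        det t f * (dot (pt t (g a)) (pt t (g a)) : ℤ) := by
      exact_mod_cast this
    rw [h1, h2, div_lt_div_iff₀ (by positivity) (by norm_num)]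
    nlinarith
  have := convexHull_inter_subset_of_supporting_forms (fun p => dot p p) (heq f hf) (heq g hg)
    (hlt f hf g hg) fun p hp => by
      by_cases hpg : p ∈ univ.image fun a => bary t (g a)
      · exact (heq g hg p hpg).le
      · exact (hlt g hg f hf p hp hpg).le
  simpa using this

/-- Take the triangle whose normalised supporting form is largest at `x`. If `x` were beyond one of
its sides, the triangle supplied by `coface_nonneg_or` would have a larger value at `x`. -/
theorem exists_tri_of_nonneg (t : Fin 3) {x : Fin 3 → ℝ} (h0 : ∀ k, 0 ≤ x k) (h1 : ∑ k, x k = 1) :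
    ∃ f ∈ tri t, ∃ w : Fin 3 → ℝ, (∀ a, 0 ≤ w a) ∧ ∑ a, w a = 1 ∧ ∑ a, w a • bary t (f a) = x := by
  classical
  have hne : (tri t).toFinset.Nonempty := by
    obtain ⟨f, hf, -⟩ := exists_tri t 0 (by unfold card; omega)
    exact ⟨f, by simpa using hf⟩
  obtain ⟨f, hf, hmax⟩ := exists_max_image (tri t).toFinset (fun f => lin (form t f) x / det t f) hne
  simp only [List.mem_toFinset] at hf hmax
  have hd : (0 : ℝ) < det t f := by exact_mod_cast det_pos t f hf
  have hc : ∀ k, 0 ≤ lin (coface t f k) x := by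
    intro k
    by_contra! hneg
    rcases coface_nonneg_or t f hf k with h | ⟨g, hg, hU, hUn⟩
    · refine hneg.not_ge ?_
      have hr : ∀ c, (0 : ℝ) ≤ coface t f k c := fun c => by exact_mod_cast h c
      rw [lin_apply]
      have := hr 0; have := hr 1; have := hr 2; have := h0 0; have := h0 1; have := h0 2
      positivity
    · set U : Fin 3 → ℤ := fun d => det t f * form t g d - det t g * form t f d with hUdef
      set β := coface t f k
      have hdg : (0 : ℝ) < det t g := by exact_mod_cast det_pos t g hg
      have hle := hmax g hg
      rw [div_le_div_iff₀ hdg hd] at hle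
      have hUx : lin U x ≤ 0 := by
        have : lin U x = lin (form t g) x * det t f - lin (form t f) x * det t g := by
          simp only [lin_apply, hUdef]; push_cast; ring
        linarith
      -- `U` and `β` are parallel, so `lin U x` has the sign opposite to `lin β x`, that is, it is
      -- positive.
      have hcr : lin U x * lin β (fun c => β c) = lin U (fun c => β c) * lin β x := by
        have c0 := hU 0; have c1 := hU 1; have c2 := hU 2
        simp only [cross, Matrix.cons_val_zero, Matrix.cons_val_one, Matrix.cons_val] at c0 c1 c2
        have c0' : (U 1 * β 2 - U 2 * β 1 : ℝ) = 0 := by exact_mod_cast c0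
        have c1' : (U 2 * β 0 - U 0 * β 2 : ℝ) = 0 := by exact_mod_cast c1
        have c2' : (U 0 * β 1 - U 1 * β 0 : ℝ) = 0 := by exact_mod_cast c2
        simp only [lin_apply]
        linear_combination (x 1 * β 2 - x 2 * β 1) * c0' + (x 2 * β 0 - x 0 * β 2) * c1' +
          (x 0 * β 1 - x 1 * β 0) * c2'
      have hUβ : lin U (fun c => β c) < 0 := by
        have : lin U (fun c => β c) = (dot U β : ℤ) := by
          simp only [lin_apply, dot]; push_cast; ring
        rw [this]; exact_mod_cast hUn
      have hβ : 0 ≤ lin β (fun c => (β c : ℝ)) := by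
        rw [lin_apply]
        nlinarith [sq_nonneg (β 0 : ℝ), sq_nonneg (β 1 : ℝ), sq_nonneg (β 2 : ℝ)]
      have := mul_pos_of_neg_of_neg hUβ hneg
      have := mul_nonpos_of_nonpos_of_nonneg hUx hβ
      linarith
  -- Cramer's rule: the values of the cofaces at `x` are the coordinates of `x` in the basis of
  -- scaled vertices, times the determinant.
  have hx : ∀ c, ∑ a, lin (coface t f a) x * pt t (f a) c = det t f * x c := by
    intro c
    simp only [Fin.sum_univ_three, lin_apply]
    fin_cases c <;> simp [coface, det, dot, cross] <;> ring
  have hs : ∑ a, lin (coface t f a) x * 12 = det t f := by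
    have h3 := hx 0; have h4 := hx 1; have h5 := hx 2
    simp only [Fin.sum_univ_three] at h1 h3 h4 h5 ⊢
    have hp : ∀ a, (pt t (f a) 0 : ℝ) + pt t (f a) 1 + pt t (f a) 2 = 12 := fun a => by
      exact_mod_cast pt_sum t (f a) (tri_lt t f hf a)
    linear_combination h3 + h4 + h5 + det t f * h1 - lin (coface t f 0) x * hp 0
      - lin (coface t f 1) x * hp 1 - lin (coface t f 2) x * hp 2
  refine ⟨f, hf, fun a => lin (coface t f a) x * 12 / det t f, fun a => ?_, ?_, ?_⟩
  · have := hc a; positivity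
  · rw [← sum_div, hs, div_self hd.ne']
  · funext c
    have := hx c
    simp only [Finset.sum_apply, Pi.smul_apply, smul_eq_mul, bary]
    calc _ = (∑ a, lin (coface t f a) x * pt t (f a) c) / det t f := by
          rw [sum_div]; exact sum_congr rfl fun a _ => by ring
      _ = x c := by rw [this]; field_simp

variable {E : Type*} [AddCommGroup E] [Module ℝ E]

/-- The position of the `i`-th vertex in the triangle with corners `e`. -/
noncomputable def place (e : Fin 3 → E) (t : Fin 3) (i : ℕ) : E :=
  Fintype.linearCombination ℝ e (bary t i)

open Classical in
noncomputable def cell (e : Fin 3 → E) (t : Fin 3) (f : Fin 3 → ℕ) : Finset E :=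
  univ.image fun a => place e t (f a)

theorem mem_cell {e : Fin 3 → E} {t : Fin 3} {f : Fin 3 → ℕ} {x : E} :
    x ∈ cell e t f ↔ ∃ a, place e t (f a) = x := by
  simp [cell]

theorem coe_cell {e : Fin 3 → E} {t : Fin 3} {f : Fin 3 → ℕ} :
    (cell e t f : Set E) = Fintype.linearCombination ℝ e '' Set.range fun a => bary t (f a) := by
  ext x
  simp [mem_cell, place]

theorem place_inj {e : Fin 3 → E} (he : AffineIndependent ℝ e) {t : Fin 3} {i j : ℕ}
    (hi : i < card t) (hj : j < card t) (h : place e t i = place e t j) : i = j :=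
  bary_inj hi hj (he.linearCombination_inj ((bary_sum hi).trans (bary_sum hj).symm) h)

theorem place_mem_convexHull_iff [DecidableEq E] {e : Fin 3 → E} (he : AffineIndependent ℝ e)
    {t : Fin 3} {i : ℕ} (hi : i < card t) {K : Finset (Fin 3)} :
    place e t i ∈ convexHull ℝ (K.image e : Set E) ↔ ∀ k ∉ K, pt t i k = 0 := by
  unfold place
  rw [he.linearCombination_mem_convexHull_image_iff (bary_nonneg hi) (bary_sum hi)]
  simp [bary]

theorem convexHull_cell_subset {e : Fin 3 → E} {t : Fin 3} {f : Fin 3 → ℕ} (hf : f ∈ tri t) {x : E}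
    (hx : x ∈ convexHull ℝ (cell e t f : Set E)) :
    ∃ w ∈ convexHull ℝ (Set.range fun a => bary t (f a)), ∑ k, w k = 1 ∧
      Fintype.linearCombination ℝ e w = x := by
  rw [coe_cell, ← LinearMap.image_convexHull] at hx
  obtain ⟨w, hw, rfl⟩ := hx
  refine ⟨w, hw, ?_, rfl⟩
  have hsub : convexHull ℝ (Set.range fun a => bary t (f a)) ⊆ {w | ∑ k, w k = 1} := by
    refine convexHull_min ?_ ?_
    · rintro _ ⟨a, rfl⟩
      exact bary_sum (tri_lt t f hf a)
    · intro x hx y hy a b _ _ hab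
      have hx : ∑ k, x k = 1 := hx
      have hy : ∑ k, y k = 1 := hy
      simp [sum_add_distrib, ← mul_sum, hx, hy, hab]
  exact hsub hw

theorem triangulates [DecidableEq E] {e : Fin 3 → E} (he : AffineIndependent ℝ e) (t : Fin 3) :
    SimplicialComplex.Triangulates {F | ∃ f ∈ tri t, F = cell e t f} (univ.image e) where
  finite := ((tri t).toFinset.image (cell e t)).finite_toSet.subset fun F ⟨f, hf, hF⟩ => by
    simpa using ⟨f, hf, hF.symm⟩
  subset := by
    rintro F ⟨f, hf, rfl⟩ x hx
    obtain ⟨a, rfl⟩ := mem_cell.1 hx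
    exact (place_mem_convexHull_iff he (tri_lt t f hf a)).2 (by simp)
  indep := by
    rintro F ⟨f, hf, rfl⟩
    have hli : AffineIndependent ℝ fun a => place e t (f a) := by
      rw [affineIndependent_iff]
      intro s w hw hws
      have h0 : Fintype.linearCombination ℝ e (∑ a ∈ s, w a • bary t (f a)) =
          Fintype.linearCombination ℝ e 0 := by
        rw [map_sum, map_zero, ← hws]
        exact sum_congr rfl fun a _ => by rw [map_smul]; rfl
      have h1 := he.linearCombination_inj (by
        simp only [Finset.sum_apply, Pi.smul_apply, smul_eq_mul, Pi.zero_apply, sum_const_zero]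
        rw [sum_comm, ← hw]
        exact sum_congr rfl fun a _ => by
          rw [← mul_sum, bary_sum (tri_lt t f hf a), mul_one]) h0
      exact linearIndependent_iff'.1 (bary_linearIndependent hf) s w h1
    have := hli.range
    refine this.mono (t := Set.range _) fun x hx => ?_
    obtain ⟨a, ha⟩ := mem_cell.1 hx
    exact ⟨a, ha⟩
  inter := by
    rintro F ⟨f, hf, rfl⟩ G ⟨g, hg, rfl⟩ x ⟨hx, hx'⟩
    obtain ⟨w, hw, hw1, rfl⟩ := convexHull_cell_subset hf hx
    obtain ⟨v, hv, hv1, hvw⟩ := convexHull_cell_subset hg hx'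
    obtain rfl := he.linearCombination_inj (hv1.trans hw1.symm) hvw
    have h := Set.mem_image_of_mem (Fintype.linearCombination ℝ e) (bary_cells_inter hf hg ⟨hw, hv⟩)
    rw [LinearMap.image_convexHull] at h
    refine convexHull_mono ?_ h
    rw [coe_cell, coe_cell]
    exact Set.image_inter_subset _ _ _
  cover := by
    intro x hx
    obtain ⟨w, h0, h1, -, rfl⟩ := exists_of_mem_convexHull_image hx
    obtain ⟨f, hf, v, hv0, hv1, rfl⟩ := exists_tri_of_nonneg t h0 h1
    refine ⟨cell e t f, ⟨f, hf, rfl⟩, ?_⟩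
    simp only [map_sum, map_smul]
    exact (convex_convexHull ℝ _).sum_mem (fun a _ => hv0 a) hv1 fun a _ =>
      subset_convexHull ℝ _ (mem_coe.2 (mem_cell.2 ⟨a, rfl⟩))

end RingDisk

end

/-! ### Cutting an edge into thirds. -/

section

open Geometry Finset
open scoped Classical

section Edge

variable {E : Type*} [AddCommGroup E] [Module ℝ E]

/-- The point of the segment from `x` to `y` at one third of its length from `x`. -/
noncomputable def thirdPoint (x y : E) : E := (2 / 3 : ℝ) • x + (1 / 3 : ℝ) • y

/-- The three edges of the subdivision of an edge into thirds. -/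
def edgeCells (σ : Finset E) : Set (Finset E) :=
  {F | ∃ x y, x ≠ y ∧ σ = {x, y} ∧
    (F = {x, thirdPoint x y} ∨ F = {thirdPoint x y, thirdPoint y x})}

theorem finset_pair_eq_pair {α : Type*} {x y a b : α} (h : ({x, y} : Finset α) = {a, b}) :
    (x = a ∧ y = b) ∨ (x = b ∧ y = a) := by
  have := congrArg (fun s : Finset α => (s : Set α)) h
  simp only [coe_pair] at this
  exact Set.pair_eq_pair_iff.1 this

theorem mem_edgeCells_pair {x y : E} (hxy : x ≠ y) {F : Finset E} :
    F ∈ edgeCells {x, y} ↔ F = {x, thirdPoint x y} ∨ F = {thirdPoint x y, thirdPoint y x} ∨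
      F = {thirdPoint y x, y} := by
  constructor
  · rintro ⟨a, b, -, h, hF⟩
    rcases finset_pair_eq_pair h with ⟨rfl, rfl⟩ | ⟨rfl, rfl⟩
    · tauto
    · rcases hF with h | h
      · exact .inr (.inr (h.trans (pair_comm _ _)))
      · exact .inr (.inl (h.trans (pair_comm _ _)))
  · rintro (h | h | h)
    · exact ⟨x, y, hxy, rfl, .inl h⟩
    · exact ⟨x, y, hxy, rfl, .inr h⟩
    · exact ⟨y, x, hxy.symm, pair_comm _ _, .inl (h.trans (pair_comm _ _))⟩

theorem lineMap_one_third (x y : E) :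
    AffineMap.lineMap (k := ℝ) x y (1 / 3 : ℝ) = thirdPoint x y := by
  rw [AffineMap.lineMap_apply_module, thirdPoint]; norm_num

theorem lineMap_two_thirds (x y : E) :
    AffineMap.lineMap (k := ℝ) x y (2 / 3 : ℝ) = thirdPoint y x := by
  rw [AffineMap.lineMap_apply_module, thirdPoint, add_comm]; norm_num

theorem mem_convexHull_lineMap {x y z : E} {a b : ℝ} (hab : a ≤ b) :
    z ∈ convexHull ℝ {AffineMap.lineMap x y a, AffineMap.lineMap x y b} ↔
      ∃ s ∈ Set.Icc a b, AffineMap.lineMap x y s = z := by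
  rw [convexHull_pair, ← image_segment, segment_eq_Icc hab]; rfl

theorem exists_lineMap_of_mem_edgeCells {x y : E} (hxy : x ≠ y) {F : Finset E} :
    F ∈ edgeCells {x, y} ↔ ∃ i : Fin 3,
      F = {AffineMap.lineMap x y ((i : ℝ) / 3), AffineMap.lineMap x y (((i : ℝ) + 1) / 3)} := by
  rw [mem_edgeCells_pair hxy, Fin.exists_fin_succ, Fin.exists_fin_two]
  have e0 : (AffineMap.lineMap x y (0 : ℝ) : E) = x := AffineMap.lineMap_apply_zero _ _
  have e1 : (AffineMap.lineMap x y (1 : ℝ) : E) = y := AffineMap.lineMap_apply_one _ _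
  have e2 := lineMap_one_third x y
  have e3 := lineMap_two_thirds x y
  norm_num at e2 e3 ⊢
  norm_num [e2, e3]

theorem lineMap_injective {x y : E} (hxy : x ≠ y) :
    Function.Injective (AffineMap.lineMap (k := ℝ) x y) :=
  AffineMap.lineMap_injective ℝ hxy

theorem triangulates_edgeCells {x y : E} (hxy : x ≠ y) :
    SimplicialComplex.Triangulates (edgeCells {x, y}) {x, y} where
  finite := by
    have : (({({x, thirdPoint x y} : Finset E), {thirdPoint x y, thirdPoint y x},
      {thirdPoint y x, y}}) : Set (Finset E)).Finite := by simp
    exact this.subset fun F hF => (mem_edgeCells_pair hxy).1 hF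
  subset := by
    intro F hF z hz
    obtain ⟨i, rfl⟩ := (exists_lineMap_of_mem_edgeCells hxy).1 hF
    have hi : (i : ℝ) ≤ 2 := by exact_mod_cast Nat.le_of_lt_succ i.2
    have hi0 : (0 : ℝ) ≤ (i : ℝ) := by positivity
    rw [coe_pair, convexHull_pair]
    simp only [coe_pair, Set.mem_insert_iff, Set.mem_singleton_iff] at hz
    rw [segment_eq_image_lineMap]
    rcases hz with rfl | rfl
    · exact Set.mem_image_of_mem _ ⟨by positivity, by linarith⟩
    · exact Set.mem_image_of_mem _ ⟨by positivity, by linarith⟩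
  indep := by
    intro F hF
    obtain ⟨i, rfl⟩ := (exists_lineMap_of_mem_edgeCells hxy).1 hF
    have hne : (AffineMap.lineMap x y ((i : ℝ) / 3) : E) ≠
        AffineMap.lineMap x y (((i : ℝ) + 1) / 3) := fun h => by
      have := lineMap_injective hxy h
      linarith
    have := (affineIndependent_of_ne ℝ hne).range
    refine this.mono (t := Set.range _) ?_
    simp [Matrix.range_cons, Set.pair_comm]
  inter := by
    have key : ∀ i j : Fin 3, i < j → ∀ z,
      z ∈ convexHull ℝ {(AffineMap.lineMap x y ((i : ℝ) / 3) : E),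
        AffineMap.lineMap x y (((i : ℝ) + 1) / 3)} →
      z ∈ convexHull ℝ {(AffineMap.lineMap x y ((j : ℝ) / 3) : E),
        AffineMap.lineMap x y (((j : ℝ) + 1) / 3)} →
      z = AffineMap.lineMap x y (((i : ℝ) + 1) / 3) ∧ z = AffineMap.lineMap x y ((j : ℝ) / 3) := by
      intro i j hij z hz hz'
      obtain ⟨s, hs, rfl⟩ := (mem_convexHull_lineMap (by linarith)).1 hz
      obtain ⟨r, hr, hrs⟩ := (mem_convexHull_lineMap (by linarith)).1 hz'
      obtain rfl := lineMap_injective hxy hrs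
      have hij' : (i : ℝ) + 1 ≤ j := by exact_mod_cast hij
      have e1 : r = (i + 1 : ℝ) / 3 := by linarith [hs.1, hs.2, hr.1, hr.2]
      have e2 : r = (j : ℝ) / 3 := by linarith [hs.1, hs.2, hr.1, hr.2]
      exact ⟨by rw [← e1], by rw [← e2]⟩
    rintro F hF G hG z ⟨hz, hz'⟩
    obtain ⟨i, rfl⟩ := (exists_lineMap_of_mem_edgeCells hxy).1 hF
    obtain ⟨j, rfl⟩ := (exists_lineMap_of_mem_edgeCells hxy).1 hG
    rw [coe_pair] at hz hz' ⊢
    rw [coe_pair]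
    rcases lt_trichotomy i j with h | rfl | h
    · obtain ⟨h1, h2⟩ := key i j h z hz hz'
      exact subset_convexHull ℝ _ ⟨by simp [h1], by simp [h2]⟩
    · rwa [Set.inter_self]
    · obtain ⟨h1, h2⟩ := key j i h z hz' hz
      exact subset_convexHull ℝ _ ⟨by simp [h2], by simp [h1]⟩
  cover := by
    intro z hz
    rw [coe_pair, convexHull_pair, segment_eq_image_lineMap] at hz
    obtain ⟨s, hs, rfl⟩ := hz
    have : ∃ i : Fin 3, (i : ℝ) / 3 ≤ s ∧ s ≤ ((i : ℝ) + 1) / 3 := by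
      rcases le_total s (1 / 3) with h | h
      · exact ⟨0, by simpa using hs.1, by norm_num; linarith⟩
      rcases le_total s (2 / 3) with h' | h'
      · exact ⟨1, by norm_num; linarith, by norm_num; linarith⟩
      · exact ⟨2, by norm_num; linarith, by norm_num; linarith [hs.2]⟩
    obtain ⟨i, hi⟩ := this
    refine ⟨_, (exists_lineMap_of_mem_edgeCells hxy).2 ⟨i, rfl⟩, ?_⟩
    rw [coe_pair]
    exact (mem_convexHull_lineMap (by linarith)).2 ⟨s, hi, rfl⟩

/-- The only cell at `x` ends one third along the edge. Hence the ends of a cut edge are no longer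
adjacent, nor is an end adjacent to the far third point. -/
theorem pair_not_subset_edgeCell {x y : E} (hxy : x ≠ y) {F : Finset E}
    (hF : F ∈ edgeCells {x, y}) (hx : x ∈ F) :
    y ∉ F ∧ thirdPoint y x ∉ F := by
  have inj := lineMap_injective hxy
  have e0 : (AffineMap.lineMap x y (0 : ℝ) : E) = x := AffineMap.lineMap_apply_zero _ _
  have e1 : (AffineMap.lineMap x y (1 : ℝ) : E) = y := AffineMap.lineMap_apply_one _ _
  have e3 := lineMap_two_thirds x y
  obtain ⟨i, rfl⟩ := (exists_lineMap_of_mem_edgeCells hxy).1 hF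
  have hi : (0 : ℝ) ≤ i := by positivity
  have h0 : (AffineMap.lineMap x y (0 : ℝ) : E) ∈ ({AffineMap.lineMap x y ((i : ℝ) / 3),
      AffineMap.lineMap x y (((i : ℝ) + 1) / 3)} : Finset E) := by rwa [e0]
  simp only [mem_insert, mem_singleton, inj.eq_iff] at h0
  have hi0 : (i : ℝ) = 0 := by rcases h0 with h | h <;> linarith
  rw [hi0]
  have h1 : ∀ s : ℝ, 1 / 3 < s → (AffineMap.lineMap x y s : E) ∉
      ({AffineMap.lineMap x y ((0 : ℝ) / 3), AffineMap.lineMap x y (((0 : ℝ) + 1) / 3)} :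
        Finset E) := by
    intro s hs
    simp only [mem_insert, mem_singleton, inj.eq_iff, not_or]
    constructor <;> intro h <;> linarith
  have h2 := h1 1 (by norm_num)
  have h3 := h1 (2 / 3) (by norm_num)
  rw [e1] at h2
  rw [e3] at h3
  exact ⟨h2, h3⟩

end Edge

end

/-! ### Cells of the subdivision relative to a flag subcomplex. -/

section

open Geometry Finset
open scoped Classical

namespace Geometry.SimplicialComplex

variable {E : Type*} [AddCommGroup E] [Module ℝ E]

theorem pair_mem_faces_iff {K : SimplicialComplex ℝ E} {x y : E} :
    (∃ s ∈ K.faces, (s : Set E) = {x, y}) ↔ ({x, y} : Finset E) ∈ K.faces := by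
  constructor
  · rintro ⟨s, hs, h⟩
    rw [← coe_pair, coe_inj] at h
    rwa [← h]
  · exact fun h => ⟨_, h, coe_pair⟩

theorem edgeGraph_adj_iff {K : SimplicialComplex ℝ E} {v w : K.vertices} :
    K.edgeGraph.Adj v w ↔ (v : E) ≠ w ∧ {(v : E), (w : E)} ∈ K.faces :=
  and_congr (not_congr Subtype.ext_iff) pair_mem_faces_iff

theorem isFlag_iff {K : SimplicialComplex ℝ E} :
    K.IsFlag ↔ ∀ s : Finset E, s.Nonempty → (∀ x ∈ s, x ∈ K.vertices) →
      (∀ x ∈ s, ∀ y ∈ s, x ≠ y → {x, y} ∈ K.faces) → s ∈ K.faces := by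
  constructor
  · intro h s hs hv hp
    have := h (s.subtype (· ∈ K.vertices)) (by
      obtain ⟨x, hx⟩ := hs
      exact ⟨⟨x, hv x hx⟩, by simpa using hx⟩) (by
      intro x hx y hy hxy
      rw [mem_coe, mem_subtype] at hx hy
      exact ⟨hxy, pair_mem_faces_iff.2 (hp _ hx _ hy fun e => hxy (Subtype.ext e))⟩)
    rwa [subtype_map_of_mem hv] at this
  · intro h s hs hc
    refine h _ (by simpa using hs) ?_ ?_
    · intro x hx
      obtain ⟨v, -, rfl⟩ := mem_map.1 hx
      exact v.2
    · intro x hx y hy hxy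
      obtain ⟨v, hv, rfl⟩ := mem_map.1 hx
      obtain ⟨w, hw, rfl⟩ := mem_map.1 hy
      exact pair_mem_faces_iff.1 (hc hv hw fun e => hxy (by rw [e])).2

theorem not_square_iff {K : SimplicialComplex ℝ E} :
    (¬ (SimpleGraph.cycleGraph 4).IsIndContained K.edgeGraph) ↔
      ∀ a b c d : E, a ≠ b → b ≠ c → c ≠ d → d ≠ a → a ≠ c → b ≠ d → {a, b} ∈ K.faces →
        {b, c} ∈ K.faces → {c, d} ∈ K.faces → {d, a} ∈ K.faces →
        {a, c} ∈ K.faces ∨ {b, d} ∈ K.faces := by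
  constructor
  · intro h a b c d hab hbc hcd hda hac hbd h1 h2 h3 h4
    by_contra! hn
    apply h
    have hv : ∀ {x y : E}, {x, y} ∈ K.faces → x ∈ K.vertices := fun h =>
      K.down_closed h (by simp) (singleton_nonempty _)
    let f : Fin 4 → K.vertices := ![⟨a, hv h1⟩, ⟨b, hv h2⟩, ⟨c, hv h3⟩, ⟨d, hv h4⟩]
    refine ⟨⟨⟨f, ?_⟩, ?_⟩⟩
    · intro i j hij
      fin_cases i <;> fin_cases j <;> simp_all [f, Ne.symm]
    · intro i j
      change K.edgeGraph.Adj (f i) (f j) ↔ _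
      rw [edgeGraph_adj_iff]
      have hac' : {c, a} ∉ K.faces := by rw [pair_comm]; exact hn.1
      have hbd' : {d, b} ∉ K.faces := by rw [pair_comm]; exact hn.2
      have h1' : {b, a} ∈ K.faces := by rwa [pair_comm]
      have h2' : {c, b} ∈ K.faces := by rwa [pair_comm]
      have h3' : {d, c} ∈ K.faces := by rwa [pair_comm]
      have h4' : {a, d} ∈ K.faces := by rwa [pair_comm]
      have hd : ∀ i j : Fin 4, (SimpleGraph.cycleGraph 4).Adj i j ↔ (i = j + 1 ∨ j = i + 1) := by
        decide
      rw [hd]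
      fin_cases i <;> fin_cases j <;>
        simp [f, *, hab.symm, hbc.symm, hcd.symm, hda.symm, hac.symm, hbd.symm]
  · rintro h ⟨f⟩
    have hadj : ∀ i j, (SimpleGraph.cycleGraph 4).Adj i j ↔
        (f i : E) ≠ f j ∧ {(f i : E), (f j : E)} ∈ K.faces := fun i j => by
      rw [← f.map_adj_iff, edgeGraph_adj_iff]
    have hne : ∀ i j, i ≠ j → (f i : E) ≠ f j := fun i j hij e =>
      hij (f.injective (Subtype.ext e))
    have a01 := (hadj 0 1).1 (by decide)
    have a12 := (hadj 1 2).1 (by decide)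
    have a23 := (hadj 2 3).1 (by decide)
    have a30 := (hadj 3 0).1 (by decide)
    rcases h (f 0) (f 1) (f 2) (f 3) a01.1 a12.1 a23.1 a30.1 (hne _ _ (by decide))
      (hne _ _ (by decide)) a01.2 a12.2 a23.2 a30.2 with h | h
    · exact absurd ((hadj 0 2).2 ⟨hne _ _ (by decide), h⟩) (by decide)
    · exact absurd ((hadj 1 3).2 ⟨hne _ _ (by decide), h⟩) (by decide)

/-- `e` enumerates the corners of the triangle `σ` so that the pattern of its sides lying in `L` is
the one prescribed by `t`. -/
structure IsFrame (L : SimplicialComplex ℝ E) (σ : Finset E) (e : Fin 3 → E) (t : Fin 3) :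
    Prop where
  inj : Function.Injective e
  image : univ.image e = σ
  side : ∀ k, {e (k + 1), e (k + 2)} ∈ L.faces ↔ RingDisk.full t k = true

/-- If all three sides were in `L`, flagness would put `σ` in `L`. The remaining patterns, with
zero, one or two sides in `L`, are rotated into the positions prescribed by `full`. -/
theorem IsFlag.exists_isFrame {L : SimplicialComplex ℝ E} (hL : L.IsFlag) {σ : Finset E}
    (h3 : σ.card = 3) (hσ : σ ∉ L.faces) : ∃ e t, IsFrame L σ e t := by
  obtain ⟨a, b, c, hab, hac, hbc, rfl⟩ := card_eq_three.1 h3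
  have hn : ¬ ({a, b} ∈ L.faces ∧ {b, c} ∈ L.faces ∧ {c, a} ∈ L.faces) := by
    rintro ⟨h1, h2, h3⟩
    refine hσ (isFlag_iff.1 hL _ (by simp) ?_ ?_)
    · have hv : ∀ {x y : E}, {x, y} ∈ L.faces → x ∈ L.vertices := fun h =>
        L.down_closed h (by simp) (singleton_nonempty _)
      simp [hv h1, hv h2, hv h3]
    · have h1' : {b, a} ∈ L.faces := by rwa [pair_comm]
      have h2' : {c, b} ∈ L.faces := by rwa [pair_comm]
      have h3' : {a, c} ∈ L.faces := by rwa [pair_comm]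
      simp [*]
  have mk : ∀ a b c : E, a ≠ b → a ≠ c → b ≠ c → ∀ t, ({b, c} ∈ L.faces ↔ RingDisk.full t 0 = true) →
      ({c, a} ∈ L.faces ↔ RingDisk.full t 1 = true) →
      ({a, b} ∈ L.faces ↔ RingDisk.full t 2 = true) → IsFrame L {a, b, c} ![a, b, c] t := by
    intro a b c hab hac hbc t h0 h1 h2
    refine ⟨?_, ?_, fun k => ?_⟩
    · intro i j hij
      fin_cases i <;> fin_cases j <;> simp_all
    · ext x; simp [Fin.exists_fin_succ, eq_comm]
    · fin_cases k
      · exact h0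
      · exact h1
      · exact h2
  have r1 : ({a, b, c} : Finset E) = {b, c, a} := by ext; simp; tauto
  have r2 : ({a, b, c} : Finset E) = {c, a, b} := by ext; simp; tauto
  by_cases p : {a, b} ∈ L.faces <;> by_cases q : {b, c} ∈ L.faces <;>
    by_cases r : {c, a} ∈ L.faces
  · exact (hn ⟨p, q, r⟩).elim
  · rw [r1]
    exact ⟨_, 2, mk b c a hbc hab.symm hac.symm 2 (by simp [r, RingDisk.full])
      (by simp [p, RingDisk.full]) (by simp [q, RingDisk.full])⟩
  · exact ⟨_, 2, mk a b c hab hac hbc 2 (by simp [q, RingDisk.full])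
      (by simp [r, RingDisk.full]) (by simp [p, RingDisk.full])⟩
  · exact ⟨_, 1, mk a b c hab hac hbc 1 (by simp [q, RingDisk.full])
      (by simp [r, RingDisk.full]) (by simp [p, RingDisk.full])⟩
  · rw [r2]
    exact ⟨_, 2, mk c a b hac.symm hbc.symm hab 2 (by simp [p, RingDisk.full])
      (by simp [q, RingDisk.full]) (by simp [r, RingDisk.full])⟩
  · rw [r1]
    exact ⟨_, 1, mk b c a hbc hab.symm hac.symm 1 (by simp [r, RingDisk.full])
      (by simp [p, RingDisk.full]) (by simp [q, RingDisk.full])⟩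
  · rw [r2]
    exact ⟨_, 1, mk c a b hac.symm hbc.symm hab 1 (by simp [p, RingDisk.full])
      (by simp [q, RingDisk.full]) (by simp [r, RingDisk.full])⟩
  · exact ⟨_, 0, mk a b c hab hac hbc 0 (by simp [q, RingDisk.full])
      (by simp [r, RingDisk.full]) (by simp [p, RingDisk.full])⟩

/-- The cells of the subdivision of `σ` which leaves `L` unsubdivided. -/
noncomputable def relCells (L : SimplicialComplex ℝ E) (σ : Finset E) : Set (Finset E) :=
  if σ ∈ L.faces ∨ σ.card ≤ 1 then {σ}
  else if σ.card = 2 then edgeCells σ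
  -- A frame is chosen independently for each triangle. The choices need not be coordinated, because
  -- the cells on a side do not depend on them.
  else if h : ∃ p : (Fin 3 → E) × Fin 3, IsFrame L σ p.1 p.2 then
    {F | ∃ f ∈ RingDisk.tri h.choose.2, F = RingDisk.cell h.choose.1 h.choose.2 f}
  else ∅

variable {X L : SimplicialComplex ℝ E}

theorem relCells_of_mem {σ : Finset E} (h : σ ∈ L.faces) : relCells L σ = {σ} := by
  simp [relCells, h]

theorem relCells_of_card_le_one {σ : Finset E} (h : σ.card ≤ 1) : relCells L σ = {σ} := by
  simp [relCells, h]

theorem relCells_pair {x y : E} (hxy : x ≠ y) (h : {x, y} ∉ L.faces) :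
    relCells L {x, y} = edgeCells {x, y} := by
  simp [relCells, h, card_pair hxy]

theorem IsFlag.exists_relCells_eq (hL : L.IsFlag) {σ : Finset E} (h3 : σ.card = 3)
    (hσ : σ ∉ L.faces) : ∃ e t, IsFrame L σ e t ∧
      relCells L σ = {F | ∃ f ∈ RingDisk.tri t, F = RingDisk.cell e t f} := by
  obtain ⟨e, t, het⟩ := hL.exists_isFrame h3 hσ
  have h : ∃ p : (Fin 3 → E) × Fin 3, IsFrame L σ p.1 p.2 := ⟨(e, t), het⟩
  refine ⟨h.choose.1, h.choose.2, h.choose_spec, ?_⟩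
  rw [relCells, if_neg (by simp [hσ, h3]), if_neg (by simp [h3]), dif_pos h]

theorem IsFrame.affineIndependent {σ : Finset E} {e : Fin 3 → E} {t : Fin 3} (h : IsFrame L σ e t)
    (hσ : σ ∈ X.faces) : AffineIndependent ℝ e := by
  have := X.indep hσ
  let g : Fin 3 ↪ σ := ⟨fun i => ⟨e i, by rw [← h.image]; simp⟩, fun i j hij =>
    h.inj (congrArg Subtype.val hij)⟩
  exact this.comp_embedding g

/-- The point with integral barycentric coordinates `c`, scaled by `12`. -/
noncomputable def scaledPoint (e : Fin 3 → E) (c : Fin 3 → ℤ) : E :=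
  Fintype.linearCombination ℝ e fun k => (c k : ℝ) / 12

theorem scaledPoint_pt (e : Fin 3 → E) (t : Fin 3) (i : ℕ) :
    scaledPoint e (RingDisk.pt t i) = RingDisk.place e t i := rfl

theorem scaledPoint_corner (e : Fin 3 → E) (k : Fin 3) :
    scaledPoint e (RingDisk.corner k) = e k := by
  fin_cases k <;>
    simp [scaledPoint, Fintype.linearCombination_apply, Fin.sum_univ_three, RingDisk.corner]

theorem scaledPoint_third (e : Fin 3 → E) {i j : Fin 3} (hij : i ≠ j) :
    scaledPoint e (RingDisk.third i j) = thirdPoint (e i) (e j) := by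
  have h1 : (8 / 12 : ℝ) = 2 / 3 := by norm_num
  have h2 : (4 / 12 : ℝ) = 3⁻¹ := by norm_num
  fin_cases i <;> fin_cases j <;>
    simp_all [scaledPoint, Fintype.linearCombination_apply, Fin.sum_univ_three, RingDisk.third,
      thirdPoint] <;> exact add_comm _ _

/-- The left side does not mention the frame: this is what makes disks in neighbouring triangles fit
together. -/
theorem IsFrame.relCells_side {σ : Finset E} {e : Fin 3 → E} {t : Fin 3} (h : IsFrame L σ e t)
    (k : Fin 3) : relCells L {e (k + 1), e (k + 2)} =
      {G | ∃ g ∈ RingDisk.segs t k, G = {scaledPoint e g.1, scaledPoint e g.2}} := by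
  have hk : k + 1 ≠ k + 2 := by revert k; decide
  have hne : e (k + 1) ≠ e (k + 2) := fun e => hk (h.inj e)
  by_cases hL : {e (k + 1), e (k + 2)} ∈ L.faces
  · rw [relCells_of_mem hL]
    have := (h.side k).1 hL
    ext G
    simp [RingDisk.segs, this, scaledPoint_corner]
  · rw [relCells_pair hne hL]
    have := mt (h.side k).2 hL
    ext G
    simp [RingDisk.segs, this, scaledPoint_corner, scaledPoint_third, hk, hk.symm,
      mem_edgeCells_pair hne]

theorem exists_side_of_card_eq_two {σ ρ : Finset E} {e : Fin 3 → E} {t : Fin 3}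
    (h : IsFrame L σ e t) (hρ : ρ ⊆ σ) (h2 : ρ.card = 2) :
    ∃ k, ρ = {e (k + 1), e (k + 2)} := by
  obtain ⟨x, y, hxy, rfl⟩ := card_eq_two.1 h2
  rw [← h.image] at hρ
  obtain ⟨i, -, rfl⟩ := mem_image.1 (hρ (by simp : x ∈ _))
  obtain ⟨j, -, rfl⟩ := mem_image.1 (hρ (by simp : y ∈ _))
  have hij : i ≠ j := fun e => hxy (by rw [e])
  have : ∀ i j : Fin 3, i ≠ j → ∃ k, (i = k + 1 ∧ j = k + 2) ∨ (i = k + 2 ∧ j = k + 1) := by decide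
  obtain ⟨k, ⟨rfl, rfl⟩ | ⟨rfl, rfl⟩⟩ := this i j hij
  · exact ⟨k, rfl⟩
  · exact ⟨k, pair_comm _ _⟩

theorem place_mem_side_iff {e : Fin 3 → E} (he : AffineIndependent ℝ e) {t : Fin 3} {i : ℕ}
    (hi : i < RingDisk.card t) (k : Fin 3) :
    RingDisk.place e t i ∈ convexHull ℝ ({e (k + 1), e (k + 2)} : Set E) ↔
      RingDisk.pt t i k = 0 := by
  have := RingDisk.place_mem_convexHull_iff he hi (K := {k + 1, k + 2})
  rw [image_insert, image_singleton, coe_pair] at this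
  rw [this]
  have h1 : ∀ k j : Fin 3, j ∉ ({k + 1, k + 2} : Finset (Fin 3)) ↔ j = k := by decide
  simp only [h1, forall_eq]

theorem triangulates_singleton {σ : Finset E} (hσ : σ ∈ X.faces) :
    Triangulates {σ} σ where
  finite := Set.finite_singleton _
  subset F hF := by rw [Set.mem_singleton_iff.1 hF]; exact subset_convexHull ℝ _
  indep F hF := by rw [Set.mem_singleton_iff.1 hF]; exact X.indep hσ
  inter F hF G hG := by
    rw [Set.mem_singleton_iff.1 hF, Set.mem_singleton_iff.1 hG]
    exact X.inter_subset_convexHull hσ hσ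
  cover x hx := ⟨σ, rfl, hx⟩

theorem IsFlag.triangulates_relCells (hL : L.IsFlag) (hX : ∀ s ∈ X.faces, s.card ≤ 3)
    {σ : Finset E} (hσ : σ ∈ X.faces) : Triangulates (relCells L σ) σ := by
  by_cases hσL : σ ∈ L.faces
  · rw [relCells_of_mem hσL]; exact triangulates_singleton hσ
  by_cases h1 : σ.card ≤ 1
  · rw [relCells_of_card_le_one h1]; exact triangulates_singleton hσ
  by_cases h2 : σ.card = 2
  · obtain ⟨x, y, hxy, rfl⟩ := card_eq_two.1 h2
    rw [relCells_pair hxy hσL]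
    exact triangulates_edgeCells hxy
  have h3 : σ.card = 3 := by have := hX σ hσ; omega
  obtain ⟨e, t, het, h⟩ := hL.exists_relCells_eq h3 hσL
  rw [h]
  have := RingDisk.triangulates (het.affineIndependent hσ) t
  rwa [het.image] at this

/-- The only substantial compatibility is between a disk and its sides and corners, which is read
off the finite tables. -/
noncomputable def relTriangulation (hX : ∀ s ∈ X.faces, s.card ≤ 3) (hL : L.IsFlag) :
    X.CellwiseTriangulation where
  cells := relCells L
  triangulates σ hσ := hL.triangulates_relCells hX hσ
  restrict := by
    intro σ hσ ρ hρσ hρ F hF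
    rcases hρσ.eq_or_ssubset with rfl | hss
    · exact ⟨F, hF, fun p hp _ => hp⟩
    have hlt := card_lt_card hss
    have hpos := hρ.card_pos
    by_cases h1 : ρ.card ≤ 1
    · rw [relCells_of_card_le_one h1]
      refine ⟨ρ, rfl, fun p _ hp => ?_⟩
      obtain ⟨a, rfl⟩ := card_eq_one.1 (le_antisymm h1 hpos)
      simpa using hp
    by_cases hσL : σ ∈ L.faces
    · rw [relCells_of_mem hσL] at hF
      rw [relCells_of_mem (L.down_closed hσL hρσ hρ)]
      refine ⟨ρ, rfl, fun p hp hpρ => ?_⟩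
      rw [Set.mem_singleton_iff.1 hF] at hp
      exact (X.vertex_mem_convexHull_iff (X.down_closed hσ (singleton_subset_iff.2 hp)
        (singleton_nonempty _)) (X.down_closed hσ hρσ hρ)).1 hpρ
    have h3 : σ.card = 3 := by have := hX σ hσ; omega
    obtain ⟨e, t, het, h⟩ := hL.exists_relCells_eq h3 hσL
    rw [h] at hF
    obtain ⟨f, hf, rfl⟩ := hF
    obtain ⟨k, rfl⟩ := exists_side_of_card_eq_two het hρσ (by omega)
    rw [het.relCells_side]
    obtain ⟨g, hg, hgf⟩ := RingDisk.side_subset t f hf k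
    refine ⟨_, ⟨g, hg, rfl⟩, fun p hp hpρ => ?_⟩
    obtain ⟨a, rfl⟩ := RingDisk.mem_cell.1 hp
    rw [coe_pair, place_mem_side_iff (het.affineIndependent hσ) (RingDisk.tri_lt t f hf a)] at hpρ
    rw [mem_insert, mem_singleton]
    rcases hgf a hpρ with h | h
    · left; rw [← h]; rfl
    · right; rw [← h]; rfl
  extend := by
    intro σ hσ ρ hρσ hρ G hG
    rcases hρσ.eq_or_ssubset with rfl | hss
    · exact ⟨G, hG, Subset.refl _⟩
    have hlt := card_lt_card hss
    have hpos := hρ.card_pos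
    by_cases hσL : σ ∈ L.faces
    · rw [relCells_of_mem (L.down_closed hσL hρσ hρ)] at hG
      rw [relCells_of_mem hσL]
      exact ⟨σ, rfl, by rwa [Set.mem_singleton_iff.1 hG]⟩
    by_cases h2 : σ.card = 2
    · have h1 : ρ.card = 1 := by omega
      rw [relCells_of_card_le_one h1.le] at hG
      rw [Set.mem_singleton_iff.1 hG]
      obtain ⟨x, y, hxy, rfl⟩ := card_eq_two.1 h2
      obtain ⟨a, rfl⟩ := card_eq_one.1 h1
      rw [relCells_pair hxy hσL]
      have ha := hρσ (mem_singleton_self a)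
      rw [mem_insert, mem_singleton] at ha
      rcases ha with rfl | rfl
      · exact ⟨_, (mem_edgeCells_pair hxy).2 (.inl rfl), by simp⟩
      · exact ⟨_, (mem_edgeCells_pair hxy).2 (.inr (.inr rfl)), by simp⟩
    have h3 : σ.card = 3 := by have := hX σ hσ; omega
    obtain ⟨e, t, het, h⟩ := hL.exists_relCells_eq h3 hσL
    rw [h]
    by_cases h1 : ρ.card = 1
    · rw [relCells_of_card_le_one h1.le] at hG
      rw [Set.mem_singleton_iff.1 hG]
      obtain ⟨a, rfl⟩ := card_eq_one.1 h1
      have ha := hρσ (mem_singleton_self a)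
      rw [← het.image] at ha
      obtain ⟨k, -, rfl⟩ := mem_image.1 ha
      obtain ⟨f, hf, a, hfa⟩ := RingDisk.exists_tri_corner t k
      refine ⟨_, ⟨f, hf, rfl⟩, singleton_subset_iff.2 (RingDisk.mem_cell.2 ⟨a, ?_⟩)⟩
      rw [← scaledPoint_pt, hfa, scaledPoint_corner]
    · obtain ⟨k, rfl⟩ := exists_side_of_card_eq_two het hρσ (by omega)
      rw [het.relCells_side] at hG
      obtain ⟨g, hg, rfl⟩ := hG
      obtain ⟨f, hf, ⟨a, ha⟩, b, hb⟩ := RingDisk.segs_subset t k g hg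
      refine ⟨_, ⟨f, hf, rfl⟩, ?_⟩
      rw [insert_subset_iff, singleton_subset_iff, RingDisk.mem_cell, RingDisk.mem_cell]
      exact ⟨⟨a, by rw [← ha]; rfl⟩, b, by rw [← hb]; rfl⟩

end Geometry.SimplicialComplex

end

/-! ### Flagness, fullness and absence of squares. -/

section

open Geometry Finset
open scoped Classical

namespace Geometry.SimplicialComplex

variable {E : Type*} [AddCommGroup E] [Module ℝ E] {X L : SimplicialComplex ℝ E}

/-- `σ` is the simplex of `X` whose relative interior contains `v`. -/
structure IsCarrier (X : SimplicialComplex ℝ E) (σ : Finset E) (v : E) : Prop where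
  mem_faces : σ ∈ X.faces
  mem_convexHull : v ∈ convexHull ℝ (σ : Set E)
  notMem_of_ssubset : ∀ ρ ⊂ σ, v ∉ convexHull ℝ (ρ : Set E)

theorem IsCarrier.subset {σ τ : Finset E} {v : E} (h : IsCarrier X σ v) (hτ : τ ∈ X.faces)
    (hv : v ∈ convexHull ℝ (τ : Set E)) : σ ⊆ τ := by
  by_contra hn
  refine h.notMem_of_ssubset (σ ∩ τ) ⟨inter_subset_left, fun hs =>
    hn (hs.trans inter_subset_right)⟩ ?_
  rw [coe_inter]
  exact X.inter_subset_convexHull h.mem_faces hτ ⟨h.mem_convexHull, hv⟩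

theorem exists_isCarrier {σ : Finset E} {v : E} (hσ : σ ∈ X.faces)
    (hv : v ∈ convexHull ℝ (σ : Set E)) : ∃ τ, IsCarrier X τ v := by
  induction σ using Finset.strongInduction with
  | H σ ih =>
    by_cases h : ∃ ρ ⊂ σ, v ∈ convexHull ℝ (ρ : Set E)
    · obtain ⟨ρ, hρ, hvρ⟩ := h
      have hne : ρ.Nonempty := coe_nonempty.1 (convexHull_nonempty_iff.1 ⟨v, hvρ⟩)
      exact ih ρ hρ (X.down_closed hσ hρ.1 hne) hvρ
    · push Not at h
      exact ⟨σ, hσ, hv, h⟩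

theorem isCarrier_thirdPoint {x y : E} (hxy : x ≠ y) (h : {x, y} ∈ X.faces) :
    IsCarrier X {x, y} (thirdPoint x y) := by
  refine ⟨h, ?_, fun ρ hρ hm => ?_⟩
  · exact (triangulates_edgeCells hxy).subset _ ((mem_edgeCells_pair hxy).2 (.inl rfl)) (by simp)
  · have hne : ρ.Nonempty := coe_nonempty.1 (convexHull_nonempty_iff.1 ⟨_, hm⟩)
    have hlt := card_lt_card hρ
    rw [card_pair hxy] at hlt
    obtain ⟨a, rfl⟩ := card_eq_one.1 (le_antisymm (Nat.lt_succ_iff.1 hlt) hne.card_pos)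
    have ha := hρ.1 (mem_singleton_self a)
    rw [coe_singleton, convexHull_singleton, Set.mem_singleton_iff, ← lineMap_one_third] at hm
    have inj := lineMap_injective hxy
    rw [mem_insert, mem_singleton, ← hm] at ha
    rcases ha with ha | ha
    · have := @inj (1 / 3) 0 (ha.trans (AffineMap.lineMap_apply_zero _ _).symm)
      norm_num at this
    · have := @inj (1 / 3) 1 (ha.trans (AffineMap.lineMap_apply_one _ _).symm)
      norm_num at this

/-- `v` lies in the interior of a triangle of `X` which is not in `L`. -/
def IsTriangleInterior (X L : SimplicialComplex ℝ E) (v : E) : Prop :=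
  ∃ σ, IsCarrier X σ v ∧ σ ∉ L.faces ∧ σ.card = 3

/-- The subdivision of `X` relative to `L`. -/
noncomputable def relSubdivision (hX : ∀ s ∈ X.faces, s.card ≤ 3) (hL : L.IsFlag) :
    SimplicialComplex ℝ E :=
  (relTriangulation hX hL).complex

section

variable {hX : ∀ s ∈ X.faces, s.card ≤ 3} {hL : L.IsFlag}

theorem exists_relCell {s σ : Finset E} (hs : s ∈ (relSubdivision hX hL).faces)
    (hσ : σ ∈ X.faces) (hsσ : (s : Set E) ⊆ convexHull ℝ (σ : Set E)) :
    ∃ F ∈ relCells L σ, s ⊆ F :=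
  (relTriangulation hX hL).exists_cell hs hσ hsσ

theorem mem_relSubdivision_of_subset {s F σ : Finset E} (hs : s.Nonempty) (hσ : σ ∈ X.faces)
    (hF : F ∈ relCells L σ) (hsF : s ⊆ F) : s ∈ (relSubdivision hX hL).faces :=
  ⟨hs, σ, hσ, F, hF, hsF⟩

theorem exists_face_of_mem_relSubdivision {s : Finset E}
    (hs : s ∈ (relSubdivision hX hL).faces) :
    ∃ σ ∈ X.faces, (s : Set E) ⊆ convexHull ℝ (σ : Set E) := by
  obtain ⟨-, σ, hσ, F, hF, hsF⟩ := hs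
  exact ⟨σ, hσ, (coe_subset.2 hsF).trans ((hL.triangulates_relCells hX hσ).subset F hF)⟩

/-- The edge of `X` joining `x` and `y` would be cut if it were not in `L`, and then its ends share
no cell. -/
theorem pair_mem_of_vertices {x y : E} (hx : x ∈ X.vertices) (hy : y ∈ X.vertices) (hxy : x ≠ y)
    (h : {x, y} ∈ (relSubdivision hX hL).faces) : {x, y} ∈ L.faces := by
  obtain ⟨σ, hσ, hs⟩ := exists_face_of_mem_relSubdivision h
  rw [coe_pair, Set.pair_subset_iff] at hs
  have hxσ := (X.vertex_mem_convexHull_iff hx hσ).1 hs.1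
  have hyσ := (X.vertex_mem_convexHull_iff hy hσ).1 hs.2
  have hp : {x, y} ∈ X.faces := X.down_closed hσ
    (insert_subset_iff.2 ⟨hxσ, singleton_subset_iff.2 hyσ⟩) (by simp)
  by_contra hn
  obtain ⟨F, hF, hsF⟩ := exists_relCell h hp (subset_convexHull ℝ _)
  rw [relCells_pair hxy hn] at hF
  exact (pair_not_subset_edgeCell hxy hF (hsF (by simp))).1 (hsF (by simp))

/-- Any simplex of `X` containing `m` contains its carrier, hence equals it by the bound on
dimension. So the star of `m` lies in one triangle, and questions near `m` become questions about
the disk. -/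
theorem IsTriangleInterior.exists_frame {m : E} (hm : IsTriangleInterior X L m)
    (hmK : m ∈ (relSubdivision hX hL).vertices) :
    ∃ σ e t i, σ ∈ X.faces ∧ IsFrame L σ e t ∧
      relCells L σ = {F | ∃ f ∈ RingDisk.tri t, F = RingDisk.cell e t f} ∧
      i < RingDisk.card t ∧ m = RingDisk.place e t i ∧ ¬ RingDisk.IsBd t i ∧
      ∀ s ∈ (relSubdivision hX hL).faces, m ∈ s → (s : Set E) ⊆ convexHull ℝ (σ : Set E) := by
  obtain ⟨σ, hc, hσL, h3⟩ := hm
  obtain ⟨e, t, het, h⟩ := hL.exists_relCells_eq h3 hσL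
  obtain ⟨F, hF, hmF⟩ := exists_relCell hmK hc.mem_faces
    (by simpa using hc.mem_convexHull)
  rw [h] at hF
  obtain ⟨f, hf, rfl⟩ := hF
  obtain ⟨a, rfl⟩ := RingDisk.mem_cell.1 (hmF (mem_singleton_self m))
  have hlt := RingDisk.tri_lt t f hf a
  refine ⟨σ, e, t, f a, hc.mem_faces, het, h, hlt, rfl, ?_, fun s hs hms => ?_⟩
  · rintro ⟨k, hk⟩
    rw [← place_mem_side_iff (het.affineIndependent hc.mem_faces) hlt, ← coe_pair] at hk
    refine hc.notMem_of_ssubset _ ?_ hk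
    refine ssubset_of_subset_of_ne ?_ fun heq => ?_
    · rw [insert_subset_iff, singleton_subset_iff, ← het.image]; simp
    · have := card_le_two (a := e (k + 1)) (b := e (k + 2))
      rw [heq, h3] at this
      omega
  · obtain ⟨τ, hτ, hsτ⟩ := exists_face_of_mem_relSubdivision hs
    have hστ := hc.subset hτ (hsτ hms)
    rwa [eq_of_subset_of_card_le hστ (by rw [h3]; exact hX τ hτ)]

section Frame

variable {σ : Finset E} {e : Fin 3 → E} {t : Fin 3}

theorem exists_tri_of_face (hσ : σ ∈ X.faces)
    (h : relCells L σ = {F | ∃ f ∈ RingDisk.tri t, F = RingDisk.cell e t f})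
    {s : Finset E} (hs : s ∈ (relSubdivision hX hL).faces)
    (hsσ : (s : Set E) ⊆ convexHull ℝ (σ : Set E)) :
    ∃ f ∈ RingDisk.tri t, s ⊆ RingDisk.cell e t f := by
  obtain ⟨F, hF, hsF⟩ := exists_relCell hs hσ hsσ
  rw [h] at hF
  obtain ⟨f, hf, rfl⟩ := hF
  exact ⟨f, hf, hsF⟩

theorem exists_place_of_vertex (hσ : σ ∈ X.faces)
    (h : relCells L σ = {F | ∃ f ∈ RingDisk.tri t, F = RingDisk.cell e t f})
    {v : E} (hv : v ∈ (relSubdivision hX hL).vertices)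
    (hvσ : v ∈ convexHull ℝ (σ : Set E)) :
    ∃ i < RingDisk.card t, v = RingDisk.place e t i := by
  obtain ⟨f, hf, hs⟩ := exists_tri_of_face hσ h hv (by simpa using hvσ)
  obtain ⟨a, rfl⟩ := RingDisk.mem_cell.1 (hs (mem_singleton_self v))
  exact ⟨f a, RingDisk.tri_lt t f hf a, rfl⟩

theorem place_mem_convexHull (hσ : σ ∈ X.faces) (het : IsFrame L σ e t) {i : ℕ} (hi : i < RingDisk.card t) :
    RingDisk.place e t i ∈ convexHull ℝ (σ : Set E) := by
  rw [← het.image]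
  exact (RingDisk.place_mem_convexHull_iff (het.affineIndependent hσ) hi).2 (by simp)

/-- Each disk sits in the subdivision as an induced subgraph, so the tables apply to adjacency in
the whole complex. -/
theorem adj_place_iff (hσ : σ ∈ X.faces) (het : IsFrame L σ e t)
    (h : relCells L σ = {F | ∃ f ∈ RingDisk.tri t, F = RingDisk.cell e t f})
    {i j : ℕ} (hi : i < RingDisk.card t) (hj : j < RingDisk.card t) :
    (RingDisk.place e t i ≠ RingDisk.place e t j ∧
      {RingDisk.place e t i, RingDisk.place e t j} ∈ (relSubdivision hX hL).faces) ↔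
      RingDisk.Adj t i j := by
  have he := het.affineIndependent hσ
  constructor
  · rintro ⟨hne, hf⟩
    obtain ⟨f, hf, hs⟩ := exists_tri_of_face hσ h hf (by
      rw [coe_pair, Set.pair_subset_iff]
      exact ⟨place_mem_convexHull hσ het hi, place_mem_convexHull hσ het hj⟩)
    obtain ⟨a, ha⟩ := RingDisk.mem_cell.1 (hs (mem_insert_self _ _))
    obtain ⟨b, hb⟩ := RingDisk.mem_cell.1 (hs (mem_insert_of_mem (mem_singleton_self _)))
    exact ⟨fun hij => hne (by rw [hij]), f, hf,
      ⟨a, RingDisk.place_inj he (RingDisk.tri_lt t f hf a) hi ha⟩,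
      b, RingDisk.place_inj he (RingDisk.tri_lt t f hf b) hj hb⟩
  · rintro ⟨hij, f, hf, ⟨a, rfl⟩, b, rfl⟩
    refine ⟨fun hn => hij (RingDisk.place_inj he hi hj hn), ?_⟩
    refine mem_relSubdivision_of_subset (F := RingDisk.cell e t f) (by simp) hσ
      (h ▸ ⟨f, hf, rfl⟩) ?_
    rw [insert_subset_iff, singleton_subset_iff, RingDisk.mem_cell, RingDisk.mem_cell]
    exact ⟨⟨a, rfl⟩, b, rfl⟩

theorem isBd_of_not_isTriangleInterior {i : ℕ} (hσ : σ ∈ X.faces) (het : IsFrame L σ e t)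
    (h3 : σ.card = 3) (hσL : σ ∉ L.faces)
    (hi : i < RingDisk.card t) (hn : ¬ IsTriangleInterior X L (RingDisk.place e t i)) :
    RingDisk.IsBd t i := by
  have he := het.affineIndependent hσ
  by_contra hb
  refine hn ⟨σ, ⟨hσ, place_mem_convexHull hσ het hi, fun ρ hρ hm => ?_⟩, hσL, h3⟩
  obtain ⟨x, hxσ, hxρ⟩ := exists_of_ssubset hρ
  have hρσ := hρ.1
  rw [← het.image] at hxσ hρσ
  obtain ⟨k, -, rfl⟩ := mem_image.1 hxσ
  have hsub : ρ ⊆ (univ.erase k).image e := by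
    intro y hy
    obtain ⟨j, -, rfl⟩ := mem_image.1 (hρσ hy)
    exact mem_image_of_mem e (mem_erase.2 ⟨fun hjk => hxρ (hjk ▸ hy), mem_univ _⟩)
  have := convexHull_mono (coe_subset.2 hsub) hm
  rw [RingDisk.place_mem_convexHull_iff he hi] at this
  exact hb ⟨k, this k (by simp)⟩

end Frame

/-- If the edge lies in a triangle of `X`, its ends are boundary vertices of the disk there, and
`common_side` forces `z` onto the side `xy`. On that side the cells are explicit. -/
theorem eq_of_adj_thirdPoint {x y z : E} (hxy : x ≠ y) (hp : {x, y} ∈ X.faces)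
    (hpL : {x, y} ∉ L.faces) (hz : ¬ IsTriangleInterior X L z) (hne : thirdPoint x y ≠ z)
    (hadj : {thirdPoint x y, z} ∈ (relSubdivision hX hL).faces) :
    z = x ∨ z = thirdPoint y x := by
  have hc := isCarrier_thirdPoint hxy hp
  have hmain : z ∈ convexHull ℝ (({x, y} : Finset E) : Set E) → z = x ∨ z = thirdPoint y x := by
    intro hzc
    obtain ⟨F, hF, hsF⟩ := exists_relCell hadj hp (by
      rw [coe_pair (a := thirdPoint x y), Set.pair_subset_iff]
      exact ⟨hc.mem_convexHull, hzc⟩)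
    rw [relCells_pair hxy hpL] at hF
    have h1 : thirdPoint x y ∈ F := hsF (by simp)
    have h2 : z ∈ F := hsF (by simp)
    by_cases hy : y ∈ F
    · rw [pair_comm] at hF
      exact absurd h1 (pair_not_subset_edgeCell hxy.symm hF hy).2
    · rcases (mem_edgeCells_pair hxy).1 hF with rfl | rfl | rfl
      · simp only [mem_insert, mem_singleton] at h2
        exact h2.imp_right fun h => absurd h.symm hne
      · simp only [mem_insert, mem_singleton] at h2
        exact .inr (h2.resolve_left fun h => hne h.symm)
      · simp at hy
  obtain ⟨τ, hτ, hsτ⟩ := exists_face_of_mem_relSubdivision hadj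
  rw [coe_pair, Set.pair_subset_iff] at hsτ
  have hsub := hc.subset hτ hsτ.1
  by_cases h2 : τ.card ≤ 2
  · have := eq_of_subset_of_card_le hsub (by rwa [card_pair hxy])
    exact hmain (this ▸ hsτ.2)
  have h3 : τ.card = 3 := by have := hX τ hτ; omega
  have hτL : τ ∉ L.faces := fun hn => hpL (L.down_closed hn hsub (by simp))
  obtain ⟨e, t, het, h⟩ := hL.exists_relCells_eq h3 hτL
  have hv : ∀ w ∈ ({thirdPoint x y, z} : Finset E), w ∈ (relSubdivision hX hL).vertices :=
    fun w hw => down_closed hadj (singleton_subset_iff.2 hw) (singleton_nonempty _)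
  obtain ⟨i, hi, hri⟩ := exists_place_of_vertex hτ h (hv _ (mem_insert_self _ _)) hsτ.1
  obtain ⟨j, hj, hzj⟩ := exists_place_of_vertex hτ h
    (hv z (mem_insert_of_mem (mem_singleton_self _))) hsτ.2
  have hij := (adj_place_iff hτ het h hi hj).1 ⟨by rwa [← hri, ← hzj], by rwa [← hri, ← hzj]⟩
  have hbi := isBd_of_not_isTriangleInterior hτ het h3 hτL hi (by
    rw [← hri]
    rintro ⟨ρ, hρ, -, hρ3⟩
    have := card_le_card (hρ.subset hp hc.mem_convexHull)
    rw [hρ3, card_pair hxy] at this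
    omega)
  have hbj := isBd_of_not_isTriangleInterior hτ het h3 hτL hj (by rwa [← hzj])
  obtain ⟨k, hki, hkj⟩ := RingDisk.common_side t i hi hbi j hj hbj hij
  have he := het.affineIndependent hτ
  rw [← place_mem_side_iff he hi, ← hri, ← coe_pair] at hki
  rw [← place_mem_side_iff he hj, ← hzj, ← coe_pair] at hkj
  have hside : {e (k + 1), e (k + 2)} ∈ X.faces := X.down_closed hτ (by
    rw [insert_subset_iff, singleton_subset_iff, ← het.image]; simp) (by simp)
  have heq := eq_of_subset_of_card_le (hc.subset hside hki) (by
    rw [card_pair hxy]; exact card_le_two)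
  exact hmain (heq ▸ hkj)

/-- The three cases are the three possible dimensions of the carrier. -/
theorem vertex_trichotomy {v : E} (hv : v ∈ (relSubdivision hX hL).vertices) :
    v ∈ X.vertices ∨ (∃ x y, x ≠ y ∧ {x, y} ∈ X.faces ∧ {x, y} ∉ L.faces ∧ v = thirdPoint x y) ∨
      IsTriangleInterior X L v := by
  obtain ⟨τ, hτ, hvτ⟩ := exists_face_of_mem_relSubdivision hv
  obtain ⟨σ, hc⟩ := exists_isCarrier hτ (hvτ (mem_coe.2 (mem_singleton_self v)))
  have hσ := hc.mem_faces
  have hpos := (X.nonempty_of_mem_faces hσ).card_pos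
  by_cases h1 : σ.card = 1
  · obtain ⟨a, rfl⟩ := card_eq_one.1 h1
    have := hc.mem_convexHull
    rw [coe_singleton, convexHull_singleton, Set.mem_singleton_iff] at this
    exact .inl (this ▸ hσ)
  have hn : v ∉ σ := fun hvσ => by
    refine hc.notMem_of_ssubset {v} (ssubset_of_subset_of_ne (singleton_subset_iff.2 hvσ) ?_)
      (by simp)
    rintro rfl
    exact h1 (card_singleton v)
  obtain ⟨F, hF, hvF⟩ := exists_relCell hv hσ (by simpa using hc.mem_convexHull)
  have hvF := singleton_subset_iff.1 hvF
  have hσL : σ ∉ L.faces := fun h => by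
    rw [relCells_of_mem h, Set.mem_singleton_iff] at hF
    exact hn (hF ▸ hvF)
  by_cases h2 : σ.card = 2
  · right; left
    obtain ⟨x, y, hxy, rfl⟩ := card_eq_two.1 h2
    rw [relCells_pair hxy hσL] at hF
    have hnx : v ≠ x := fun h => hn (by simp [h])
    have hny : v ≠ y := fun h => hn (by simp [h])
    have : v = thirdPoint x y ∨ v = thirdPoint y x := by
      rcases (mem_edgeCells_pair hxy).1 hF with rfl | rfl | rfl <;>
        simp only [mem_insert, mem_singleton] at hvF <;> tauto
    rcases this with h | h
    · exact ⟨x, y, hxy, hσ, hσL, h⟩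
    · exact ⟨y, x, hxy.symm, by rwa [pair_comm], by rwa [pair_comm], h⟩
  · have h3 : σ.card = 3 := by have := hX σ hσ; omega
    exact .inr (.inr ⟨σ, hc, hσL, h3⟩)

end

theorem relSubdivision_isSubdivision (hX : ∀ s ∈ X.faces, s.card ≤ 3) (hL : L.IsFlag) :
    (relSubdivision hX hL).IsSubdivision X :=
  (relTriangulation hX hL).isSubdivision

theorem isFullSubcomplex_relSubdivision (hX : ∀ s ∈ X.faces, s.card ≤ 3) (hL : L.IsFlag)
    (hLX : L ≤ X) : L.IsFullSubcomplex (relSubdivision hX hL) := by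
  refine ⟨fun s hs => mem_relSubdivision_of_subset (L.nonempty_of_mem_faces hs) (hLX hs)
    (by rw [relCells_of_mem hs]; rfl) (Subset.refl s), fun s hs hv => ?_⟩
  refine isFlag_iff.1 hL s (nonempty_of_mem_faces hs) hv fun x hx y hy hxy => ?_
  refine pair_mem_of_vertices (hX := hX) (hL := hL) (hLX (hv x hx)) (hLX (hv y hy)) hxy ?_
  exact down_closed hs (insert_subset_iff.2 ⟨hx, singleton_subset_iff.2 hy⟩) (by simp)

/-- A clique with a triangle-interior vertex lies in one disk. A clique of at least two old vertices
is one in `L`. Otherwise it contains a third point, whose two possible neighbours are not adjacent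
to each other, so it has at most two elements. -/
theorem isFlag_relSubdivision (hX : ∀ s ∈ X.faces, s.card ≤ 3) (hL : L.IsFlag)
    (hLX : L ≤ X) : (relSubdivision hX hL).IsFlag := by
  rw [isFlag_iff]
  intro s hs hv hadj
  by_cases h1 : ∃ m ∈ s, IsTriangleInterior X L m
  · obtain ⟨m, hms, hm⟩ := h1
    obtain ⟨σ, e, t, i, hσ, het, h, hi, rfl, -, hstar⟩ := hm.exists_frame (hv m hms)
    have hpl : ∀ p ∈ s, ∃ j < RingDisk.card t, p = RingDisk.place e t j := by
      intro p hp
      by_cases hpm : RingDisk.place e t i = p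
      · exact ⟨i, hi, hpm.symm⟩
      · exact exists_place_of_vertex hσ h (hv p hp)
          (hstar _ (hadj _ hms p hp hpm) (by simp) (by simp))
    have hadj' : ∀ j < RingDisk.card t, ∀ k < RingDisk.card t, RingDisk.place e t j ∈ s →
        RingDisk.place e t k ∈ s → RingDisk.place e t j ≠ RingDisk.place e t k →
        RingDisk.Adj t j k := fun j hj k hk hjs hks hne =>
      (adj_place_iff (hX := hX) (hL := hL) hσ het h hj hk).1 ⟨hne, hadj _ hjs _ hks hne⟩
    by_cases h2 : ∃ p ∈ s, p ≠ RingDisk.place e t i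
    · obtain ⟨p, hps, hpi⟩ := h2
      obtain ⟨j, hj, rfl⟩ := hpl p hps
      by_cases h3 : ∃ q ∈ s, q ≠ RingDisk.place e t i ∧ q ≠ RingDisk.place e t j
      · obtain ⟨q, hqs, hqi, hqj⟩ := h3
        obtain ⟨k, hk, rfl⟩ := hpl q hqs
        have aij := hadj' i hi j hj hms hps hpi.symm
        have aik := hadj' i hi k hk hms hqs hqi.symm
        have ajk := hadj' j hj k hk hps hqs hqj.symm
        obtain ⟨f, hf, ⟨a, ha⟩, ⟨b, hb⟩, c, hc⟩ := RingDisk.tri_of_clique t i hi j hj aij k hk aik ajk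
        refine mem_relSubdivision_of_subset (F := RingDisk.cell e t f) hs hσ
          (h ▸ ⟨f, hf, rfl⟩) fun r hr => ?_
        obtain ⟨l, hl, rfl⟩ := hpl r hr
        rw [RingDisk.mem_cell]
        by_contra hn
        have hli : RingDisk.place e t i ≠ RingDisk.place e t l := fun hh => hn ⟨a, by rw [ha, hh]⟩
        have hlj : RingDisk.place e t j ≠ RingDisk.place e t l := fun hh => hn ⟨b, by rw [hb, hh]⟩
        have hlk : RingDisk.place e t k ≠ RingDisk.place e t l := fun hh => hn ⟨c, by rw [hc, hh]⟩
        exact RingDisk.no_four_clique t i hi j hj aij k hk aik ajk l hl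
          (hadj' i hi l hl hms hr hli) (hadj' j hj l hl hps hr hlj) (hadj' k hk l hl hqs hr hlk)
      · push Not at h3
        refine down_closed (hadj _ hms _ hps hpi.symm) (fun q hq => ?_) hs
        rw [mem_insert, mem_singleton]
        by_cases hqi : q = RingDisk.place e t i
        · exact .inl hqi
        · exact .inr (h3 q hq hqi)
    · push Not at h2
      refine down_closed (hv _ hms) (fun q hq => ?_) hs
      rw [mem_singleton, h2 q hq]
  push Not at h1
  by_cases h2 : ∀ v ∈ s, v ∈ X.vertices
  · by_cases h3 : ∃ x ∈ s, ∃ y ∈ s, x ≠ y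
    · refine (isFullSubcomplex_relSubdivision hX hL hLX).1 (isFlag_iff.1 hL s hs ?_ ?_)
      · intro v hvs
        obtain ⟨w, hw, hne⟩ : ∃ w ∈ s, v ≠ w := by
          obtain ⟨x, hx, y, hy, hxy⟩ := h3
          by_cases h : v = x
          · exact ⟨y, hy, h ▸ hxy⟩
          · exact ⟨x, hx, h⟩
        exact L.down_closed (pair_mem_of_vertices (h2 v hvs) (h2 w hw) hne (hadj v hvs w hw hne))
          (by simp) (singleton_nonempty _)
      · intro x hx y hy hxy
        exact pair_mem_of_vertices (h2 x hx) (h2 y hy) hxy (hadj x hx y hy hxy)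
    · push Not at h3
      obtain ⟨v, hvs⟩ := hs
      refine down_closed (hv v hvs) (fun w hw => ?_) ⟨v, hvs⟩
      rw [mem_singleton]
      exact h3 w hw v hvs
  · push Not at h2
    obtain ⟨r, hrs, hr⟩ := h2
    obtain ⟨x, y, hxy, hp, hpL, rfl⟩ := ((vertex_trichotomy (hv r hrs)).resolve_left hr).resolve_right
      (h1 r hrs)
    have hn : ∀ z ∈ s, thirdPoint x y ≠ z → z = x ∨ z = thirdPoint y x := fun z hz hne =>
      eq_of_adj_thirdPoint hxy hp hpL (h1 z hz) hne (hadj _ hrs z hz hne)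
    have hno : ¬ (x ∈ s ∧ thirdPoint y x ∈ s) := by
      rintro ⟨hxs, hys⟩
      have hp' : {y, x} ∈ X.faces := by rwa [pair_comm]
      have hpL' : {y, x} ∉ L.faces := by rwa [pair_comm]
      have hc := isCarrier_thirdPoint hxy.symm hp'
      have hne : thirdPoint y x ≠ x := by
        rw [← lineMap_two_thirds]
        intro h
        have := @lineMap_injective _ _ _ _ _ hxy (2 / 3) 0
          (h.trans (AffineMap.lineMap_apply_zero _ _).symm)
        norm_num at this
      rcases eq_of_adj_thirdPoint hxy.symm hp' hpL' (h1 x hxs) hne (hadj _ hys _ hxs hne) with h | h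
      · exact hxy h
      · have := @lineMap_injective _ _ _ _ _ hxy 0 (1 / 3)
          (by rw [lineMap_one_third, ← h]; exact AffineMap.lineMap_apply_zero _ _)
        norm_num at this
    by_cases h3 : ∃ z ∈ s, thirdPoint x y ≠ z
    · obtain ⟨z, hz, hne⟩ := h3
      refine down_closed (hadj _ hrs z hz hne) (fun w hw => ?_) hs
      rw [mem_insert, mem_singleton]
      by_cases hwr : w = thirdPoint x y
      · exact .inl hwr
      · right
        rcases hn z hz hne with rfl | rfl <;> rcases hn w hw (Ne.symm hwr) with rfl | rfl
        · rfl
        · exact (hno ⟨hz, hw⟩).elim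
        · exact (hno ⟨hw, hz⟩).elim
        · rfl
    · push Not at h3
      refine down_closed (hv _ hrs) (fun w hw => ?_) hs
      rw [mem_singleton, h3 w hw]

theorem isFlagNoSquare_relSubdivision (hX : ∀ s ∈ X.faces, s.card ≤ 3) (hL : L.IsFlagNoSquare)
    (hLX : L ≤ X) : (relSubdivision hX hL.1).IsFlagNoSquare := by
  refine ⟨isFlag_relSubdivision hX hL.1 hLX, not_square_iff.2 ?_⟩
  have hv : ∀ {x y : E}, {x, y} ∈ (relSubdivision hX hL.1).faces →
      x ∈ (relSubdivision hX hL.1).vertices := fun h =>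
    down_closed h (by simp) (singleton_nonempty _)
  have caseTI : ∀ a b c d : E, a ≠ b → d ≠ a → b ≠ d →
      {a, b} ∈ (relSubdivision hX hL.1).faces → {b, c} ∈ (relSubdivision hX hL.1).faces →
      {c, d} ∈ (relSubdivision hX hL.1).faces → {d, a} ∈ (relSubdivision hX hL.1).faces →
      b ≠ c → c ≠ d → a ≠ c → IsTriangleInterior X L a →
      {a, c} ∈ (relSubdivision hX hL.1).faces ∨ {b, d} ∈ (relSubdivision hX hL.1).faces := by
    intro a b c d hab hda hbd h1 h2 h3 h4 hbc hcd hac ha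
    obtain ⟨σ, e, t, i, hσ, het, h, hi, rfl, hib, hstar⟩ := ha.exists_frame (hv h1)
    obtain ⟨j, hj, rfl⟩ := exists_place_of_vertex hσ h (hv h2) (hstar _ h1 (by simp) (by simp))
    obtain ⟨l, hl, rfl⟩ := exists_place_of_vertex hσ h (hv h4) (hstar _ h4 (by simp) (by simp))
    have aij := (adj_place_iff hσ het h hi hj).1 ⟨hab, h1⟩
    have ail := (adj_place_iff hσ het h hi hl).1 ⟨hda.symm, by rwa [pair_comm]⟩
    by_cases hc : c ∈ convexHull ℝ (σ : Set E)
    · obtain ⟨k, hk, rfl⟩ := exists_place_of_vertex hσ h (hv h3) hc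
      have ajk := (adj_place_iff hσ het h hj hk).1 ⟨hbc, h2⟩
      have akl := (adj_place_iff hσ het h hk hl).1 ⟨hcd, h3⟩
      by_cases aik : RingDisk.Adj t i k
      · exact .inl ((adj_place_iff hσ het h hi hk).2 aik).2
      · have := RingDisk.no_square t i hi j hj aij k hk ajk (fun hh => hac (by rw [hh])) aik l hl ail
          akl (fun hh => hbd (by rw [hh]))
        exact .inr ((adj_place_iff hσ het h hj hl).2 this).2
    -- The cycle leaves the triangle at `c`, so `b` and `d`, being adjacent to `c`, are boundary
    -- vertices; as neighbours of the interior vertex `a` they are adjacent.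
    · right
      have h3σ : σ.card = 3 := by
        rw [← het.image, card_image_of_injective _ het.inj]; rfl
      have hσL : σ ∉ L.faces := by
        intro hs
        have : ∀ k, RingDisk.full t k = true := fun k => (het.side k).1 (L.down_closed hs (by
          rw [insert_subset_iff, singleton_subset_iff, ← het.image]; simp) (by simp))
        have hd : ∀ t, ¬ ∀ k, RingDisk.full t k = true := by decide
        exact hd t this
      have key : ∀ m < RingDisk.card t, {RingDisk.place e t m, c} ∈ (relSubdivision hX hL.1).faces →
          RingDisk.IsBd t m := by
        intro m hm hmc
        refine isBd_of_not_isTriangleInterior hσ het h3σ hσL hm fun hti => hc ?_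
        obtain ⟨τ, hτ, -, hτ3⟩ := hti
        have hτσ := eq_of_subset_of_card_le (hτ.subset hσ (place_mem_convexHull hσ het hm))
          (by rw [hτ3, h3σ])
        obtain ⟨ρ, hρ, hsρ⟩ := exists_face_of_mem_relSubdivision hmc
        have := eq_of_subset_of_card_le (hτ.subset hρ (hsρ (by simp))) (by rw [hτ3]; exact hX ρ hρ)
        rw [← hτσ, this]
        exact hsρ (by simp)
      have := RingDisk.adj_of_adj_interior t i hi hib j hj aij (key j hj h2) l hl ail
        (key l hl (by rwa [pair_comm])) (fun hh => hbd (by rw [hh]))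
      exact ((adj_place_iff hσ het h hj hl).2 this).2
  -- If `a` were a third point of `xy`, then `b` and `d` would be its two neighbours along the edge
  -- and `c` would be `y`; the cycle would close by the edge `xy`, which is not in `L`.
  have caseEdge : ∀ a b c d : E, a ≠ b → d ≠ a → b ≠ d →
      {a, b} ∈ (relSubdivision hX hL.1).faces → {b, c} ∈ (relSubdivision hX hL.1).faces →
      {c, d} ∈ (relSubdivision hX hL.1).faces → {d, a} ∈ (relSubdivision hX hL.1).faces →
      b ≠ c → c ≠ d → a ≠ c → ¬ IsTriangleInterior X L a →
      ¬ IsTriangleInterior X L b → ¬ IsTriangleInterior X L c → ¬ IsTriangleInterior X L d → a ∈ X.vertices := by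
    intro a b c d hab hda hbd h1 h2 h3 h4 hbc hcd hac hta hb hc hd
    by_contra ha
    rcases vertex_trichotomy (hv h1) with h | ⟨x, y, hxy, hp, hpL, rfl⟩ | h
    · exact ha h
    · have hp' : {y, x} ∈ X.faces := by rwa [pair_comm]
      have hpL' : {y, x} ∉ L.faces := by rwa [pair_comm]
      have hxX : x ∈ X.vertices := X.down_closed hp (by simp) (singleton_nonempty _)
      have hyX : y ∈ X.vertices := X.down_closed hp (by simp) (singleton_nonempty _)
      have h4' : {thirdPoint x y, d} ∈ (relSubdivision hX hL.1).faces := by rwa [pair_comm]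
      have h3' : {d, c} ∈ (relSubdivision hX hL.1).faces := by rwa [pair_comm]
      have h2' : {c, b} ∈ (relSubdivision hX hL.1).faces := by rwa [pair_comm]
      rcases eq_of_adj_thirdPoint hxy hp hpL hb hab h1 with rfl | rfl <;>
        rcases eq_of_adj_thirdPoint hxy hp hpL hd hda.symm h4' with rfl | rfl
      · exact hbd rfl
      · rcases eq_of_adj_thirdPoint hxy.symm hp' hpL' hc hcd.symm h3' with rfl | rfl
        · exact hpL (pair_mem_of_vertices hxX hyX hxy h2)
        · exact hac rfl
      · rcases eq_of_adj_thirdPoint hxy.symm hp' hpL' hc hbc h2 with rfl | rfl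
        · exact hpL' (pair_mem_of_vertices hyX hxX hxy.symm h3)
        · exact hac rfl
      · exact hbd rfl
    · exact hta h
  intro a b c d hab hbc hcd hda hac hbd h1 h2 h3 h4
  by_cases ta : IsTriangleInterior X L a
  · exact caseTI a b c d hab hda hbd h1 h2 h3 h4 hbc hcd hac ta
  by_cases tb : IsTriangleInterior X L b
  · have := caseTI b c d a hbc hab hac.symm h2 h3 h4 h1 hcd hda hbd tb
    rw [pair_comm c] at this
    exact this.symm
  by_cases tc : IsTriangleInterior X L c
  · have := caseTI c d a b hcd hbc hbd.symm h3 h4 h1 h2 hda hab hac.symm tc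
    rw [pair_comm c, pair_comm d] at this
    exact this
  by_cases td : IsTriangleInterior X L d
  · have := caseTI d a b c hda hcd hac h4 h1 h2 h3 hab hbc hbd.symm td
    rw [pair_comm d] at this
    exact this.symm
  have va := caseEdge a b c d hab hda hbd h1 h2 h3 h4 hbc hcd hac ta tb tc td
  have vb := caseEdge b c d a hbc hab hac.symm h2 h3 h4 h1 hcd hda hbd tb tc td ta
  have vc := caseEdge c d a b hcd hbc hbd.symm h3 h4 h1 h2 hda hab hac.symm tc td ta tb
  have vd := caseEdge d a b c hda hcd hac h4 h1 h2 h3 hab hbc hbd.symm td ta tb tc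
  have hfull := (isFullSubcomplex_relSubdivision hX hL.1 hLX).1
  exact (not_square_iff.1 hL.2 a b c d hab hbc hcd hda hac hbd (pair_mem_of_vertices va vb hab h1)
    (pair_mem_of_vertices vb vc hbc h2) (pair_mem_of_vertices vc vd hcd h3)
    (pair_mem_of_vertices vd va hda h4)).imp (fun h => hfull h) fun h => hfull h

end Geometry.SimplicialComplex

end

/-! ### The plane as a complete fan. -/

section

open Finset

namespace Fan

variable {n : ℕ} [NeZero n]

/-- `u` lies in one of the cones spanned by two consecutive basis vectors. -/
def IsFan (u : ZMod n → ℝ) : Prop :=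
  (∀ j, 0 ≤ u j) ∧ ∃ i, ∀ j, j ≠ i → j ≠ i + 1 → u j = 0

noncomputable def toPlane (u : ZMod n → ℝ) : ℂ := ∑ j, (u j : ℂ) * ZMod.stdAddChar j

/-- Write `ζ` for the character at 1. The `j`-th coordinate is a tent supported on the two cones at
the ray of `ζ ^ j`: the minimum of two linear forms vanishing on the neighbouring rays, cut off at
zero. The closed formula makes continuity of the inverse evident. -/
noncomputable def ofPlane (z : ℂ) (j : ZMod n) : ℝ :=
  max 0 (min (z * ZMod.stdAddChar (1 - j)).im (-(z * ZMod.stdAddChar (-1 - j)).im)) /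
    (ZMod.stdAddChar (1 : ZMod n)).im

theorem stdAddChar_natCast (k : ℕ) : (ZMod.stdAddChar (k : ZMod n) : ℂ) =
    Complex.exp ((2 * Real.pi * k / n : ℝ) * Complex.I) := by
  have := ZMod.stdAddChar_coe (N := n) (k : ℤ)
  rw [Int.cast_natCast] at this
  rw [this]
  congr 1
  push_cast
  ring

theorem im_stdAddChar_natCast (k : ℕ) : (ZMod.stdAddChar (k : ZMod n) : ℂ).im =
    Real.sin (2 * Real.pi * k / n) := by
  rw [stdAddChar_natCast, Complex.exp_ofReal_mul_I_im]

theorem im_stdAddChar_nonneg {k : ℕ} (hk : 2 * k ≤ n) :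
    0 ≤ (ZMod.stdAddChar (k : ZMod n) : ℂ).im := by
  have hn : (0 : ℝ) < n := by exact_mod_cast NeZero.pos n
  have hk' : (2 * k : ℝ) ≤ n := by exact_mod_cast hk
  rw [im_stdAddChar_natCast]
  refine Real.sin_nonneg_of_nonneg_of_le_pi (by positivity) ?_
  rw [div_le_iff₀ hn]
  nlinarith [Real.pi_pos]

theorem im_stdAddChar_neg (k : ZMod n) :
    (ZMod.stdAddChar (-k) : ℂ).im = - (ZMod.stdAddChar k : ℂ).im := by
  rw [AddChar.map_neg_eq_conj, Complex.conj_im]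

theorem im_stdAddChar_nonpos {k : ℕ} (hk : n ≤ 2 * k) (hkn : k ≤ n) :
    (ZMod.stdAddChar (k : ZMod n) : ℂ).im ≤ 0 := by
  have h : (k : ZMod n) = -((n - k : ℕ) : ZMod n) := by
    rw [Nat.cast_sub hkn]; simp
  rw [h, im_stdAddChar_neg, neg_nonpos]
  exact im_stdAddChar_nonneg (by omega)

theorem im_stdAddChar_one_pos (hn : 3 ≤ n) : 0 < (ZMod.stdAddChar (1 : ZMod n) : ℂ).im := by
  have h := im_stdAddChar_natCast (n := n) 1
  rw [Nat.cast_one] at h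
  rw [h]
  have hn' : (3 : ℝ) ≤ n := by exact_mod_cast hn
  refine Real.sin_pos_of_pos_of_lt_pi (by positivity) ?_
  rw [div_lt_iff₀ (by linarith)]
  push_cast
  nlinarith [Real.pi_pos]

theorem toPlane_eq {u : ZMod n → ℝ} {i : ZMod n} (hn : 2 ≤ n)
    (h : ∀ j, j ≠ i → j ≠ i + 1 → u j = 0) :
    toPlane u = u i * ZMod.stdAddChar i + u (i + 1) * ZMod.stdAddChar (i + 1) := by
  have : Fact (1 < n) := ⟨hn⟩
  have hne : i ≠ i + 1 := by simp
  unfold toPlane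
  rw [← sum_pair hne (f := fun j => (u j : ℂ) * ZMod.stdAddChar j)]
  refine (sum_subset (subset_univ _) fun j _ hj => ?_).symm
  rw [mem_insert, mem_singleton, not_or] at hj
  rw [h j hj.1 hj.2]
  simp

/-- For `4 ≤ n` the imaginary part of `ζ ^ 2` is nonnegative, which decides the minimum at the two
rays of the cone. At any other ray one of the two forms is nonpositive. -/
theorem ofPlane_toPlane (hn : 4 ≤ n) {u : ZMod n → ℝ} (hu : IsFan u) :
    ofPlane (toPlane u) = u := by
  obtain ⟨h0, i, hi⟩ := hu
  funext j
  have hpos := im_stdAddChar_one_pos (n := n) (by omega)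
  rw [ofPlane, div_eq_iff hpos.ne', toPlane_eq (by omega) hi]
  set a := u i with ha
  set b := u (i + 1) with hb
  have ha0 : 0 ≤ a := h0 i
  have hb0 : 0 ≤ b := h0 (i + 1)
  have him : ∀ m : ZMod n, ((a * ZMod.stdAddChar i + b * ZMod.stdAddChar (i + 1) : ℂ) *
      ZMod.stdAddChar m).im =
      a * (ZMod.stdAddChar (i + m) : ℂ).im + b * (ZMod.stdAddChar (i + m + 1) : ℂ).im := by
    intro m
    rw [add_mul, mul_assoc, mul_assoc, ← AddChar.map_add_eq_mul, ← AddChar.map_add_eq_mul,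
      Complex.add_im, Complex.im_ofReal_mul, Complex.im_ofReal_mul, add_right_comm]
  rw [him, him]
  obtain ⟨k, hk, hjk⟩ : ∃ k : ℕ, k < n ∧ j = i + k :=
    ⟨(j - i).val, ZMod.val_lt _, by simp⟩
  have s2 : 0 ≤ (ZMod.stdAddChar (2 : ZMod n) : ℂ).im := by
    have := im_stdAddChar_nonneg (n := n) (k := 2) (by omega)
    exact_mod_cast this
  have z0 : (ZMod.stdAddChar (0 : ZMod n) : ℂ).im = 0 := by simp
  have e1 : i + (1 - j) = 1 - k := by rw [hjk]; ring
  have e2 : i + (1 - j) + 1 = 2 - k := by rw [hjk]; ring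
  have e3 : i + (-1 - j) = -(k + 1) := by rw [hjk]; ring
  have e4 : i + (-1 - j) + 1 = -k := by rw [hjk]; ring
  rw [e2, e1, e4, e3, im_stdAddChar_neg, im_stdAddChar_neg]
  rcases Nat.lt_or_ge k 2 with hk2 | hk2
  · interval_cases k
    · have : j = i := by simp [hjk]
      rw [this, ← ha]
      simp only [Nat.cast_zero, sub_zero, zero_add, z0]
      rw [min_eq_right (by nlinarith), max_eq_right (by nlinarith)]
      ring
    · have : j = i + 1 := by simp [hjk]
      rw [this, ← hb]
      have e5 : (2 - (1 : ZMod n)) = 1 := by ring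
      have e6 : ((1 : ZMod n) + 1) = 2 := by ring
      simp only [Nat.cast_one, sub_self, z0, e5, e6]
      rw [min_eq_left (by nlinarith), max_eq_right (by nlinarith)]
      ring
  · have hz : u j = 0 := by
      refine hi j (fun h => ?_) fun h => ?_
      · have h' : (k : ZMod n) = (0 : ℕ) := by simpa [hjk] using h
        rw [ZMod.natCast_eq_natCast_iff', Nat.mod_eq_of_lt hk, Nat.mod_eq_of_lt (by omega)] at h'
        omega
      · have h' : (k : ZMod n) = (1 : ℕ) := by simpa [hjk] using h
        rw [ZMod.natCast_eq_natCast_iff', Nat.mod_eq_of_lt hk, Nat.mod_eq_of_lt (by omega)] at h'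
        omega
    rw [hz, zero_mul]
    refine max_eq_left ?_
    -- The ray `j` is `k` steps ahead of the ray `i`; depending on which half turn it falls in, the
    -- first or the second form is nonpositive.
    rcases le_total (2 * (k - 1)) n with h | h
    · refine (min_le_left _ _).trans ?_
      have e5 : (1 - (k : ZMod n)) = -((k - 1 : ℕ) : ZMod n) := by
        rw [Nat.cast_sub (by omega)]; push_cast; ring
      have e6 : (2 - (k : ZMod n)) = -((k - 2 : ℕ) : ZMod n) := by
        rw [Nat.cast_sub (by omega)]; push_cast; ring
      rw [e5, e6, im_stdAddChar_neg, im_stdAddChar_neg]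
      have := im_stdAddChar_nonneg (n := n) (k := k - 1) h
      have := im_stdAddChar_nonneg (n := n) (k := k - 2) (by omega)
      nlinarith
    · refine (min_le_right _ _).trans ?_
      have := im_stdAddChar_nonpos (n := n) (k := k) (by omega) (by omega)
      have h5 := im_stdAddChar_nonpos (n := n) (k := k + 1) (by omega) (by omega)
      rw [Nat.cast_succ] at h5
      nlinarith

theorem exists_isFan_toPlane_eq (hn : 3 ≤ n) (z : ℂ) : ∃ u : ZMod n → ℝ, IsFan u ∧ toPlane u = z := by
  have hn0 : (0 : ℝ) < n := by exact_mod_cast NeZero.pos n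
  have : Fact (1 < n) := ⟨by omega⟩
  set α : ℝ := 2 * Real.pi / n with hα
  have hα0 : 0 < α := by positivity
  have hs : 0 < Real.sin α := by
    have h := im_stdAddChar_one_pos hn
    have h1 := im_stdAddChar_natCast (n := n) 1
    rw [Nat.cast_one] at h1
    rw [h1] at h
    simpa [hα] using h
  have hαπ : α < Real.pi := by
    rw [hα, div_lt_iff₀ hn0]
    have hn' : (3 : ℝ) ≤ n := by exact_mod_cast hn
    nlinarith [Real.pi_pos]
  -- The cone is found by dividing the argument by the angle `α`; the coordinates `a` and `b` below
  -- come from the law of sines with the remaining angle `ψ`.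
  set m : ℤ := ⌊z.arg / α⌋ with hm
  set ψ : ℝ := z.arg - m * α with hψ
  have h1 : 0 ≤ ψ := by
    have := Int.floor_le (z.arg / α)
    rw [le_div_iff₀ hα0] at this
    linarith
  have h2 : ψ < α := by
    have := Int.lt_floor_add_one (z.arg / α)
    rw [div_lt_iff₀ hα0] at this
    linarith
  set a : ℝ := ‖z‖ * Real.sin (α - ψ) / Real.sin α with ha
  set b : ℝ := ‖z‖ * Real.sin ψ / Real.sin α with hb
  have ha0 : 0 ≤ a := by
    have := Real.sin_nonneg_of_nonneg_of_le_pi (x := α - ψ) (by linarith) (by linarith)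
    positivity
  have hb0 : 0 ≤ b := by
    have := Real.sin_nonneg_of_nonneg_of_le_pi h1 (by linarith)
    positivity
  have hne : (m : ZMod n) + 1 ≠ m := by simp
  let u : ZMod n → ℝ := fun j => if j = m then a else if j = m + 1 then b else 0
  have hui : ∀ j : ZMod n, j ≠ m → j ≠ m + 1 → u j = 0 := fun j h h' => by simp [u, h, h']
  refine ⟨u, ⟨fun j => ?_, m, hui⟩, ?_⟩
  · simp only [u]; split_ifs <;> first | assumption | exact le_rfl
  · rw [toPlane_eq (by omega) hui]
    have hua : u m = a := by simp [u]
    have hub : u (m + 1) = b := by simp [u]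
    have c1 : (ZMod.stdAddChar (m : ZMod n) : ℂ) = Complex.exp ((m * α : ℝ) * Complex.I) := by
      rw [ZMod.stdAddChar_coe, hα]
      congr 1
      push_cast
      ring
    have c2 : (ZMod.stdAddChar (1 : ZMod n) : ℂ) = Complex.exp (α * Complex.I) := by
      have := stdAddChar_natCast (n := n) 1
      rw [Nat.cast_one] at this
      rw [this, hα]
      simp
    rw [hua, hub, AddChar.map_add_eq_mul, c1, c2]
    have key : (a : ℂ) + b * Complex.exp (α * Complex.I) = ‖z‖ * Complex.exp (ψ * Complex.I) := by
      apply Complex.ext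
      · simp only [Complex.add_re, Complex.ofReal_re, Complex.re_ofReal_mul,
          Complex.exp_ofReal_mul_I_re]
        rw [ha, hb, Real.sin_sub]
        field_simp
        ring
      · simp only [Complex.add_im, Complex.ofReal_im, Complex.im_ofReal_mul,
          Complex.exp_ofReal_mul_I_im]
        rw [hb]
        field_simp
        ring
    calc _ = Complex.exp ((m * α : ℝ) * Complex.I) * (a + b * Complex.exp (α * Complex.I)) := by ring
      _ = ‖z‖ * Complex.exp (z.arg * Complex.I) := by
        rw [key, mul_left_comm, ← Complex.exp_add, hψ]
        congr 2
        push_cast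
        ring
      _ = z := Complex.norm_mul_exp_arg_mul_I z

theorem isFan_ofPlane (hn : 4 ≤ n) (z : ℂ) : IsFan (ofPlane z : ZMod n → ℝ) := by
  obtain ⟨u, hu, rfl⟩ := exists_isFan_toPlane_eq (n := n) (by omega) z
  rwa [ofPlane_toPlane hn hu]

theorem toPlane_ofPlane (hn : 4 ≤ n) (z : ℂ) : toPlane (ofPlane z : ZMod n → ℝ) = z := by
  obtain ⟨u, hu, rfl⟩ := exists_isFan_toPlane_eq (n := n) (by omega) z
  rw [ofPlane_toPlane hn hu]

theorem continuous_ofPlane (j : ZMod n) : Continuous fun z => ofPlane z j := by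
  unfold ofPlane
  fun_prop

end Fan

end

/-! ### Surfaces from oriented triangulations. -/

section

open Geometry Finset
open scoped Classical

/-- A closed connected oriented surface triangulated with vertex set `Fin N`: `O x y z` says that
`x → y → z → x` is a positively oriented triangle, and `link` that links are cycles. -/
structure OrientedTriangulation (N : ℕ) where
  O : Fin N → Fin N → Fin N → Prop
  cyc : ∀ {x y z}, O x y z → O y z x
  ne : ∀ {x y z}, O x y z → x ≠ y
  link : ∀ v, ∃ (n : ℕ) (l : ℕ → Fin N), 4 ≤ n ∧ Function.Periodic l n ∧ Set.InjOn l (Set.Iio n) ∧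
    ∀ x y, O v x y ↔ ∃ k, x = l k ∧ y = l (k + 1)
  reachable : ∀ v w, Relation.ReflTransGen (fun x y => ∃ z, O x y z) v w
  pos : 0 < N

namespace OrientedTriangulation

variable {N : ℕ}

/-- Vertices are the standard basis vectors, so the complex lies in the standard simplex:
coordinates are barycentric, and cells automatically meet in common faces. -/
noncomputable def pt (i : Fin N) : EuclideanSpace ℝ (Fin N) := EuclideanSpace.single i 1

theorem pt_apply (i j : Fin N) : pt i j = if j = i then (1 : ℝ) else 0 := by
  simp [pt]

theorem pt_injective : Function.Injective (pt (N := N)) := fun i j h => by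
  have := congrArg (fun x : EuclideanSpace ℝ (Fin N) => x i) h
  simp only [pt_apply, if_true] at this
  by_contra hn
  simp [hn] at this

theorem affineIndependent_pt : AffineIndependent ℝ (pt (N := N)) := by
  have h := (EuclideanSpace.basisFun (Fin N) ℝ).toBasis.linearIndependent.affineIndependent
  have e : ⇑(EuclideanSpace.basisFun (Fin N) ℝ).toBasis = pt := by
    funext i; simp [pt]
  rwa [e] at h

theorem linearCombination_pt (x : EuclideanSpace ℝ (Fin N)) :
    Fintype.linearCombination ℝ pt (fun i => x i) = x := by
  ext j
  simp [Fintype.linearCombination_apply, pt_apply]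

theorem mem_convexHull_pt_iff {K : Finset (Fin N)} {x : EuclideanSpace ℝ (Fin N)} :
    x ∈ convexHull ℝ (K.image pt : Set (EuclideanSpace ℝ (Fin N))) ↔
      (∀ i, 0 ≤ x i) ∧ ∑ i, x i = 1 ∧ ∀ i ∉ K, x i = 0 := by
  constructor
  · intro h
    obtain ⟨w, h0, h1, h2, rfl⟩ := exists_of_mem_convexHull_image h
    have : ∀ j, Fintype.linearCombination ℝ pt w j = w j := fun j => by
      simp [Fintype.linearCombination_apply, pt_apply]
    simp only [this]
    exact ⟨h0, h1, h2⟩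
  · rintro ⟨h0, h1, h2⟩
    rw [← linearCombination_pt x]
    exact linearCombination_mem_convexHull_image h0 h1 h2

variable (S : OrientedTriangulation N)

noncomputable def complex : SimplicialComplex ℝ (EuclideanSpace ℝ (Fin N)) where
  faces := {s | s.Nonempty ∧ ∃ x y z, S.O x y z ∧ s ⊆ ({x, y, z} : Finset (Fin N)).image pt}
  indep := by
    rintro s ⟨-, x, y, z, -, hs⟩
    refine affineIndependent_pt.range.mono fun p hp => ?_
    obtain ⟨i, -, rfl⟩ := mem_image.1 (hs hp)
    exact ⟨i, rfl⟩
  isRelLowerSet_faces := by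
    rintro s ⟨hs, x, y, z, h, hsT⟩
    exact ⟨hs, fun t hts ht => ⟨ht, x, y, z, h, hts.trans hsT⟩⟩
  inter_subset_convexHull := by
    rintro s t ⟨-, x, y, z, -, hs⟩ ⟨-, x', y', z', -, ht⟩
    have hu : AffineIndependent ℝ ((↑) : ↥(univ.image pt :
        Finset (EuclideanSpace ℝ (Fin N))) → EuclideanSpace ℝ (Fin N)) := by
      refine affineIndependent_pt.range.mono fun p hp => ?_
      obtain ⟨i, -, rfl⟩ := mem_image.1 hp
      exact ⟨i, rfl⟩
    exact convexHull_inter_of_subset_simplex hu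
      (coe_subset.2 (hs.trans (image_subset_image (subset_univ _))))
      (coe_subset.2 (ht.trans (image_subset_image (subset_univ _))))

theorem triangle_mem_faces {x y z : Fin N} (h : S.O x y z) :
    ({x, y, z} : Finset (Fin N)).image pt ∈ S.complex.faces :=
  ⟨by simp, x, y, z, h, Subset.refl _⟩

theorem finite_faces : S.complex.faces.Finite := by
  refine ((univ.image pt).powerset.finite_toSet).subset ?_
  rintro s ⟨-, x, y, z, -, hs⟩
  rw [mem_coe, mem_powerset]
  exact hs.trans (image_subset_image (subset_univ _))

theorem card_le_three_of_mem_faces {s : Finset (EuclideanSpace ℝ (Fin N))}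
    (hs : s ∈ S.complex.faces) : s.card ≤ 3 := by
  obtain ⟨-, x, y, z, -, h⟩ := hs
  exact (card_le_card h).trans (card_image_le.trans card_le_three)

theorem mem_space_iff {p : EuclideanSpace ℝ (Fin N)} : p ∈ S.complex.space ↔
    ∃ x y z, S.O x y z ∧ (∀ i, 0 ≤ p i) ∧ ∑ i, p i = 1 ∧
      ∀ i ∉ ({x, y, z} : Finset (Fin N)), p i = 0 := by
  rw [SimplicialComplex.mem_space_iff]
  constructor
  · rintro ⟨s, ⟨-, x, y, z, h, hs⟩, hp⟩
    exact ⟨x, y, z, h, mem_convexHull_pt_iff.1 (convexHull_mono (coe_subset.2 hs) hp)⟩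
  · rintro ⟨x, y, z, h, hp⟩
    exact ⟨_, S.triangle_mem_faces h, mem_convexHull_pt_iff.2 hp⟩

theorem exists_link_triangle {p : EuclideanSpace ℝ (Fin N)} (hp : p ∈ S.complex.space) {v : Fin N}
    (hv : p v ≠ 0) : ∃ x y, S.O v x y ∧ ∀ i ∉ ({v, x, y} : Finset (Fin N)), p i = 0 := by
  obtain ⟨x, y, z, h, -, -, hs⟩ := S.mem_space_iff.1 hp
  have hvm : v ∈ ({x, y, z} : Finset (Fin N)) := by
    by_contra hn
    exact hv (hs v hn)
  simp only [mem_insert, mem_singleton] at hvm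
  rcases hvm with rfl | rfl | rfl
  · exact ⟨y, z, h, hs⟩
  · refine ⟨z, x, S.cyc h, fun i hi => hs i ?_⟩
    simp only [mem_insert, mem_singleton] at hi ⊢; tauto
  · refine ⟨x, y, S.cyc (S.cyc h), fun i hi => hs i ?_⟩
    simp only [mem_insert, mem_singleton] at hi ⊢; tauto

section Chart

variable {n : ℕ} [NeZero n] (v : Fin N) (l : ZMod n → Fin N)

/-- Dividing by the coordinate at `v` spreads the open star over the whole fan, with the outer
boundary of the star sent to infinity; `starPoint` is the inverse normalisation. -/
noncomputable def starCoord (p : EuclideanSpace ℝ (Fin N)) (j : ZMod n) : ℝ := p (l j) / p v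

noncomputable def starPoint (u : ZMod n → ℝ) : EuclideanSpace ℝ (Fin N) :=
  (1 + ∑ j, u j)⁻¹ • (pt v + ∑ j, u j • pt (l j))

variable {v l}

theorem starPoint_apply_center (hv : ∀ j, l j ≠ v) (u : ZMod n → ℝ) :
    starPoint v l u v = (1 + ∑ j, u j)⁻¹ := by
  simp [starPoint, pt_apply, fun j => (hv j).symm]

theorem starPoint_apply_link (hl : Function.Injective l) (hv : ∀ j, l j ≠ v) (u : ZMod n → ℝ)
    (i : ZMod n) : starPoint v l u (l i) = (1 + ∑ j, u j)⁻¹ * u i := by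
  simp [starPoint, pt_apply, hv, hl.eq_iff]

theorem starPoint_apply_of_ne {u : ZMod n → ℝ} {w : Fin N} (hw : w ≠ v)
    (h : ∀ j, w = l j → u j = 0) : starPoint v l u w = 0 := by
  have : ∑ j, u j * (if w = l j then (1 : ℝ) else 0) = 0 :=
    sum_eq_zero fun j _ => by by_cases hj : w = l j <;> simp [hj, h]
  simp [starPoint, pt_apply, hw] at this ⊢
  exact .inr this

theorem sum_eq_center_add_link (hl : Function.Injective l) (hv : ∀ j, l j ≠ v)
    {p : EuclideanSpace ℝ (Fin N)} (hp : ∀ w, w ≠ v → (∀ j, w ≠ l j) → p w = 0) :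
    ∑ w, p w = p v + ∑ j, p (l j) := by
  have h1 : v ∉ univ.image l := by simpa using hv
  rw [← sum_image (f := fun w => p w) (g := l) (s := univ) fun i _ j _ h => hl h, ← sum_insert h1]
  refine (sum_subset (subset_univ _) fun w _ hw => hp w ?_ ?_).symm
  · rintro rfl; simp at hw
  · rintro j rfl; simp at hw

/-- The open star of a vertex whose link is the cycle `l` is homeomorphic to the plane. -/
theorem nonempty_star_homeomorph (hn : 4 ≤ n) (hl : Function.Injective l) (hv : ∀ j, l j ≠ v)
    (hO : ∀ x y, S.O v x y ↔ ∃ j, x = l j ∧ y = l (j + 1)) :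
    Nonempty ({p : S.complex.space | 0 < p.1 v} ≃ₜ ℂ) := by
  have hnn : ∀ p : S.complex.space, (∀ i, 0 ≤ p.1 i) ∧ ∑ i, p.1 i = 1 := fun p => by
    obtain ⟨x, y, z, -, h0, h1, -⟩ := S.mem_space_iff.1 p.2
    exact ⟨h0, h1⟩
  have hsupp : ∀ p : S.complex.space, 0 < p.1 v → ∃ i : ZMod n, ∀ w, w ≠ v → w ≠ l i →
      w ≠ l (i + 1) → p.1 w = 0 := fun p hp => by
    obtain ⟨x, y, h, hs⟩ := S.exists_link_triangle p.2 hp.ne'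
    obtain ⟨i, rfl, rfl⟩ := (hO x y).1 h
    exact ⟨i, fun w h1 h2 h3 => hs w (by simp [h1, h2, h3])⟩
  have hfan : ∀ p : S.complex.space, 0 < p.1 v → Fan.IsFan (starCoord v l p.1) := fun p hp => by
    obtain ⟨i, hi⟩ := hsupp p hp
    refine ⟨fun j => div_nonneg ((hnn p).1 _) hp.le, i, fun j h1 h2 => ?_⟩
    rw [starCoord, hi (l j) (hv j) (fun h => h1 (hl h)) (fun h => h2 (hl h)), zero_div]
  have hsum : ∀ u : ZMod n → ℝ, Fan.IsFan u → 0 < 1 + ∑ j, u j := fun u hu => by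
    have := sum_nonneg fun j (_ : j ∈ univ) => hu.1 j
    linarith
  have hmem : ∀ u : ZMod n → ℝ, Fan.IsFan u → starPoint v l u ∈ S.complex.space := fun u hu => by
    have hpos := hsum u hu
    obtain ⟨h0, i, hi⟩ := hu
    have hz : ∀ w ∉ ({v, l i, l (i + 1)} : Finset (Fin N)), starPoint v l u w = 0 := by
      intro w hw
      simp only [mem_insert, mem_singleton, not_or] at hw
      refine starPoint_apply_of_ne hw.1 fun j hj => hi j ?_ ?_
      · rintro rfl; exact hw.2.1 hj
      · rintro rfl; exact hw.2.2 hj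
    rw [mem_space_iff]
    refine ⟨v, l i, l (i + 1), (hO _ _).2 ⟨i, rfl, rfl⟩, fun w => ?_, ?_, hz⟩
    · by_cases hwv : w = v
      · rw [hwv, starPoint_apply_center hv]; positivity
      by_cases hwl : ∃ j, w = l j
      · obtain ⟨j, rfl⟩ := hwl
        rw [starPoint_apply_link hl hv]
        have := h0 j
        positivity
      · push Not at hwl
        rw [starPoint_apply_of_ne hwv fun j hj => (hwl j hj).elim]
    · rw [sum_eq_center_add_link hl hv fun w hw hwl =>
        starPoint_apply_of_ne hw fun j hj => (hwl j hj).elim]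
      simp only [starPoint_apply_center hv, starPoint_apply_link hl hv, ← mul_sum]
      field_simp
  refine ⟨{
    toFun := fun p => Fan.toPlane (starCoord v l p.1.1)
    invFun := fun z => ⟨⟨starPoint v l (Fan.ofPlane z), hmem _ (Fan.isFan_ofPlane hn z)⟩, by
      change 0 < starPoint v l (Fan.ofPlane z) v
      rw [starPoint_apply_center hv]
      exact inv_pos.2 (hsum _ (Fan.isFan_ofPlane hn z))⟩
    left_inv := ?_
    right_inv := ?_
    continuous_toFun := ?_
    continuous_invFun := ?_ }⟩
  · rintro ⟨p, hp⟩
    have hp : 0 < p.1 v := hp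
    refine Subtype.ext (Subtype.ext ?_)
    change starPoint v l (Fan.ofPlane (Fan.toPlane (starCoord v l p.1))) = p.1
    rw [Fan.ofPlane_toPlane hn (hfan p hp)]
    obtain ⟨i, hi⟩ := hsupp p hp
    have hz : ∀ w, w ≠ v → (∀ j, w ≠ l j) → p.1 w = 0 := fun w h1 h2 => hi w h1 (h2 _) (h2 _)
    have h1 := (hnn p).2
    rw [sum_eq_center_add_link hl hv hz] at h1
    have hinv : (1 + ∑ j, starCoord v l p.1 j)⁻¹ = p.1 v := by
      unfold starCoord
      rw [← sum_div, inv_eq_iff_eq_inv, eq_comm, inv_eq_one_div, ← h1]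
      field_simp
      rw [h1, mul_one, h1]
    ext w
    by_cases hwv : w = v
    · rw [hwv, starPoint_apply_center hv, hinv]
    by_cases hwl : ∃ j, w = l j
    · obtain ⟨j, rfl⟩ := hwl
      rw [starPoint_apply_link hl hv, hinv, starCoord]
      field_simp
    · push Not at hwl
      rw [starPoint_apply_of_ne hwv fun j hj => (hwl j hj).elim, hz w hwv hwl]
  · intro z
    change Fan.toPlane (starCoord v l (starPoint v l (Fan.ofPlane z))) = z
    have : starCoord v l (starPoint v l (Fan.ofPlane z : ZMod n → ℝ)) = Fan.ofPlane z := by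
      funext j
      have := hsum _ (Fan.isFan_ofPlane (n := n) hn z)
      rw [starCoord, starPoint_apply_center hv, starPoint_apply_link hl hv]
      field_simp
    rw [this, Fan.toPlane_ofPlane hn]
  · unfold Fan.toPlane starCoord
    refine continuous_finsetSum _ fun j _ => Continuous.mul ?_ continuous_const
    refine Complex.continuous_ofReal.comp (Continuous.div ?_ ?_ fun p => (ne_of_gt p.2))
    · fun_prop
    · fun_prop
  · refine Continuous.subtype_mk (Continuous.subtype_mk ?_ _) _
    unfold starPoint
    have hc : ∀ j : ZMod n, Continuous fun z => Fan.ofPlane z j := Fan.continuous_ofPlane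
    refine Continuous.smul (Continuous.inv₀ (by fun_prop) fun z =>
      (hsum _ (Fan.isFan_ofPlane hn z)).ne') (by fun_prop)

end Chart

/-- Coordinates sum to 1, so the open stars of the vertices cover the space, and each is a plane.
Connectedness follows along chains of edges. -/
theorem isClosedSurface : IsClosedSurface S.complex.space where
  t2 := inferInstance
  compact := by
    rw [← isCompact_iff_compactSpace]
    exact S.finite_faces.isCompact_biUnion fun s _ => s.finite_toSet.isCompact_convexHull (𝕜 := ℝ)
  connected := by
    rw [← isConnected_iff_connectedSpace]
    have hT : ∀ {x y z}, S.O x y z → ∀ p ∈ convexHull ℝ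
        ((({x, y, z} : Finset (Fin N)).image pt : Finset _) : Set (EuclideanSpace ℝ (Fin N))),
        ∀ q ∈ convexHull ℝ ((({x, y, z} : Finset (Fin N)).image pt : Finset _) : Set _),
        JoinedIn S.complex.space p q := fun h p hp q hq =>
      (((convex_convexHull ℝ _).isPathConnected ⟨p, hp⟩).joinedIn p hp q hq).mono
        (S.complex.convexHull_subset_space (S.triangle_mem_faces h))
    have hpt : ∀ {K : Finset (Fin N)} {i : Fin N}, i ∈ K → pt i ∈ convexHull ℝ
        ((K.image pt : Finset _) : Set (EuclideanSpace ℝ (Fin N))) := fun hi =>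
      subset_convexHull ℝ _ (mem_coe.2 (mem_image_of_mem pt hi))
    have hv : ∀ v w, v = w ∨ JoinedIn S.complex.space (pt v) (pt w) := fun v w => by
      induction S.reachable v w with
      | refl => exact .inl rfl
      | tail _ h ih =>
        obtain ⟨z, h⟩ := h
        have h1 := hT h _ (hpt (mem_insert_self _ _)) _
          (hpt (mem_insert_of_mem (mem_insert_self _ _)))
        rcases ih with rfl | ih
        · exact .inr h1
        · exact .inr (ih.trans h1)
    obtain ⟨n, l, -, -, -, hO⟩ := S.link ⟨0, S.pos⟩
    have h0 := (hO _ _).2 ⟨0, rfl, rfl⟩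
    refine IsPathConnected.isConnected ⟨pt ⟨0, S.pos⟩, S.complex.convexHull_subset_space
      (S.triangle_mem_faces h0) (hpt (mem_insert_self _ _)), fun {p} hp => ?_⟩
    obtain ⟨x, y, z, h, hp⟩ := S.mem_space_iff.1 hp
    have h1 := hT h _ (hpt (mem_insert_self _ _)) p (mem_convexHull_pt_iff.2 hp)
    rcases hv ⟨0, S.pos⟩ x with rfl | h2
    · exact h1
    · exact h2.trans h1
  locallyEuclidean := by
    intro p
    obtain ⟨x, y, z, -, h0, h1, -⟩ := S.mem_space_iff.1 p.2
    obtain ⟨v, -, hv⟩ : ∃ v ∈ univ, p.1 v ≠ 0 := exists_ne_zero_of_sum_ne_zero (by rw [h1]; simp)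
    obtain ⟨n, l, hn, hper, hinj, hO⟩ := S.link v
    have : NeZero n := ⟨by omega⟩
    have hval : ∀ k : ℕ, l (k : ZMod n).val = l k := fun k => by
      rw [ZMod.val_natCast, hper.map_mod_nat]
    obtain ⟨e⟩ := S.nonempty_star_homeomorph (v := v) (l := fun j : ZMod n => l j.val) hn
      (fun i j h => ZMod.val_injective n (hinj (ZMod.val_lt i) (ZMod.val_lt j) h))
      (fun j => (S.ne ((hO _ _).2 ⟨j.val, rfl, rfl⟩)).symm) (fun x y => by
        rw [hO]
        constructor
        · rintro ⟨k, rfl, rfl⟩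
          refine ⟨k, (hval k).symm, ?_⟩
          have := hval (k + 1)
          rw [Nat.cast_succ] at this
          exact this.symm
        · rintro ⟨j, rfl, rfl⟩
          refine ⟨j.val, rfl, ?_⟩
          have := hval (j.val + 1)
          rwa [Nat.cast_succ, ZMod.natCast_zmod_val] at this)
    exact ⟨{q | 0 < q.1 v}, isOpen_lt continuous_const (by fun_prop), (h0 v).lt_of_ne' hv,
      ⟨e.trans Complex.orthonormalBasisOneI.repr.toHomeomorph⟩⟩

end OrientedTriangulation

end

/-! ### Orientability of subdivisions. -/

section

open Geometry Finset
open scoped Classical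

namespace Geometry.SimplicialComplex

variable {E : Type*} [AddCommGroup E] [Module ℝ E] {K : SimplicialComplex ℝ E}

theorem IsTriangle.mem_faces {a b c : E} (h : K.IsTriangle a b c) :
    ({a, b, c} : Finset E) ∈ K.faces := by
  obtain ⟨-, -, -, s, hs, e⟩ := h
  have : s = {a, b, c} := by
    rw [← coe_inj, e]; simp
  rwa [← this]

theorem IsTriangle.eq_zero {a b c : E} (h : K.IsTriangle a b c) {α β γ : ℝ} (h0 : α + β + γ = 0)
    (hs : α • a + β • b + γ • c = 0) : α = 0 ∧ β = 0 ∧ γ = 0 := by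
  have hi := K.indep h.mem_faces
  obtain ⟨hab, hbc, hac, -⟩ := h
  have hna : a ∉ ({b, c} : Finset E) := by simp [hab, hac]
  have hnb : b ∉ ({c} : Finset E) := by simp [hbc]
  let w : E → ℝ := fun p => if p = a then α else if p = b then β else γ
  have wa : w a = α := by simp [w]
  have wb : w b = β := by simp [w, hab.symm]
  have wc : w c = γ := by simp [w, hac.symm, hbc.symm]
  have key := affineIndependent_iff.1 hi univ (fun i => w i)
    (by
      refine (Finset.sum_coe_sort ({a, b, c} : Finset E) w).trans ?_
      rw [sum_insert hna, sum_insert hnb, sum_singleton, wa, wb, wc, ← add_assoc, h0])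
    (by
      refine (Finset.sum_coe_sort ({a, b, c} : Finset E) fun p => w p • p).trans ?_
      rw [sum_insert hna, sum_insert hnb, sum_singleton, wa, wb, wc, ← add_assoc, hs])
  exact ⟨wa ▸ key ⟨a, by simp⟩ (mem_univ _), wb ▸ key ⟨b, by simp⟩ (mem_univ _),
    wc ▸ key ⟨c, by simp⟩ (mem_univ _)⟩

theorem IsTriangle.swap {a b c : E} (h : K.IsTriangle a b c) : K.IsTriangle b a c :=
  ⟨h.1.symm, h.2.2.1, h.2.1, by
    obtain ⟨s, hs, e⟩ := h.2.2.2
    exact ⟨s, hs, by rw [e, Set.insert_comm]⟩⟩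

theorem IsTriangle.rotate {a b c : E} (h : K.IsTriangle a b c) : K.IsTriangle b c a :=
  ⟨h.2.1, h.2.2.1.symm, h.1.symm, by
    obtain ⟨s, hs, e⟩ := h.2.2.2
    exact ⟨s, hs, by rw [e]; ext; simp; tauto⟩⟩

/-- Two distinct triangles with a common edge lie on opposite sides of it. -/
theorem IsTriangle.nonpos_of_adjacent {a b c d : E} (htc : K.IsTriangle a b c)
    (htd : K.IsTriangle a b d) (hcd : c ≠ d) {α β γ : ℝ} (hsum : α + β + γ = 1)
    (hd : d = α • a + β • b + γ • c) : γ ≤ 0 := by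
  by_contra! hγ
  -- If `γ > 0`, move slightly from the midpoint of `ab` towards `d`. For this `ε` the point `q`
  -- lies in both triangles, hence on `ab`, although its coordinate at `c` is positive.
  set ε : ℝ := 1 / (1 + 2 * |α| + 2 * |β|) with hε
  have hpos : 0 < 1 + 2 * |α| + 2 * |β| := by positivity
  have hε0 : 0 < ε := by positivity
  have hεm : ε * (1 + 2 * |α| + 2 * |β|) = 1 := by rw [hε]; field_simp
  have hεα : 0 ≤ ε * |α| := by positivity
  have hεβ : 0 ≤ ε * |β| := by positivity
  have h1 : 0 ≤ (1 - ε) / 2 + ε * α := by nlinarith [neg_abs_le α]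
  have h2 : 0 ≤ (1 - ε) / 2 + ε * β := by nlinarith [neg_abs_le β]
  set q := ((1 - ε) / 2) • a + ((1 - ε) / 2) • b + ε • d with hq
  have hq' : q = ((1 - ε) / 2 + ε * α) • a + ((1 - ε) / 2 + ε * β) • b + (ε * γ) • c := by
    rw [hq]
    conv_lhs => rw [hd]
    module
  have hmem : ∀ {u v w : E} {r s t : ℝ}, 0 ≤ r → 0 ≤ s → 0 ≤ t →
      r + s + t = 1 → r • u + s • v + t • w ∈ convexHull ℝ {u, v, w} := by
    intro u v w r s t hr hs ht hrst
    have := (convex_convexHull ℝ ({u, v, w} : Set E)).sum_mem (t := univ) (w := ![r, s, t])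
      (z := ![u, v, w])
      (by intro i _; fin_cases i <;> simpa)
      (by simpa [Fin.sum_univ_three] using hrst)
      (by intro i _; apply subset_convexHull; fin_cases i <;> simp)
    simpa [Fin.sum_univ_three] using this
  have hqd : q ∈ convexHull ℝ {a, b, d} :=
    hmem (by nlinarith) (by nlinarith) hε0.le (by ring)
  have hqc : q ∈ convexHull ℝ {a, b, c} := by
    rw [hq']
    exact hmem h1 h2 (by positivity) (by linear_combination ε * hsum)
  obtain ⟨s, hs, hse⟩ := htc.2.2.2
  obtain ⟨t, ht, hte⟩ := htd.2.2.2
  have hqi := K.inter_subset_convexHull hs ht ⟨by rwa [hse], by rwa [hte]⟩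
  have hset : ({a, b, c} ∩ {a, b, d} : Set E) = {a, b} := by
    ext p
    simp only [Set.mem_inter_iff, Set.mem_insert_iff, Set.mem_singleton_iff]
    have := htc.2.1; have := htc.2.2.1
    constructor
    · rintro ⟨rfl | rfl | rfl, h⟩ <;> tauto
    · tauto
  rw [hse, hte, hset, convexHull_pair] at hqi
  obtain ⟨s, t, -, -, hst, hstq⟩ := hqi
  rw [hq'] at hstq
  have := (htc.eq_zero (α := (1 - ε) / 2 + ε * α - s) (β := (1 - ε) / 2 + ε * β - t) (γ := ε * γ)
    (by linear_combination ε * hsum - hst) (by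
      rw [← sub_eq_zero] at hstq
      rw [← neg_eq_zero, ← hstq]
      module)).2.2
  have h3 : 0 < ε * γ := by positivity
  exact h3.ne' this

end Geometry.SimplicialComplex

namespace OrientedTriangulation

variable {N : ℕ} (S : OrientedTriangulation N)

theorem O_unique {x y z z' : Fin N} (h : S.O x y z) (h' : S.O x y z') : z = z' := by
  obtain ⟨n, l, hn, hper, hinj, hO⟩ := S.link x
  obtain ⟨k, rfl, rfl⟩ := (hO _ _).1 h
  obtain ⟨k', hk, rfl⟩ := (hO _ _).1 h'
  rw [← hper.map_mod_nat k, ← hper.map_mod_nat k'] at hk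
  have hm : k % n = k' % n := hinj (Nat.mod_lt _ (by omega)) (Nat.mod_lt _ (by omega)) hk
  rw [← hper.map_mod_nat (k + 1), ← hper.map_mod_nat (k' + 1), Nat.ModEq.add_right 1 hm]

/-- Both triangles would make the link of `x` step from `y` to `z` and back to `y`, impossible in a
cycle of length at least 4. -/
theorem not_O_swap {x y z : Fin N} (h : S.O x y z) : ¬ S.O y x z := by
  intro h'
  have h' := S.cyc h'
  obtain ⟨n, l, hn, hper, hinj, hO⟩ := S.link x
  obtain ⟨k, rfl, rfl⟩ := (hO _ _).1 h
  obtain ⟨k', hk1, hk2⟩ := (hO _ _).1 h'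
  have hmod : ∀ i j, l i = l j → i % n = j % n := fun i j hij => by
    rw [← hper.map_mod_nat i, ← hper.map_mod_nat j] at hij
    exact hinj (Nat.mod_lt _ (by omega)) (Nat.mod_lt _ (by omega)) hij
  have h1 : k + 1 ≡ k' [MOD n] := hmod _ _ hk1
  have h2 : k ≡ k' + 1 [MOD n] := hmod _ _ hk2
  have h3 : k' + 1 ≡ k + 2 [MOD n] := (h1.add_right 1).symm
  have h4 : k + 0 ≡ k + 2 [MOD n] := h2.trans h3
  have h5 := Nat.ModEq.add_left_cancel' k h4
  have h6 : 0 % n = 2 % n := h5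
  rw [Nat.zero_mod, Nat.mod_eq_of_lt (by omega)] at h6
  omega

theorem distinct {x y z : Fin N} (h : S.O x y z) : x ≠ y ∧ y ≠ z ∧ x ≠ z :=
  ⟨S.ne h, S.ne (S.cyc h), (S.ne (S.cyc (S.cyc h))).symm⟩

/-- The determinant of the coordinates of three points with respect to three vertices. -/
def coordDet (x y z : Fin N) (a b c : EuclideanSpace ℝ (Fin N)) : ℝ :=
  a x * (b y * c z - b z * c y) - a y * (b x * c z - b z * c x) + a z * (b x * c y - b y * c x)

def triangleSet (x y z : Fin N) : Set (EuclideanSpace ℝ (Fin N)) :=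
  convexHull ℝ ((({x, y, z} : Finset (Fin N)).image pt : Finset _) : Set (EuclideanSpace ℝ (Fin N)))

theorem mem_triangleSet {x y z : Fin N} {p : EuclideanSpace ℝ (Fin N)} : p ∈ triangleSet x y z ↔
    (∀ i, 0 ≤ p i) ∧ ∑ i, p i = 1 ∧ ∀ i ∉ ({x, y, z} : Finset (Fin N)), p i = 0 :=
  mem_convexHull_pt_iff

theorem triangleSet_rotate (x y z : Fin N) : triangleSet x y z = triangleSet y z x := by
  have : ({x, y, z} : Finset (Fin N)) = {y, z, x} := by ext; simp; tauto
  rw [triangleSet, this, triangleSet]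

theorem coord_sum {x y z : Fin N} (hxy : x ≠ y) (hyz : y ≠ z) (hxz : x ≠ z)
    {p : EuclideanSpace ℝ (Fin N)} (hp : p ∈ triangleSet x y z) : p x + p y + p z = 1 := by
  obtain ⟨-, h1, h2⟩ := mem_triangleSet.1 hp
  rw [← h1, ← sum_subset (subset_univ ({x, y, z} : Finset (Fin N))) fun i _ hi => h2 i hi,
    sum_insert (by simp [hxy, hxz]), sum_insert (by simp [hyz]), sum_singleton, add_assoc]

theorem ext_of_triangleSet {x y z : Fin N} {p : EuclideanSpace ℝ (Fin N)}
    (h : ∀ i ∉ ({x, y, z} : Finset (Fin N)), p i = 0) (hx : p x = 0) (hy : p y = 0)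
    (hz : p z = 0) : p = 0 := by
  ext i
  by_cases hi : i ∈ ({x, y, z} : Finset (Fin N))
  · simp only [mem_insert, mem_singleton] at hi
    rcases hi with rfl | rfl | rfl <;> simpa
  · simpa using h i hi

variable {K : SimplicialComplex ℝ (EuclideanSpace ℝ (Fin N))}
  {a b c d : EuclideanSpace ℝ (Fin N)} {x y z x' y' z' : Fin N}

theorem coordDet_ne_zero (h : S.O x y z) (ht : K.IsTriangle a b c) (ha : a ∈ triangleSet x y z)
    (hb : b ∈ triangleSet x y z) (hc : c ∈ triangleSet x y z) : coordDet x y z a b c ≠ 0 := by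
  intro h0
  obtain ⟨hxy, hyz, hxz⟩ := S.distinct h
  have hdet : (!![a x, a y, a z; b x, b y, b z; c x, c y, c z] : Matrix _ _ ℝ).det = 0 := by
    rw [Matrix.det_fin_three, ← h0]
    simp [coordDet]
    ring
  obtain ⟨v, hv, hvM⟩ := Matrix.exists_vecMul_eq_zero_iff.2 hdet
  have e0 := congrFun hvM 0
  have e1 := congrFun hvM 1
  have e2 := congrFun hvM 2
  simp [Matrix.vecMul, dotProduct, Fin.sum_univ_three] at e0 e1 e2
  have ha1 := coord_sum hxy hyz hxz ha
  have hb1 := coord_sum hxy hyz hxz hb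
  have hc1 := coord_sum hxy hyz hxz hc
  obtain ⟨h1, h2, h3⟩ := ht.eq_zero (α := v 0) (β := v 1) (γ := v 2)
    (by linear_combination e0 + e1 + e2 - v 0 * ha1 - v 1 * hb1 - v 2 * hc1)
    (ext_of_triangleSet (x := x) (y := y) (z := z) (fun i hi => by
      simp [(mem_triangleSet.1 ha).2.2 i hi, (mem_triangleSet.1 hb).2.2 i hi,
        (mem_triangleSet.1 hc).2.2 i hi]) (by simpa using e0) (by simpa using e1)
        (by simpa using e2))
  exact hv (by funext i; fin_cases i <;> assumption)

/-- A nondegenerate triangle lies in only one triangle of the triangulation. -/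
theorem coordDet_eq_of_mem (h : S.O x y z) (h' : S.O x' y' z') (ht : K.IsTriangle a b c)
    (ha : a ∈ triangleSet x y z) (hb : b ∈ triangleSet x y z) (hc : c ∈ triangleSet x y z)
    (ha' : a ∈ triangleSet x' y' z') (hb' : b ∈ triangleSet x' y' z')
    (hc' : c ∈ triangleSet x' y' z') : coordDet x' y' z' a b c = coordDet x y z a b c := by
  have hne := S.coordDet_ne_zero h ht ha hb hc
  obtain ⟨hxy, hyz, hxz⟩ := S.distinct h
  have hz : ∀ i ∉ ({x', y', z'} : Finset (Fin N)), a i = 0 ∧ b i = 0 ∧ c i = 0 := fun i hi =>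
    ⟨(mem_triangleSet.1 ha').2.2 i hi, (mem_triangleSet.1 hb').2.2 i hi,
      (mem_triangleSet.1 hc').2.2 i hi⟩
  have hx : x ∈ ({x', y', z'} : Finset (Fin N)) := by
    by_contra hn
    obtain ⟨e1, e2, e3⟩ := hz x hn
    exact hne (by unfold coordDet; rw [e1, e2, e3]; ring)
  have hy : y ∈ ({x', y', z'} : Finset (Fin N)) := by
    by_contra hn
    obtain ⟨e1, e2, e3⟩ := hz y hn
    exact hne (by unfold coordDet; rw [e1, e2, e3]; ring)
  have hz : z ∈ ({x', y', z'} : Finset (Fin N)) := by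
    by_contra hn
    obtain ⟨e1, e2, e3⟩ := hz z hn
    exact hne (by unfold coordDet; rw [e1, e2, e3]; ring)
  simp only [mem_insert, mem_singleton] at hx hy hz
  have n1 := S.not_O_swap h'
  have n2 := S.not_O_swap (S.cyc h')
  have n3 := S.not_O_swap (S.cyc (S.cyc h'))
  -- Nondegeneracy forces equal vertex sets. An odd matching would give opposite orientations of one
  -- triangle; an even one preserves the determinant.
  rcases hx with rfl | rfl | rfl <;> rcases hy with rfl | rfl | rfl <;>
    rcases hz with rfl | rfl | rfl <;>
    first
      | exact absurd rfl hxy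
      | exact absurd rfl hyz
      | exact absurd rfl hxz
      | rfl
      | exact (n1 h).elim
      | exact (n1 (S.cyc h)).elim
      | exact (n1 (S.cyc (S.cyc h))).elim
      | (unfold coordDet; ring)

/-- The orientation of a triangle induced by that of the surrounding triangle. -/
def IsPositive (a b c : EuclideanSpace ℝ (Fin N)) : Prop :=
  ∃ x y z, S.O x y z ∧ a ∈ triangleSet x y z ∧ b ∈ triangleSet x y z ∧ c ∈ triangleSet x y z ∧
    0 < coordDet x y z a b c

theorem isPositive_iff (h : S.O x y z) (ht : K.IsTriangle a b c) (ha : a ∈ triangleSet x y z)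
    (hb : b ∈ triangleSet x y z) (hc : c ∈ triangleSet x y z) :
    S.IsPositive a b c ↔ 0 < coordDet x y z a b c := by
  constructor
  · rintro ⟨x', y', z', h', ha', hb', hc', hp⟩
    rwa [S.coordDet_eq_of_mem h' h ht ha' hb' hc' ha hb hc]
  · exact fun hp => ⟨x, y, z, h, ha, hb, hc, hp⟩

theorem exists_triangle_of_isSubdivision (hK : K.IsSubdivision S.complex)
    (ht : K.IsTriangle a b c) : ∃ x y z, S.O x y z ∧ a ∈ triangleSet x y z ∧
      b ∈ triangleSet x y z ∧ c ∈ triangleSet x y z := by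
  obtain ⟨s, hs, e⟩ := ht.2.2.2
  obtain ⟨t, ⟨-, x, y, z, h, ht'⟩, hst⟩ := hK.1 s hs
  have hsub : ({a, b, c} : Set (EuclideanSpace ℝ (Fin N))) ⊆ triangleSet x y z := by
    rw [← e]
    exact (subset_convexHull ℝ _).trans (hst.trans (convexHull_mono (coe_subset.2 ht')))
  exact ⟨x, y, z, h, hsub (by simp), hsub (by simp), hsub (by simp)⟩

/-- By Cramer's rule the coordinate of `d` at `c` relative to `abc` is the quotient of the
determinants, and it is not positive since the two triangles lie on opposite sides of `ab`. -/
theorem coordDet_pos_iff_of_same (h : S.O x y z) (hcd : c ≠ d) (htc : K.IsTriangle a b c)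
    (htd : K.IsTriangle a b d) (ha : a ∈ triangleSet x y z) (hb : b ∈ triangleSet x y z)
    (hc : c ∈ triangleSet x y z) (hd : d ∈ triangleSet x y z) :
    0 < coordDet x y z a b c ↔ 0 < coordDet x y z b a d := by
  have hDc := S.coordDet_ne_zero h htc ha hb hc
  have hDd := S.coordDet_ne_zero h htd ha hb hd
  have hswap : coordDet x y z b a d = - coordDet x y z a b d := by unfold coordDet; ring
  set Dc := coordDet x y z a b c with hDcdef
  set Dd := coordDet x y z a b d with hDddef
  suffices hγ : ¬ 0 < Dd / Dc by
    rw [hswap]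
    rcases lt_or_gt_of_ne hDc with h1 | h1 <;> rcases lt_or_gt_of_ne hDd with h2 | h2
    · exact (hγ (div_pos_of_neg_of_neg h2 h1)).elim
    · constructor <;> intro <;> linarith
    · constructor <;> intro <;> linarith
    · exact (hγ (div_pos h2 h1)).elim
  intro hγ
  set γ := Dd / Dc with hγdef
  set α := coordDet x y z d b c / Dc with hα
  set β := coordDet x y z a d c / Dc with hβ
  have hd : d = α • a + β • b + γ • c := by
    rw [← sub_eq_zero]
    have hz : ∀ p ∈ triangleSet x y z, ∀ i ∉ ({x, y, z} : Finset (Fin N)), p i = 0 :=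
      fun p hp => (mem_triangleSet.1 hp).2.2
    refine ext_of_triangleSet (x := x) (y := y) (z := z) (fun i hi => ?_) ?_ ?_ ?_
    · simp [hz a ha i hi, hz b hb i hi, hz c hc i hi, hz d hd i hi]
    all_goals
      simp only [PiLp.sub_apply, PiLp.add_apply, PiLp.smul_apply, smul_eq_mul, hα, hβ, hγdef]
      field_simp
      rw [hDddef, hDcdef]
      unfold coordDet
      ring
  obtain ⟨hxy, hyz, hxz⟩ := S.distinct h
  have hsum : α + β + γ = 1 := by
    have e1 := coord_sum hxy hyz hxz ha
    have e2 := coord_sum hxy hyz hxz hb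
    have e3 := coord_sum hxy hyz hxz hc
    have e4 := coord_sum hxy hyz hxz (by assumption : d ∈ triangleSet x y z)
    have hc' : ∀ i, d i = α * a i + β * b i + γ * c i := fun i => by
      conv_lhs => rw [hd]
      simp
    rw [hc' x, hc' y, hc' z] at e4
    linear_combination e4 - α * e1 - β * e2 - γ * e3
  exact hγ.not_ge (htc.nonpos_of_adjacent htd hcd hsum hd)

/-- Here `a` and `b` lie on the side `xy`, and the second surrounding triangle is oriented as `y`,
`x`, `w`. Both determinants reduce to the same 2 by 2 minor times a positive coordinate of `c` or
`d`. -/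
theorem isPositive_iff_of_adjacent (h : S.O x y z) (h' : S.O x' y' z')
    (htc : K.IsTriangle a b c) (htd : K.IsTriangle a b d) (ha : a ∈ triangleSet x y z)
    (hb : b ∈ triangleSet x y z) (hc : c ∈ triangleSet x y z) (ha' : a ∈ triangleSet x' y' z')
    (hb' : b ∈ triangleSet x' y' z') (hd : d ∈ triangleSet x' y' z')
    (hz : z ∉ ({x', y', z'} : Finset (Fin N))) :
    S.IsPositive a b c ↔ S.IsPositive b a d := by
  have hDc := S.coordDet_ne_zero h htc ha hb hc
  obtain ⟨hxy, hyz, hxz⟩ := S.distinct h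
  have az := (mem_triangleSet.1 ha').2.2 z hz
  have bz := (mem_triangleSet.1 hb').2.2 z hz
  have hD : coordDet x y z a b c = (a x * b y - a y * b x) * c z := by
    unfold coordDet; rw [az, bz]; ring
  have hx : x ∈ ({x', y', z'} : Finset (Fin N)) := by
    by_contra hn
    rw [hD, (mem_triangleSet.1 ha').2.2 x hn, (mem_triangleSet.1 hb').2.2 x hn] at hDc
    simp at hDc
  have hy : y ∈ ({x', y', z'} : Finset (Fin N)) := by
    by_contra hn
    rw [hD, (mem_triangleSet.1 ha').2.2 y hn, (mem_triangleSet.1 hb').2.2 y hn] at hDc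
    simp at hDc
  obtain ⟨w, hw, hTw⟩ : ∃ w, S.O y x w ∧ triangleSet x' y' z' = triangleSet y x w := by
    have r1 := triangleSet_rotate x' y' z'
    have r2 := triangleSet_rotate y' z' x'
    have c1 := S.cyc h'
    have c2 := S.cyc c1
    simp only [mem_insert, mem_singleton, not_or] at hx hy hz
    rcases hx with rfl | rfl | rfl <;> rcases hy with rfl | rfl | rfl
    · exact absurd rfl hxy
    · exact (hz.2.2 (S.O_unique h h')).elim
    · exact ⟨_, c2, r1.trans r2⟩
    · exact ⟨_, h', rfl⟩
    · exact absurd rfl hxy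
    · exact (hz.1 (S.O_unique h c1)).elim
    · exact (hz.2.1 (S.O_unique h c2)).elim
    · exact ⟨_, c1, r1⟩
    · exact absurd rfl hxy
  rw [hTw] at ha' hb' hd
  obtain ⟨-, hxw, hyw⟩ := S.distinct hw
  have hwT : w ∉ ({x, y, z} : Finset (Fin N)) := by
    simp only [mem_insert, mem_singleton, not_or]
    refine ⟨hxw.symm, hyw.symm, ?_⟩
    rintro rfl
    exact S.not_O_swap h hw
  have aw := (mem_triangleSet.1 ha).2.2 w hwT
  have bw := (mem_triangleSet.1 hb).2.2 w hwT
  have hD' : coordDet y x w b a d = (a x * b y - a y * b x) * d w := by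
    unfold coordDet; rw [aw, bw]; ring
  have hDd := S.coordDet_ne_zero hw htd.swap hb' ha' hd
  rw [S.isPositive_iff h htc ha hb hc, S.isPositive_iff hw htd.swap hb' ha' hd, hD, hD']
  rw [hD] at hDc
  rw [hD'] at hDd
  have hcz : 0 < c z := ((mem_triangleSet.1 hc).1 z).lt_of_ne' (right_ne_zero_of_mul hDc)
  have hdw : 0 < d w := ((mem_triangleSet.1 hd).1 w).lt_of_ne' (right_ne_zero_of_mul hDd)
  rw [mul_pos_iff_of_pos_right hcz, mul_pos_iff_of_pos_right hdw]

theorem isOrientable_of_isSubdivision (hK : K.IsSubdivision S.complex) : K.IsOrientable := by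
  refine ⟨S.IsPositive, fun a b c ht => ?_, fun a b c ht => ?_, fun a b c d hcd htc htd => ?_⟩
  · obtain ⟨x, y, z, h, ha, hb, hc⟩ := S.exists_triangle_of_isSubdivision hK ht
    rw [S.isPositive_iff h ht ha hb hc, S.isPositive_iff h ht.rotate hb hc ha]
    have : coordDet x y z b c a = coordDet x y z a b c := by unfold coordDet; ring
    rw [this]
  · obtain ⟨x, y, z, h, ha, hb, hc⟩ := S.exists_triangle_of_isSubdivision hK ht
    rw [S.isPositive_iff h ht ha hb hc, S.isPositive_iff h ht.swap hb ha hc]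
    have hne := S.coordDet_ne_zero h ht ha hb hc
    have : coordDet x y z b a c = -coordDet x y z a b c := by unfold coordDet; ring
    rw [this, not_lt, neg_nonpos]
    exact ⟨le_of_lt, fun h => h.lt_of_ne' hne⟩
  · obtain ⟨x, y, z, h, ha, hb, hc⟩ := S.exists_triangle_of_isSubdivision hK htc
    obtain ⟨x', y', z', h', ha', hb', hd⟩ := S.exists_triangle_of_isSubdivision hK htd
    by_cases hz : z ∈ ({x', y', z'} : Finset (Fin N))
    · by_cases hx : x ∈ ({x', y', z'} : Finset (Fin N))
      · by_cases hy : y ∈ ({x', y', z'} : Finset (Fin N))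
        · obtain ⟨hxy, hyz, hxz⟩ := S.distinct h
          have hsub : ({x, y, z} : Finset (Fin N)) ⊆ {x', y', z'} := by
            simp only [insert_subset_iff, singleton_subset_iff]
            exact ⟨hx, hy, hz⟩
          have heq := eq_of_subset_of_card_le hsub (by
            rw [card_eq_three.2 ⟨x, y, z, hxy, hxz, hyz, rfl⟩]; exact card_le_three)
          have hd' : d ∈ triangleSet x y z := by rwa [triangleSet, heq]
          rw [S.isPositive_iff h htc ha hb hc, S.isPositive_iff h htd.swap hb ha hd']
          exact S.coordDet_pos_iff_of_same h hcd htc htd ha hb hc hd'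
        · rw [triangleSet_rotate, triangleSet_rotate] at ha hb hc
          exact S.isPositive_iff_of_adjacent (S.cyc (S.cyc h)) h' htc htd ha hb hc ha' hb' hd hy
      · rw [triangleSet_rotate] at ha hb hc
        exact S.isPositive_iff_of_adjacent (S.cyc h) h' htc htd ha hb hc ha' hb' hd hx
    · exact S.isPositive_iff_of_adjacent h h' htc htd ha hb hc ha' hb' hd hz

end OrientedTriangulation

end

/-! ### Graphs of girth at least five as subcomplexes. -/

section

open Geometry Finset
open scoped Classical

namespace SimpleGraph

variable {V : Type*} {Γ : SimpleGraph V}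

theorem not_adj_of_five_le_egirth (h : 5 ≤ Γ.egirth) {a b c : V} (hab : Γ.Adj a b)
    (hbc : Γ.Adj b c) : ¬ Γ.Adj c a := by
  intro hca
  have := le_egirth.1 h a (.cons hab (.cons hbc (.cons hca .nil)))
    (by simp [Walk.cons_isCycle_iff, hab.ne, hab.ne', hbc.ne, hca.ne, hca.ne'])
  revert this
  norm_num

theorem not_square_of_five_le_egirth (h : 5 ≤ Γ.egirth) {a b c d : V} (hab : Γ.Adj a b)
    (hbc : Γ.Adj b c) (hcd : Γ.Adj c d) (hac : a ≠ c) (hbd : b ≠ d) : ¬ Γ.Adj d a := by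
  intro hda
  have := le_egirth.1 h a (.cons hab (.cons hbc (.cons hcd (.cons hda .nil))))
    (by simp [Walk.cons_isCycle_iff, hab.ne, hab.ne', hbc.ne, hcd.ne, hda.ne, hda.ne', hac,
          hac.symm, hbd])
  revert this
  norm_num

end SimpleGraph

namespace Geometry.SimplicialComplex

variable {E : Type*} [AddCommGroup E] [Module ℝ E] {V : Type*}

/-- The `1`-dimensional subcomplex of `X` given by a graph on some of its vertices. -/
def ofGraph (X : SimplicialComplex ℝ E) (Γ : SimpleGraph V) (g : V → E)
    (h : ∀ u v, {g u, g v} ∈ X.faces) : SimplicialComplex ℝ E where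
  faces := {s | (∃ v, s = {g v}) ∨ ∃ u v, Γ.Adj u v ∧ s = {g u, g v}}
  indep := by
    rintro s (⟨v, rfl⟩ | ⟨u, v, -, rfl⟩)
    · exact X.indep (by simpa using h v v)
    · exact X.indep (h u v)
  isRelLowerSet_faces := by
    rintro s (⟨v, rfl⟩ | ⟨u, v, huv, rfl⟩)
    · refine ⟨singleton_nonempty _, fun t ht hne => .inl ⟨v, ?_⟩⟩
      exact (subset_singleton_iff.1 ht).resolve_left hne.ne_empty
    · refine ⟨by simp, fun t ht hne => ?_⟩
      have ht : t ⊆ {g u, g v} := ht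
      rcases Set.subset_pair_iff_eq.1 (by simpa using coe_subset.2 ht) with h | h | h | h
      · exact (hne.ne_empty (by simpa using h)).elim
      · exact .inl ⟨u, by simpa using h⟩
      · exact .inl ⟨v, by simpa using h⟩
      · exact .inr ⟨u, v, huv, by rw [← coe_inj, h, coe_pair]⟩
  inter_subset_convexHull := by
    have hX : ∀ s : Finset E, ((∃ v, s = {g v}) ∨ ∃ u v, Γ.Adj u v ∧ s = {g u, g v}) →
        s ∈ X.faces := by
      rintro s (⟨v, rfl⟩ | ⟨u, v, -, rfl⟩)
      · simpa using h v v
      · exact h u v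
    intro s t hs ht
    exact X.inter_subset_convexHull (hX _ hs) (hX _ ht)

variable {X : SimplicialComplex ℝ E} {Γ : SimpleGraph V} {g : V → E}
  {h : ∀ u v, {g u, g v} ∈ X.faces}

theorem ofGraph_le : X.ofGraph Γ g h ≤ X := by
  rintro s (⟨v, rfl⟩ | ⟨u, v, -, rfl⟩)
  · simpa using h v v
  · exact h u v

theorem mem_ofGraph_vertices {x : E} : x ∈ (X.ofGraph Γ g h).vertices ↔ ∃ v, x = g v := by
  constructor
  · rintro (⟨v, hv⟩ | ⟨u, v, -, hv⟩)
    · exact ⟨v, by simpa using hv⟩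
    · exact ⟨u, (mem_singleton.1 (hv ▸ mem_insert_self (g u) {g v})).symm⟩
  · rintro ⟨v, rfl⟩
    exact .inl ⟨v, rfl⟩

theorem pair_mem_ofGraph_iff (hg : Function.Injective g) {u v : V} (huv : u ≠ v) :
    {g u, g v} ∈ (X.ofGraph Γ g h).faces ↔ Γ.Adj u v := by
  constructor
  · rintro (⟨w, hw⟩ | ⟨a, b, hab, e⟩)
    · have := congrArg Finset.card hw
      rw [card_pair (hg.ne huv), card_singleton] at this
      omega
    · rcases finset_pair_eq_pair e with ⟨h1, h2⟩ | ⟨h1, h2⟩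
      · rwa [hg h1, hg h2]
      · rw [hg h1, hg h2]; exact hab.symm
  · exact fun huv => .inr ⟨u, v, huv, rfl⟩

/-- Without triangles, cliques have at most two vertices; without 4-cycles, there is no square at
all. -/
theorem isFlagNoSquare_ofGraph (hg : Function.Injective g) (hΓ : 5 ≤ Γ.egirth) :
    (X.ofGraph Γ g h).IsFlagNoSquare := by
  have hadj : ∀ {u v}, g u ≠ g v → {g u, g v} ∈ (X.ofGraph Γ g h).faces → Γ.Adj u v :=
    fun hne hf => (pair_mem_ofGraph_iff hg fun e => hne (by rw [e])).1 hf
  refine ⟨isFlag_iff.2 fun s hs hv hc => ?_, not_square_iff.2 ?_⟩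
  · obtain ⟨a, ha⟩ := hs
    by_cases h1 : ∃ b ∈ s, b ≠ a
    · obtain ⟨b, hb, hba⟩ := h1
      by_cases h2 : ∃ c ∈ s, c ≠ a ∧ c ≠ b
      · obtain ⟨c, hc', hca, hcb⟩ := h2
        have fab := hc a ha b hb hba.symm
        have fbc := hc b hb c hc' hcb.symm
        have fca := hc c hc' a ha hca
        obtain ⟨u, rfl⟩ := mem_ofGraph_vertices.1 (hv a ha)
        obtain ⟨v, rfl⟩ := mem_ofGraph_vertices.1 (hv b hb)
        obtain ⟨w, rfl⟩ := mem_ofGraph_vertices.1 (hv c hc')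
        exact (SimpleGraph.not_adj_of_five_le_egirth hΓ (hadj hba.symm fab) (hadj hcb.symm fbc)
          (hadj hca fca)).elim
      · push Not at h2
        have : s = {a, b} := by
          ext c
          rw [mem_insert, mem_singleton]
          exact ⟨fun hc => or_iff_not_imp_left.2 (h2 c hc), by rintro (rfl | rfl) <;> assumption⟩
        rw [this]
        exact hc a ha b hb hba.symm
    · push Not at h1
      have : s = {a} := eq_singleton_iff_unique_mem.2 ⟨ha, h1⟩
      rw [this]
      exact hv a ha
  · intro a b c d hab hbc hcd hda hac hbd fab fbc fcd fda
    have hv : ∀ {x y : E}, {x, y} ∈ (X.ofGraph Γ g h).faces → ∃ v, x = g v := fun hf =>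
      (mem_ofGraph_vertices (h := h)).1 (down_closed hf (by simp) (singleton_nonempty _))
    obtain ⟨u, rfl⟩ := hv fab
    obtain ⟨v, rfl⟩ := hv fbc
    obtain ⟨w, rfl⟩ := hv fcd
    obtain ⟨x, rfl⟩ := hv fda
    exact (SimpleGraph.not_square_of_five_le_egirth hΓ (hadj hab fab) (hadj hbc fbc) (hadj hcd fcd)
      (fun e => hac (by rw [e])) (fun e => hbd (by rw [e])) (hadj hda fda)).elim

theorem isIndContained_of_isFullSubcomplex {K : SimplicialComplex ℝ E} (hg : Function.Injective g)
    (hK : (X.ofGraph Γ g h).IsFullSubcomplex K) : Γ.IsIndContained K.edgeGraph := by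
  have hv : ∀ v, g v ∈ (X.ofGraph Γ g h).vertices := fun v => mem_ofGraph_vertices.2 ⟨v, rfl⟩
  refine ⟨⟨⟨fun v => ⟨g v, hK.1 (hv v)⟩, fun u v e => hg (congrArg Subtype.val e)⟩, ?_⟩⟩
  intro u v
  rw [edgeGraph_adj_iff]
  constructor
  · rintro ⟨hne, hf⟩
    refine (pair_mem_ofGraph_iff hg fun e => hne (by rw [e])).1 (hK.2 _ hf fun x hx => ?_)
    rw [mem_insert, mem_singleton] at hx
    rcases hx with rfl | rfl
    · exact hv u
    · exact hv v
  · exact fun huv => ⟨hg.ne huv.ne, hK.1 ((pair_mem_ofGraph_iff hg huv.ne).2 huv)⟩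

/-- A graph of girth at least `5` in the `1`-skeleton of a complex of dimension at most `2` becomes
an induced subgraph of a flag-no-square subdivision. -/
theorem exists_subdivision_isIndContained (hX : ∀ s ∈ X.faces, s.card ≤ 3)
    (hg : Function.Injective g) (h : ∀ u v, ∃ s ∈ X.faces, (s : Set E) = {g u, g v})
    (hΓ : 5 ≤ Γ.egirth) :
    ∃ K : SimplicialComplex ℝ E, K.IsSubdivision X ∧ (X.faces.Finite → K.faces.Finite) ∧
      K.IsFlagNoSquare ∧ Γ.IsIndContained K.edgeGraph := by
  have hL := isFlagNoSquare_ofGraph (X := X) (h := fun u v => pair_mem_faces_iff.1 (h u v)) hg hΓ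
  exact ⟨relSubdivision hX hL.1, relSubdivision_isSubdivision hX hL.1,
    fun hf => (relTriangulation hX hL.1).finite_faces hf,
    isFlagNoSquare_relSubdivision hX hL ofGraph_le,
    isIndContained_of_isFullSubcomplex hg (isFullSubcomplex_relSubdivision hX hL.1 ofGraph_le)⟩

end Geometry.SimplicialComplex

/-! ### Biggs's embedding of a complete graph of prime order. -/

namespace BiggsMap

variable {p : ℕ} [Fact p.Prime] (η : (ZMod p)ˣ)

/-- The faces of the regular embedding of the complete graph on `ZMod p`: the face with centre `c`
is the polygon `c + η ^ k`. -/
def T (x y c : ZMod p) : Prop := y - c = η * (x - c) ∧ x ≠ c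

/-- The positively oriented triangles of the barycentric triangulation of the faces. -/
def O : ZMod p ⊕ ZMod p → ZMod p ⊕ ZMod p → ZMod p ⊕ ZMod p → Prop
  | .inl x, .inl y, .inr c => T η x y c
  | .inl y, .inr c, .inl x => T η x y c
  | .inr c, .inl x, .inl y => T η x y c
  | _, _, _ => False

theorem O_rotate {u v w : ZMod p ⊕ ZMod p} (h : O η u v w) : O η v w u := by
  rcases u with u | u <;> rcases v with v | v <;> rcases w with w | w <;> exact h

variable {η}

theorem exists_pow_eq {θ : (ZMod p)ˣ} (hθ : ∀ u, u ∈ Subgroup.zpowers θ) {x : ZMod p} (hx : x ≠ 0) :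
    ∃ k : ℕ, (θ : ZMod p) ^ k = x := by
  obtain ⟨k, hk⟩ := mem_powers_iff_mem_zpowers.2 (hθ (Units.mk0 x hx))
  refine ⟨k, ?_⟩
  have := congrArg (Units.val) hk
  simpa using this

theorem orderOf_eq {θ : (ZMod p)ˣ} (hθ : ∀ u, u ∈ Subgroup.zpowers θ) : orderOf θ = p - 1 := by
  rw [orderOf_eq_card_of_forall_mem_zpowers hθ, Nat.card_eq_fintype_card, ZMod.card_units]

theorem pow_inj {θ : (ZMod p)ˣ} (hθ : ∀ u, u ∈ Subgroup.zpowers θ) {i j : ℕ} (hi : i < p - 1)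
    (hj : j < p - 1) (h : (θ : ZMod p) ^ i = (θ : ZMod p) ^ j) : i = j := by
  refine pow_injOn_Iio_orderOf (x := θ) ?_ ?_ (Units.ext (by simpa using h)) <;>
    simpa [orderOf_eq hθ]

theorem pow_add_period {θ : (ZMod p)ˣ} (hθ : ∀ u, u ∈ Subgroup.zpowers θ) (k : ℕ) :
    (θ : ZMod p) ^ (k + (p - 1)) = (θ : ZMod p) ^ k := by
  have : θ ^ (p - 1) = 1 := by rw [← orderOf_eq hθ]; exact pow_orderOf_eq_one θ
  rw [pow_add, ← Units.val_pow_eq_pow_val θ (p - 1), this, Units.val_one, mul_one]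

theorem five_le (hp : p % 4 = 1) : 5 ≤ p := by
  have := (Fact.out : p.Prime).two_le
  omega

theorem val_ne_one (hη : ∀ u, u ∈ Subgroup.zpowers η) (hp : p % 4 = 1) : (η : ZMod p) ≠ 1 := by
  intro h
  have := five_le hp
  have := pow_inj hη (i := 0) (j := 1) (by omega) (by omega) (by simp [h])
  omega

/-- If `p ≡ 1` modulo `4` then `-η⁻¹` is a primitive root along with `η`. -/
theorem neg_inv_generator (hη : ∀ u, u ∈ Subgroup.zpowers η) (hp : p % 4 = 1) (u : (ZMod p)ˣ) :
    u ∈ Subgroup.zpowers (-η⁻¹) := by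
  have h5 := five_le hp
  set m := (p - 1) / 2 with hm
  have h2m : m * 2 = p - 1 := by omega
  have hev : Even m := ⟨m / 2, by omega⟩
  have hsq : (η ^ m) ^ 2 = 1 := by
    rw [← pow_mul, h2m, ← orderOf_eq hη]; exact pow_orderOf_eq_one η
  have hne : η ^ m ≠ 1 := fun h => by
    have := pow_inj hη (i := m) (j := 0) (by omega) (by omega) (by
      have := congrArg Units.val h
      simpa using this)
    omega
  have hneg : η ^ m = -1 := by
    have h1 : ((η ^ m : (ZMod p)ˣ) : ZMod p) ^ 2 = 1 := by
      rw [← Units.val_pow_eq_pow_val, hsq, Units.val_one]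
    rcases mul_self_eq_one_iff.1 ((sq _).symm.trans h1) with h | h
    · exact (hne (Units.ext h)).elim
    · exact Units.ext (by simpa using h)
  have hη' : η ∈ Subgroup.zpowers (-η⁻¹) := by
    rw [← inv_mem_iff]
    -- Since `η ^ m = -1` with `m` even, `(-η⁻¹) ^ m = -1`, so the next power is `η⁻¹`.
    refine ⟨((m + 1 : ℕ) : ℤ), ?_⟩
    simp only [zpow_natCast]
    rw [pow_succ, hev.neg_pow, inv_pow, hneg]
    simp
  exact (Subgroup.zpowers_le.2 hη') (hη u)

theorem O_ne (hη : ∀ u, u ∈ Subgroup.zpowers η) (hp : p % 4 = 1) {u v w : ZMod p ⊕ ZMod p}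
    (h : O η u v w) : u ≠ v := by
  rintro rfl
  rcases u with x | x <;> rcases w with c | c
  · exact h
  · obtain ⟨h1, h2⟩ := h
    have h3 : (x - c) * ((η : ZMod p) - 1) = 0 := by linear_combination -h1
    rcases mul_eq_zero.1 h3 with h4 | h4
    · exact h2 (sub_eq_zero.1 h4)
    · exact val_ne_one hη hp (sub_eq_zero.1 h4)
  · exact h
  · exact h

theorem link_center (hη : ∀ u, u ∈ Subgroup.zpowers η) (c : ZMod p) (u v : ZMod p ⊕ ZMod p) :
    O η (.inr c) u v ↔ ∃ k : ℕ, u = .inl (c + (η : ZMod p) ^ k) ∧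
      v = .inl (c + (η : ZMod p) ^ (k + 1)) := by
  constructor
  · intro h
    rcases u with x | x <;> rcases v with y | y
    · obtain ⟨h1, h2⟩ := h
      obtain ⟨k, hk⟩ := exists_pow_eq hη (sub_ne_zero.2 h2)
      refine ⟨k, by rw [hk]; ring_nf, ?_⟩
      rw [pow_succ', hk, ← h1]
      ring_nf
    all_goals exact h.elim
  · rintro ⟨k, rfl, rfl⟩
    refine ⟨?_, ?_⟩
    · ring
    · simp

/-- The cyclic sequence of neighbours of a vertex of the complete graph. -/
noncomputable def vertexLink (η : (ZMod p)ˣ) (x : ZMod p) (k : ℕ) : ZMod p ⊕ ZMod p :=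
  if k % 2 = 0 then .inl (x + (1 - (η : ZMod p)) * ((-η⁻¹ : (ZMod p)ˣ) : ZMod p) ^ (k / 2))
  else .inr (x + ((-η⁻¹ : (ZMod p)ˣ) : ZMod p) ^ (k / 2))

theorem vertexLink_even (x : ZMod p) (i : ℕ) : vertexLink η x (2 * i) =
    .inl (x + (1 - (η : ZMod p)) * ((-η⁻¹ : (ZMod p)ˣ) : ZMod p) ^ i) := by
  rw [vertexLink, if_pos (by omega), Nat.mul_div_cancel_left i two_pos]

theorem vertexLink_odd (x : ZMod p) (i : ℕ) : vertexLink η x (2 * i + 1) =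
    .inr (x + ((-η⁻¹ : (ZMod p)ˣ) : ZMod p) ^ i) := by
  rw [vertexLink, if_neg (by omega)]
  congr 4
  omega

/-- Around `x`, the neighbour `x + (1 - η) δ` is followed by the centre `x + δ` and then by the
neighbour `x + (1 - η) θ δ`, with `θ = -η⁻¹`. As `θ` is a primitive root, one cycle exhausts the
link. -/
theorem link_vertex (hη : ∀ u, u ∈ Subgroup.zpowers η) (hp : p % 4 = 1) (x : ZMod p)
    (u v : ZMod p ⊕ ZMod p) :
    O η (.inl x) u v ↔ ∃ k : ℕ, u = vertexLink η x k ∧ v = vertexLink η x (k + 1) := by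
  have hθ := neg_inv_generator hη hp
  have hη0 : (η : ZMod p) ≠ 0 := η.ne_zero
  set θ : (ZMod p)ˣ := -η⁻¹ with hθdef
  have hθη : (θ : ZMod p) * η = -1 := by
    rw [hθdef, Units.val_neg, neg_mul, Units.inv_mul]
  constructor
  · intro h
    rcases u with y | c <;> rcases v with y' | c'
    · exact h.elim
    · obtain ⟨h1, h2⟩ := h
      obtain ⟨k, hk⟩ := exists_pow_eq hθ (sub_ne_zero.2 h2.symm)
      refine ⟨2 * k, ?_, ?_⟩
      · rw [vertexLink_even, ← hθdef, hk]
        congr 1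
        linear_combination h1
      · rw [vertexLink_odd, ← hθdef, hk]
        congr 1
        ring
    · obtain ⟨h1, h2⟩ := h
      have hxc : c - x ≠ 0 := by
        intro h0
        have : (η : ZMod p) * (y' - c) = 0 := by linear_combination -h1 - h0
        rcases mul_eq_zero.1 this with h3 | h3
        · exact hη0 h3
        · exact h2 (sub_eq_zero.1 h3)
      obtain ⟨k, hk⟩ := exists_pow_eq hθ hxc
      refine ⟨2 * k + 1, ?_, ?_⟩
      · rw [vertexLink_odd, ← hθdef, hk]
        congr 1
        ring
      · have e : 2 * k + 1 + 1 = 2 * (k + 1) := by ring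
        rw [e, vertexLink_even, ← hθdef, pow_succ, hk]
        congr 1
        linear_combination (θ : ZMod p) * h1 + (y' - x) * hθη
    · exact h.elim
  · rintro ⟨k, rfl, rfl⟩
    obtain ⟨i, rfl | rfl⟩ : ∃ i, k = 2 * i ∨ k = 2 * i + 1 := ⟨k / 2, by omega⟩
    · rw [vertexLink_even, vertexLink_odd, ← hθdef]
      refine ⟨by ring, ?_⟩
      simp
    · have e : 2 * i + 1 + 1 = 2 * (i + 1) := by ring
      rw [vertexLink_odd, e, vertexLink_even, ← hθdef]
      refine ⟨?_, ?_⟩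
      · rw [pow_succ]
        linear_combination (-(1 - (η : ZMod p)) * (θ : ZMod p) ^ i) * hθη
      · intro h
        have h1 : (θ : ZMod p) ^ i * ((1 - η) * θ - 1) = 0 := by
          rw [pow_succ] at h
          linear_combination h
        rcases mul_eq_zero.1 h1 with h2 | h2
        · exact pow_ne_zero i θ.ne_zero h2
        · exact θ.ne_zero (by linear_combination h2 + hθη)

theorem vertexLink_periodic (hη : ∀ u, u ∈ Subgroup.zpowers η) (hp : p % 4 = 1) (x : ZMod p) :
    Function.Periodic (vertexLink η x) (2 * (p - 1)) := by
  have hθ := neg_inv_generator hη hp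
  intro k
  obtain ⟨i, rfl | rfl⟩ : ∃ i, k = 2 * i ∨ k = 2 * i + 1 := ⟨k / 2, by omega⟩
  · rw [← mul_add, vertexLink_even, vertexLink_even, pow_add_period hθ]
  · rw [add_right_comm, ← mul_add, vertexLink_odd, vertexLink_odd, pow_add_period hθ]

theorem vertexLink_injOn (hη : ∀ u, u ∈ Subgroup.zpowers η) (hp : p % 4 = 1) (x : ZMod p) :
    Set.InjOn (vertexLink η x) (Set.Iio (2 * (p - 1))) := by
  have hθ := neg_inv_generator hη hp
  have h1 : 1 - (η : ZMod p) ≠ 0 := sub_ne_zero.2 (val_ne_one hη hp).symm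
  intro j hj k hk h
  rw [Set.mem_Iio] at hj hk
  obtain ⟨i, rfl | rfl⟩ : ∃ i, j = 2 * i ∨ j = 2 * i + 1 := ⟨j / 2, by omega⟩ <;>
    obtain ⟨l, rfl | rfl⟩ : ∃ i, k = 2 * i ∨ k = 2 * i + 1 := ⟨k / 2, by omega⟩ <;>
    simp only [vertexLink_even, vertexLink_odd, Sum.inl.injEq, Sum.inr.injEq, reduceCtorEq] at h
  · rw [pow_inj hθ (by omega) (by omega) (mul_left_cancel₀ h1 (add_left_cancel h))]
  · rw [pow_inj hθ (by omega) (by omega) (add_left_cancel h)]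

/-- The equation for the centre is linear with leading coefficient `1 - η ≠ 0`: every directed edge
of the complete graph borders a face. -/
theorem exists_O_inl_inl (hη : ∀ u, u ∈ Subgroup.zpowers η) (hp : p % 4 = 1) {x y : ZMod p}
    (hxy : x ≠ y) : ∃ w, O η (.inl x) (.inl y) w := by
  have h1 : 1 - (η : ZMod p) ≠ 0 := sub_ne_zero.2 (val_ne_one hη hp).symm
  refine ⟨.inr ((y - η * x) / (1 - η)), ?_, ?_⟩
  · field_simp
    ring
  · intro h
    rw [eq_div_iff h1] at h
    exact hxy (by linear_combination h)

theorem exists_O_inl_inr {x c : ZMod p} (hxc : x ≠ c) : ∃ w, O η (.inl x) (.inr c) w := by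
  have h0 : (η : ZMod p) ≠ 0 := η.ne_zero
  refine ⟨.inl (c + (x - c) / η), ?_, ?_⟩
  · field_simp
    ring
  · simp [sub_ne_zero.2 hxc]

theorem exists_O_inr_inl {x c : ZMod p} (hxc : x ≠ c) : ∃ w, O η (.inr c) (.inl x) w :=
  ⟨.inl (c + η * (x - c)), by ring, hxc⟩

theorem reachable (hη : ∀ u, u ∈ Subgroup.zpowers η) (hp : p % 4 = 1) (u v : ZMod p ⊕ ZMod p) :
    Relation.ReflTransGen (fun a b => ∃ w, O η a b w) u v := by
  have hll : ∀ x y : ZMod p, Relation.ReflTransGen (fun a b => ∃ w, O η a b w) (.inl x) (.inl y) :=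
    fun x y => by
      by_cases h : x = y
      · rw [h]
      · exact .single (exists_O_inl_inl hη hp h)
  have h1 : ∀ c : ZMod p, c + 1 ≠ c := fun c => by simp
  have hu : ∃ x, Relation.ReflTransGen (fun a b => ∃ w, O η a b w) u (.inl x) := by
    rcases u with x | c
    · exact ⟨x, .refl⟩
    · exact ⟨c + 1, .single (exists_O_inr_inl (h1 c))⟩
  have hv : ∃ x, Relation.ReflTransGen (fun a b => ∃ w, O η a b w) (.inl x) v := by
    rcases v with x | c
    · exact ⟨x, .refl⟩
    · exact ⟨c + 1, .single (exists_O_inl_inr (h1 c))⟩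
  obtain ⟨x, hx⟩ := hu
  obtain ⟨y, hy⟩ := hv
  exact (hx.trans (hll x y)).trans hy

theorem exists_link (hη : ∀ u, u ∈ Subgroup.zpowers η) (hp : p % 4 = 1) (v : ZMod p ⊕ ZMod p) :
    ∃ (n : ℕ) (l : ℕ → ZMod p ⊕ ZMod p), 4 ≤ n ∧ Function.Periodic l n ∧
      Set.InjOn l (Set.Iio n) ∧ ∀ x y, O η v x y ↔ ∃ k, x = l k ∧ y = l (k + 1) := by
  have := five_le hp
  rcases v with x | c
  · exact ⟨2 * (p - 1), vertexLink η x, by omega, vertexLink_periodic hη hp x,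
      vertexLink_injOn hη hp x, link_vertex hη hp x⟩
  · refine ⟨p - 1, fun k => .inl (c + (η : ZMod p) ^ k), by omega, fun k => ?_, ?_,
      link_center hη c⟩
    · simp only [pow_add_period hη]
    · intro i hi j hj h
      exact pow_inj hη hi hj (add_left_cancel (Sum.inl.inj h))

/-- The orientable triangulation of a closed surface whose `1`-skeleton contains the complete graph
on `ZMod p`. -/
noncomputable def triangulation (hη : ∀ u, u ∈ Subgroup.zpowers η) (hp : p % 4 = 1) :
    OrientedTriangulation (Fintype.card (ZMod p ⊕ ZMod p)) where
  O x y z := O η ((Fintype.equivFin _).symm x) ((Fintype.equivFin _).symm y)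
    ((Fintype.equivFin _).symm z)
  cyc h := O_rotate η h
  ne h := fun e => O_ne hη hp h (by rw [e])
  link v := by
    obtain ⟨n, l, hn, hper, hinj, hO⟩ := exists_link hη hp ((Fintype.equivFin _).symm v)
    refine ⟨n, fun k => Fintype.equivFin _ (l k), hn, fun k => by simp only [hper k],
      fun i hi j hj h => hinj hi hj ((Fintype.equivFin _).injective h), fun x y => ?_⟩
    simp only [hO, Equiv.symm_apply_eq]
  reachable v w := by
    have := (reachable hη hp ((Fintype.equivFin _).symm v) ((Fintype.equivFin _).symm w)).lift
      (p := fun x y => ∃ z, O η ((Fintype.equivFin _).symm x) ((Fintype.equivFin _).symm y)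
        ((Fintype.equivFin _).symm z)) (Fintype.equivFin _) (fun a b ⟨c, hc⟩ =>
          ⟨Fintype.equivFin _ c, by simpa using hc⟩)
    simpa [Function.onFun] using this
  pos := Fintype.card_pos

end BiggsMap

/-- Every finite complete graph is contained in the `1`-skeleton of a closed oriented surface. -/
theorem OrientedTriangulation.exists_complete (V : Type*) [Finite V] :
    ∃ (N : ℕ) (S : OrientedTriangulation N) (f : V → Fin N), Function.Injective f ∧
      ∀ u v, u ≠ v → ∃ z, S.O (f u) (f v) z := by
  obtain ⟨p, hp, hlt, hmod⟩ := Nat.exists_prime_gt_modEq_one (k := 4) (Nat.card V) (by norm_num)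
  have : Fact p.Prime := ⟨hp⟩
  have hmod : p % 4 = 1 := hmod
  obtain ⟨η, hη⟩ := IsCyclic.exists_generator (α := (ZMod p)ˣ)
  have := Fintype.ofFinite V
  obtain ⟨ι⟩ : Nonempty (V ↪ ZMod p) := Function.Embedding.nonempty_of_card_le (by
    rw [ZMod.card, ← Nat.card_eq_fintype_card]; exact hlt.le)
  refine ⟨_, BiggsMap.triangulation hη hmod, fun v => Fintype.equivFin _ (.inl (ι v)),
    fun u v h => ι.injective (Sum.inl.inj ((Fintype.equivFin _).injective h)), fun u v huv => ?_⟩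
  obtain ⟨w, hw⟩ := BiggsMap.exists_O_inl_inl hη hmod (ι.injective.ne huv)
  exact ⟨Fintype.equivFin _ w, by simpa [BiggsMap.triangulation] using hw⟩

theorem OrientedTriangulation.exists_face_eq_pair {N : ℕ} (S : OrientedTriangulation N) {V : Type*}
    {f : V → Fin N} (h : ∀ u v, u ≠ v → ∃ z, S.O (f u) (f v) z) (u v : V) :
    ∃ s ∈ S.complex.faces, (s : Set (EuclideanSpace ℝ (Fin N))) = {pt (f u), pt (f v)} := by
  obtain ⟨x, y, z, hO, hsub⟩ : ∃ x y z, S.O x y z ∧ ({f u, f v} : Finset (Fin N)) ⊆ {x, y, z} := by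
    by_cases huv : u = v
    · obtain ⟨n, l, -, -, -, hl⟩ := S.link (f u)
      exact ⟨f u, _, _, (hl _ _).2 ⟨0, rfl, rfl⟩, by simp [huv]⟩
    · obtain ⟨z, hz⟩ := h u v huv
      exact ⟨f u, f v, z, hz, by intro i; simp; tauto⟩
  exact ⟨({f u, f v} : Finset (Fin N)).image pt, ⟨by simp, x, y, z, hO, image_subset_image hsub⟩,
    by simp⟩

end

theorem lemma5p3 :
    (∀ (E : Type*) [AddCommGroup E] [Module ℝ E] (X L : Geometry.SimplicialComplex ℝ E),
      (∀ s ∈ X.faces, s.card ≤ 3) → L ≤ X → L.IsFlagNoSquare →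
      ∃ X' : Geometry.SimplicialComplex ℝ E,
        X'.IsSubdivision X ∧ X'.IsFlagNoSquare ∧ L.IsFullSubcomplex X') ∧
    (∀ (V : Type*) [Finite V] (Γ : SimpleGraph V), 5 ≤ Γ.egirth →
      ∃ (N : ℕ) (K : Geometry.SimplicialComplex ℝ (EuclideanSpace ℝ (Fin N))),
        K.TriangulatesClosedOrientableSurface ∧ K.IsFlagNoSquare ∧
        Γ.IsIndContained K.edgeGraph) := by
  refine ⟨fun E _ _ X L hX hLX hL => ⟨Geometry.SimplicialComplex.relSubdivision hX hL.1,
    Geometry.SimplicialComplex.relSubdivision_isSubdivision hX hL.1,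
    Geometry.SimplicialComplex.isFlagNoSquare_relSubdivision hX hL hLX,
    Geometry.SimplicialComplex.isFullSubcomplex_relSubdivision hX hL.1 hLX⟩, fun V _ Γ hΓ => ?_⟩
  obtain ⟨N, S, f, hf, hO⟩ := OrientedTriangulation.exists_complete V
  obtain ⟨K, hsub, hfin, hK, hind⟩ := Geometry.SimplicialComplex.exists_subdivision_isIndContained
    (fun s hs => S.card_le_three_of_mem_faces hs) (OrientedTriangulation.pt_injective.comp hf)
    (S.exists_face_eq_pair hO) hΓ
  exact ⟨N, K, ⟨hfin S.finite_faces, hsub.space_eq ▸ S.isClosedSurface,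
    S.isOrientable_of_isSubdivision hsub⟩, hK, hind⟩
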